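/- Let $0\neq\nu<1$. Let $I_\mu(w)=\sum_{n\ge 0}\frac{(w/2)^{2n+\mu}}{\Gamma(n+1)\Gamma(n+\mu+1)}$ ($\mu>-1$, $w>0$) be the modified Bessel function, let $d\eta_\nu(y)=y^{2\nu+1}dy$ on $\mathbb{R}_+=(0,\infty)$, and for $t,x,y>0$ let $$\widetilde W_t^\nu(x,y)=(xy)^{-2\nu}\,\frac1{2t}(xy)^{\nu}e^{-(x^2+y^2)/4t}I_{-\nu}\Big(\frac{xy}{2t}\Big),$$ $$\widetilde W_t^\nu f(x)=\int_0^\infty \widetilde W_t^\nu(x,y)f(y)\,d\eta_\nu(y),\qquad \widetilde W_*^\nu f(x)=\sup_{t>0}\big|\widetilde W_t^\nu f(x)\big|,$$ the latter two being defined for the measurable $f$ for which the integrals converge absolutely for all $t,x>0$. For $1\le p\le\infty$ and $\delta\in\mathbb{R}$, say that $\widetilde W_*^\nu$ is of strong type $(p,p)$ if it is defined and bounded on $L^p(\mathbb{R}_+,x^\delta dx)$. For $1\le p<\infty$, say that it is of weak type $(p,p)$ if it is defined on $L^p(\mathbb{R}_+,x^\delta dx)$ and there is a constant $C<\infty$ with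 $$\lambda^p\int_{\{x>0:\ \widetilde W_*^\nu f(x)>\lambda\}}x^\delta\,dx\le C\int_0^\infty|f(x)|^p x^\delta\,dx$$ for all $\lambda>0$ and all $f\in L^p(\mathbb{R}_+,x^\delta dx)$; and say that it is of restricted weak type $(p,p)$ if it is defined on, and satisfies this estimate with one constant $C$ for, all characteristic functions $f$ of measurable sets of finite $x^\delta dx$ measure. Let $1\le p<\infty$ and $\delta\in\mathbb{R}$. Then, with respect to $(\mathbb{R}_+,x^\delta dx)$: (a) $\widetilde W_*^\nu$ is of strong type $(p,p)$ if and only if $p>1$ and $2\nu p-1<\delta<2p-1$; (b) $\widetilde W_*^\nu$ is of weak type $(p,p)$ if and only if $2\nu p-1\le\delta<2p-1$, where in case $p=1$ the second inequality is replaced by $\delta\le 2p-1$; (c) $\widetilde W_*^\nu$ is of restricted weak type $(p,p)$ if and only if $2\nu p-1\le\delta\le 2p-1$. Moreover, $\widetilde W_*^\nu$ is of strong type $(\infty,\infty)$ if and only if $\nu<0$. -/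

import Mathlib

open MeasureTheory Set
open scoped ENNReal NNReal

noncomputable section

/-- The modified Bessel function of the first kind `I_μ(w)`, by its power series
(used for `w > 0` and `μ > -1`, where the series converges absolutely). -/
def besselI (μ w : ℝ) : ℝ :=
  ∑' n : ℕ, (w / 2) ^ (2 * (n : ℝ) + μ) / (Real.Gamma ((n : ℝ) + 1) * Real.Gamma ((n : ℝ) + μ + 1))

/-- The measure `x^δ dx` on `(0, ∞)`, seen as a measure on `ℝ` that does not charge `(-∞, 0]`. -/
def powerMeasure (δ : ℝ) : Measure ℝ :=
  (volume.restrict (Ioi 0)).withDensity fun x => ENNReal.ofReal (x ^ δ)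

/-- The measure `dη_ν(x) = x^(2ν+1) dx` on `(0, ∞)`. -/
def eta (ν : ℝ) : Measure ℝ := powerMeasure (2 * ν + 1)

/-- The classical Bessel heat kernel `W_t^ν(x, y)` with respect to `η_ν` (for `ν > -1`). -/
def classicalKernel (ν t x y : ℝ) : ℝ :=
  1 / (2 * t) * (x * y) ^ (-ν) * Real.exp (-(x ^ 2 + y ^ 2) / (4 * t)) * besselI ν (x * y / (2 * t))

/-- The exotic Bessel heat kernel with respect to `η_ν` (for `ν < 1`). -/
def exoticKernel (ν t x y : ℝ) : ℝ :=
  (x * y) ^ (-2 * ν) * classicalKernel (-ν) t x y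

/-- The exotic Bessel heat semigroup, as an integral operator. -/
def exoticSemigroup {𝕜 : Type*} [RCLike 𝕜] (ν t : ℝ) (f : ℝ → 𝕜) (x : ℝ) : 𝕜 :=
  ∫ y, exoticKernel ν t x y • f y ∂(eta ν)

/-- The natural domain of the exotic semigroup and of its maximal operator: the functions for
which the integrals defining the semigroup converge absolutely for all `t, x > 0`. -/
def exoticDomain (𝕜 : Type*) [RCLike 𝕜] (ν : ℝ) : Set (ℝ → 𝕜) :=
  {f | ∀ t : ℝ, 0 < t → ∀ x : ℝ, 0 < x → Integrable (fun y => exoticKernel ν t x y • f y) (eta ν)}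

/-- The exotic Bessel heat maximal operator `f ↦ sup_{t > 0} |W̃_t^ν f|`, with values in
`[0, ∞]`. It is meaningful on `exoticDomain 𝕜 ν`. -/
def exoticMaximal {𝕜 : Type*} [RCLike 𝕜] (ν : ℝ) (f : ℝ → 𝕜) (x : ℝ) : ℝ≥0∞ :=
  ⨆ (t : ℝ) (_ : 0 < t), ‖exoticSemigroup ν t f x‖ₑ

/-- An operator `T` with domain `D` is of strong type `(p, p)`, `p ≤ ∞`, with respect to
`((0, ∞), x^δ dx)`: it is defined on all of `L^p(x^δ dx)` and bounded on this space. -/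
def IsStrongType {𝕜 : Type*} [RCLike 𝕜] (D : Set (ℝ → 𝕜)) (T : (ℝ → 𝕜) → ℝ → ℝ≥0∞)
    (δ : ℝ) (p : ℝ≥0∞) : Prop :=
  ∃ C : ℝ≥0, ∀ f : ℝ → 𝕜, MemLp f p (powerMeasure δ) →
    f ∈ D ∧ AEMeasurable (T f) (powerMeasure δ) ∧
      eLpNorm (T f) p (powerMeasure δ) ≤ C * eLpNorm f p (powerMeasure δ)

/-- An operator `T` with domain `D` is of weak type `(p, p)`, `1 ≤ p < ∞`, with respect to
`((0, ∞), x^δ dx)`: it is defined on all of `L^p(x^δ dx)` and satisfies there the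
weak type estimate for all levels `s > 0`. -/
def IsWeakType {𝕜 : Type*} [RCLike 𝕜] (D : Set (ℝ → 𝕜)) (T : (ℝ → 𝕜) → ℝ → ℝ≥0∞)
    (δ p : ℝ) : Prop :=
  ∃ C : ℝ≥0, ∀ f : ℝ → 𝕜, MemLp f (ENNReal.ofReal p) (powerMeasure δ) →
    f ∈ D ∧ AEMeasurable (T f) (powerMeasure δ) ∧
      ∀ s : ℝ, 0 < s →
        ENNReal.ofReal (s ^ p) * powerMeasure δ {x | 0 < x ∧ ENNReal.ofReal s < T f x} ≤
          C * ∫⁻ x, ‖f x‖ₑ ^ p ∂(powerMeasure δ)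

/-- An operator `T` with domain `D` is of restricted weak type `(p, p)`, `1 ≤ p < ∞`, with respect
to `((0, ∞), x^δ dx)`: the weak type estimate holds for characteristic functions of
measurable sets of finite `x^δ dx` measure. -/
def IsRestrictedWeakType {𝕜 : Type*} [RCLike 𝕜] (D : Set (ℝ → 𝕜)) (T : (ℝ → 𝕜) → ℝ → ℝ≥0∞)
    (δ p : ℝ) : Prop :=
  ∃ C : ℝ≥0, ∀ E : Set ℝ, E ⊆ Ioi 0 → MeasurableSet E → powerMeasure δ E < ∞ →
    E.indicator (fun _ => (1 : 𝕜)) ∈ D ∧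
    AEMeasurable (T (E.indicator fun _ => (1 : 𝕜))) (powerMeasure δ) ∧
      ∀ s : ℝ, 0 < s →
        ENNReal.ofReal (s ^ p) *
            powerMeasure δ {x | 0 < x ∧ ENNReal.ofReal s < T (E.indicator fun _ => (1 : 𝕜)) x} ≤
          C * powerMeasure δ E

end

/-!
The series of the modified Bessel function has coefficients comparable to
`1 / ((2n)! (2n + 1) ^ (μ + 1/2))`, and a sum of such terms is an expectation of a power of a Poisson
variable. This gives `I_μ(w) ≈ w ^ μ (1 + w) ^ (-μ - 1/2) e ^ w` for all `w > 0`
(`exists_besselSeries_bounds`), hence two-sided Gaussian bounds for the kernel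
(`exists_heatDensity_bounds`).

*Upper bounds.* For `y` far below, near and far above `x` these bounds dominate the semigroup by the
Hardy operator `x ^ (-2) ∫_0^x y g dy`, by a local Hardy–Littlewood maximal function, and by the dual
Hardy operator `x ^ (-2ν) ∫_x^∞ y ^ (2ν - 1) g dy` localized at `y ≈ √t` (`exists_posSemigroup_le`).

* The local maximal function only sees intervals on which `x ^ δ` is almost constant. It is of weak
  type `(1, 1)` by the Vitali covering lemma and bounded on `L^p`, `p > 1`, by interpolation, for
  every `δ`.
* The Hardy operators are bounded on `L^p(x^δ dx)` for `δ < 2p - 1` and `δ > 2νp - 1`, respectively, by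
  Schur's test (`hardyOp_strong`).
* At `δ = 2p - 1` the first one is at most `x ^ (-2)` times the norm, on characteristic functions or for
  `p = 1`. At `δ = 2νp - 1` the localized second one is at most `x ^ (-2ν)` times the norm, by
  Hölder's inequality. Both powers lie in weak `L^p` (`exists_rpow_weak`); for the second this
  uses `ν ≠ 0`.

A weak type bound makes the maximal function finite almost everywhere, and since finiteness of the
integrals at a point implies finiteness at all smaller points, they converge everywhere.

*Lower bounds.* The maximal function of the characteristic function of `(1, 2)` is at least a multiple of
`x ^ (-2ν)` near the origin and of `x ^ (-2)` at infinity, which gives the conditions on `δ`. Functions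
`y ^ (-2)` on `(ε, 1)` rule out the weak type at `δ = 2p - 1`, `p > 1`; functions concentrated near a point
rule out the strong type `(1, 1)`; the constant `1` rules out `L^∞` for `ν > 0`.
-/

open Filter Topology

/-! ### The modified Bessel function -/

/-- The entire factor of the modified Bessel function: `I_μ(w) = (w / 2) ^ μ * besselSeries μ w`. -/
noncomputable def besselSeries (μ w : ℝ) : ℝ :=
  ∑' n : ℕ, (w / 2) ^ (2 * n) / ((n.factorial : ℝ) * Real.Gamma ((n : ℝ) + μ + 1))

theorem besselI_eq_rpow_mul_besselSeries (μ : ℝ) {w : ℝ} (hw : 0 < w) :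
    besselI μ w = (w / 2) ^ μ * besselSeries μ w := by
  rw [besselI, besselSeries, ← tsum_mul_left]
  refine tsum_congr fun n => ?_
  rw [Real.rpow_add (by positivity), Real.Gamma_nat_eq_factorial,
    show (2 * (n : ℝ)) = ((2 * n : ℕ) : ℝ) by push_cast; ring, Real.rpow_natCast]
  ring

theorem exists_bounds_of_tendsto_one {v : ℕ → ℝ} (hv : ∀ n, 0 < v n)
    (h : Tendsto v atTop (𝓝 1)) : ∃ c C : ℝ, 0 < c ∧ 0 < C ∧ ∀ n, c ≤ v n ∧ v n ≤ C := by
  obtain ⟨C, hC⟩ := h.bddAbove_range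
  obtain ⟨D, hD⟩ := (h.inv₀ one_ne_zero).bddAbove_range
  have hC' : ∀ n, v n ≤ C := fun n => hC ⟨n, rfl⟩
  have hD' : ∀ n, (v n)⁻¹ ≤ D := fun n => hD ⟨n, rfl⟩
  have hDpos : 0 < D := (inv_pos.2 (hv 0)).trans_le (hD' 0)
  exact ⟨D⁻¹, C, inv_pos.2 hDpos, (hv 0).trans_le (hC' 0), fun n =>
    ⟨inv_le_of_inv_le₀ (hv n) (hD' n), hC' n⟩⟩

theorem prod_add_mul_Gamma {s : ℝ} (hs : 0 < s) (n : ℕ) :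
    (∏ j ∈ Finset.range n, (s + j)) * Real.Gamma s = Real.Gamma (s + n) := by
  induction n with
  | zero => simp
  | succ n ih =>
    rw [Finset.prod_range_succ, mul_right_comm, ih, mul_comm, ← Real.Gamma_add_one (by positivity)]
    push_cast; ring_nf

/-- `Γ(n + μ + 1)` is comparable to `(n + 1) ^ μ * n!`, by Euler's limit formula for the Gamma
function. -/
theorem exists_Gamma_ratio_bounds {μ : ℝ} (hμ : -1 < μ) :
    ∃ c C : ℝ, 0 < c ∧ 0 < C ∧ ∀ n : ℕ,
      c ≤ ((n : ℝ) + 1) ^ μ * n.factorial / Real.Gamma (n + μ + 1) ∧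
        ((n : ℝ) + 1) ^ μ * n.factorial / Real.Gamma (n + μ + 1) ≤ C := by
  have hpos : ∀ n : ℕ, 0 < Real.Gamma (n + μ + 1) := fun n => Real.Gamma_pos_of_pos (by
    have : (0 : ℝ) ≤ n := n.cast_nonneg
    linarith)
  refine exists_bounds_of_tendsto_one (fun n => div_pos (by positivity) (hpos n)) ?_
  have hs : 0 < μ + 1 := by linarith
  have hG := Real.Gamma_pos_of_pos hs
  have h1 := (Real.GammaSeq_tendsto_Gamma (μ + 1)).div_const (Real.Gamma (μ + 1))
  rw [div_self hG.ne'] at h1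
  have hinv : Tendsto (fun n : ℕ => (n : ℝ)⁻¹) atTop (𝓝 0) := tendsto_inv_atTop_nhds_zero_nat
  have h2 : Tendsto (fun n : ℕ => (1 + (n : ℝ)⁻¹) ^ μ) atTop (𝓝 1) := by
    have := (hinv.const_add 1).rpow_const (p := μ) (Or.inl (by norm_num))
    simpa using this
  have h3 : Tendsto (fun n : ℕ => 1 + (μ + 1) * (n : ℝ)⁻¹) atTop (𝓝 1) := by
    simpa using (hinv.const_mul (μ + 1)).const_add 1
  have h4 := (h1.mul h2).mul h3
  rw [one_mul, one_mul] at h4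
  refine h4.congr' ?_
  filter_upwards [eventually_gt_atTop 0] with n hn
  have hn' : (0 : ℝ) < n := by exact_mod_cast hn
  have hprod := prod_add_mul_Gamma hs (n + 1)
  have hGn : Real.Gamma (μ + 1 + (n + 1 : ℕ)) = (n + μ + 1) * Real.Gamma (n + μ + 1) := by
    rw [← Real.Gamma_add_one (by linarith)]
    congr 1; push_cast; ring
  rw [hGn] at hprod
  have e1 : (1 + (n : ℝ)⁻¹) ^ μ = ((n : ℝ) + 1) ^ μ / (n : ℝ) ^ μ := by
    rw [← Real.div_rpow (by positivity) (by positivity)]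
    congr 1; field_simp
  have hP : (∏ j ∈ Finset.range (n + 1), (μ + 1 + (j : ℝ)))
      = (n + μ + 1) * Real.Gamma (n + μ + 1) / Real.Gamma (μ + 1) := by
    rw [← hprod, mul_div_cancel_right₀ _ hG.ne']
  rw [Real.GammaSeq, hP, e1, Real.rpow_add_one hn'.ne']
  have := hpos n
  have h5 : (0 : ℝ) < n + μ + 1 := by linarith
  have h6 : 0 < (n : ℝ) ^ μ := by positivity
  field_simp
  ring

/-- The central binomial coefficient is comparable to `4 ^ n / √(n + 1)`; in squared form both bounds
are provable by induction. -/
theorem sq_four_pow_bounds (n : ℕ) :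
    ((n : ℝ) + 1) * (n.centralBinom : ℝ) ^ 2 ≤ (4 ^ n) ^ 2 ∧
      (4 ^ n) ^ 2 ≤ 4 * ((n : ℝ) + 1) * (n.centralBinom : ℝ) ^ 2 := by
  have hrec : ∀ n : ℕ, ((n : ℝ) + 1) * ((n + 1).centralBinom : ℝ)
      = 2 * (2 * n + 1) * n.centralBinom := fun n => by
    exact_mod_cast Nat.succ_mul_centralBinom_succ n
  constructor
  · induction n with
    | zero => simp
    | succ n ih =>
      have h := hrec n
      have hb : ((n + 1).centralBinom : ℝ) = 2 * (2 * n + 1) * n.centralBinom / (n + 1) := by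
        rw [← h]; field_simp
      rw [hb]; push_cast
      have : ((n : ℝ) + 1 + 1) * (2 * (2 * n + 1) * n.centralBinom / (n + 1)) ^ 2
        = (n + 1) * (n.centralBinom : ℝ) ^ 2 * (4 * (n + 2) * (2 * n + 1) ^ 2 / (n + 1) ^ 3) := by
        field_simp; ring
      rw [this, show ((4 : ℝ) ^ (n + 1)) ^ 2 = (4 ^ n) ^ 2 * 16 by ring]
      gcongr
      rw [div_le_iff₀ (by positivity)]
      have : (0 : ℝ) ≤ n := n.cast_nonneg
      nlinarith [mul_nonneg this this]
  · suffices H : ∀ n : ℕ, ((4 : ℝ) ^ (n + 1)) ^ 2 ≤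
        4 * ((n : ℝ) + 1) * ((n + 1).centralBinom : ℝ) ^ 2 by
      rcases n with _ | n
      · simp
      · refine (H n).trans ?_
        push_cast
        gcongr
        linarith
    intro n
    induction n with
    | zero => norm_num [Nat.centralBinom, Nat.choose]
    | succ n ih =>
      have h := hrec (n + 1)
      push_cast at h
      have hb : ((n + 1 + 1).centralBinom : ℝ)
          = 2 * (2 * (n + 1) + 1) * (n + 1).centralBinom / (n + 1 + 1) := by
        rw [← h]; field_simp
      rw [hb]; push_cast
      have : 4 * ((n : ℝ) + 1 + 1) * (2 * (2 * (n + 1) + 1) * (n + 1).centralBinom / (n + 1 + 1)) ^ 2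
        = 4 * (n + 1) * ((n + 1).centralBinom : ℝ) ^ 2 *
          (4 * (2 * n + 3) ^ 2 / ((n + 1) * (n + 2))) := by
        field_simp; ring
      rw [this, show ((4 : ℝ) ^ (n + 1 + 1)) ^ 2 = (4 ^ (n + 1)) ^ 2 * 16 by ring]
      gcongr
      rw [le_div_iff₀ (by positivity)]
      have : (0 : ℝ) ≤ n := n.cast_nonneg
      nlinarith [mul_nonneg this this]

theorem rpow_le_two_rpow_abs_mul {x y a : ℝ} (hx : 0 < x) (hy : 0 < y) (h1 : x ≤ 2 * y) (h2 : y ≤ 2 * x) :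
    x ^ a ≤ 2 ^ |a| * y ^ a := by
  have hq : x ^ a = (x / y) ^ a * y ^ a := by
    rw [← Real.mul_rpow (by positivity) hy.le, div_mul_cancel₀ _ hy.ne']
  rw [hq]
  gcongr
  have hlo : 1 / 2 ≤ x / y := by rw [div_le_div_iff₀ (by norm_num) hy]; linarith
  have hup : x / y ≤ 2 := by rw [div_le_iff₀ hy]; exact h1
  rcases le_total 0 a with ha | ha
  · rw [abs_of_nonneg ha]; gcongr
  · rw [abs_of_nonpos ha, Real.rpow_neg (by norm_num), ← Real.inv_rpow (by norm_num)]
    exact Real.rpow_le_rpow_of_nonpos (by norm_num) (by simpa using hlo) ha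

/-- The coefficients of `besselSeries μ` are comparable to `1 / ((2 n)! (2 n + 1) ^ (μ + 1 / 2))`. -/
theorem exists_besselSeries_coeff_bounds {μ : ℝ} (hμ : -1 < μ) :
    ∃ c C : ℝ, 0 < c ∧ 0 < C ∧ ∀ n : ℕ,
      c * (((2 * n : ℕ) : ℝ) + 1) ^ (-(μ + 1 / 2)) / (2 * n).factorial ≤
        1 / (4 ^ n * ((n.factorial : ℝ) * Real.Gamma ((n : ℝ) + μ + 1))) ∧
      1 / (4 ^ n * ((n.factorial : ℝ) * Real.Gamma ((n : ℝ) + μ + 1))) ≤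
        C * (((2 * n : ℕ) : ℝ) + 1) ^ (-(μ + 1 / 2)) / (2 * n).factorial := by
  obtain ⟨c, C, hc, hC, h⟩ := exists_Gamma_ratio_bounds hμ
  set a := -(μ + 1 / 2) with ha
  set D : ℝ := 2 ^ |a| with hD
  have hDpos : 0 < D := by positivity
  refine ⟨c / (2 * D), C * D, by positivity, by positivity, fun n => ?_⟩
  have hG : 0 < Real.Gamma (n + μ + 1) := Real.Gamma_pos_of_pos (by
    have : (0 : ℝ) ≤ n := n.cast_nonneg
    linarith)
  have hn : (0 : ℝ) < n + 1 := by positivity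
  obtain ⟨b1, b2⟩ := sq_four_pow_bounds n
  set B : ℝ := (n.centralBinom : ℝ) with hB
  have hBpos : 0 < B := by rw [hB]; exact_mod_cast Nat.centralBinom_pos n
  have hfac : ((2 * n).factorial : ℝ) = B * n.factorial * n.factorial := by
    rw [hB]
    have := Nat.choose_mul_factorial_mul_factorial (show n ≤ 2 * n by omega)
    rw [show 2 * n - n = n by omega] at this
    rw [Nat.centralBinom]; exact_mod_cast this.symm
  set s := Real.sqrt ((n : ℝ) + 1) with hs
  have hspos : 0 < s := Real.sqrt_pos.2 hn
  have hs2 : s ^ 2 = n + 1 := Real.sq_sqrt hn.le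
  have b1' : s * B ≤ 4 ^ n := by
    refine le_of_sq_le_sq ?_ (by positivity)
    rw [mul_pow, hs2]; exact b1
  have b2' : (4 : ℝ) ^ n ≤ 2 * (s * B) := by
    refine le_of_sq_le_sq ?_ (by positivity)
    rw [mul_pow, mul_pow, hs2]; linarith
  have hpow : ((n : ℝ) + 1) ^ a = (((n : ℝ) + 1) ^ μ)⁻¹ * s⁻¹ := by
    rw [ha, neg_add, Real.rpow_add hn, Real.rpow_neg hn.le, Real.rpow_neg hn.le, hs,
      Real.sqrt_eq_rpow]
  have hm : (0 : ℝ) < ((n : ℝ) + 1) ^ μ := by positivity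
  have hle : (((2 * n : ℕ) : ℝ) + 1) ^ a ≤ D * ((n : ℝ) + 1) ^ a :=
    rpow_le_two_rpow_abs_mul (by positivity) hn (by push_cast; linarith)
      (by push_cast; linarith [n.cast_nonneg (α := ℝ)])
  have hge : ((n : ℝ) + 1) ^ a ≤ D * (((2 * n : ℕ) : ℝ) + 1) ^ a :=
    rpow_le_two_rpow_abs_mul hn (by positivity) (by push_cast; linarith [n.cast_nonneg (α := ℝ)])
      (by push_cast; linarith)
  obtain ⟨g1, g2⟩ := h n
  set v := ((n : ℝ) + 1) ^ μ * n.factorial / Real.Gamma (n + μ + 1) with hv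
  have hvG : 1 / Real.Gamma (n + μ + 1) = v / (((n : ℝ) + 1) ^ μ * n.factorial) := by
    rw [hv]; field_simp
  have hF : (0 : ℝ) < n.factorial := by positivity
  have key : 1 / (4 ^ n * ((n.factorial : ℝ) * Real.Gamma ((n : ℝ) + μ + 1)))
      = v * (s * B / 4 ^ n) * ((n : ℝ) + 1) ^ a / (2 * n).factorial := by
    rw [hpow, hfac]
    calc _ = 1 / 4 ^ n / n.factorial * (1 / Real.Gamma (n + μ + 1)) := by field_simp
      _ = _ := by rw [hvG]; field_simp
  rw [key]
  constructor
  · refine div_le_div_of_nonneg_right ?_ (by positivity)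
    calc c / (2 * D) * (((2 * n : ℕ) : ℝ) + 1) ^ a
        ≤ c / (2 * D) * (D * ((n : ℝ) + 1) ^ a) := by gcongr
      _ = c * (1 / 2) * ((n : ℝ) + 1) ^ a := by field_simp
      _ ≤ v * (s * B / 4 ^ n) * ((n : ℝ) + 1) ^ a := by
        have : (1 : ℝ) / 2 ≤ s * B / 4 ^ n := by
          rw [div_le_div_iff₀ (by norm_num) (by positivity)]; linarith
        gcongr
  · refine div_le_div_of_nonneg_right ?_ (by positivity)
    calc v * (s * B / 4 ^ n) * ((n : ℝ) + 1) ^ a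
        ≤ C * 1 * (D * (((2 * n : ℕ) : ℝ) + 1) ^ a) := by
          have : s * B / 4 ^ n ≤ 1 := by rw [div_le_one (by positivity)]; exact b1'
          gcongr
      _ = _ := by ring

theorem hasSum_exp_series (w : ℝ) : HasSum (fun m : ℕ => w ^ m / m.factorial) (Real.exp w) := by
  rw [Real.exp_eq_exp_ℝ]
  exact NormedSpace.expSeries_div_hasSum_exp w

theorem factorial_add_le (m k : ℕ) :
    (m + k).factorial ≤ m.factorial * k.factorial * (m + 1) ^ k := by
  induction k with
  | zero => simp
  | succ k ih =>
    rw [← add_assoc, Nat.factorial_succ, Nat.factorial_succ, pow_succ]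
    calc (m + k + 1) * (m + k).factorial
        ≤ ((k + 1) * (m + 1)) * (m.factorial * k.factorial * (m + 1) ^ k) := by
          gcongr; nlinarith
      _ = _ := by ring

/-- Negative moments of a Poisson variable `N` of parameter `w`: `E[(N + 1)⁻ᵏ] ≲ (1 + w)⁻ᵏ`. -/
theorem poisson_negative_moment (k : ℕ) {w : ℝ} (hw : 0 ≤ w) :
    Summable (fun m : ℕ => w ^ m / m.factorial * ((1 + w) / (m + 1)) ^ k) ∧
    ∑' m : ℕ, w ^ m / m.factorial * ((1 + w) / (m + 1)) ^ k ≤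
      2 ^ k * (1 + k.factorial) * Real.exp w := by
  have hs := hasSum_exp_series w
  have hshift : Summable (fun m : ℕ => w ^ (m + k) / (m + k).factorial) :=
    (summable_nat_add_iff (f := fun m : ℕ => w ^ m / (m.factorial : ℝ)) k).2 hs.summable
  have hle : ∑' m : ℕ, w ^ (m + k) / (m + k).factorial ≤ Real.exp w := by
    rw [← hs.tsum_eq]
    exact tsum_comp_le_tsum_of_inj hs.summable (fun n => by positivity) (add_left_injective k)
  have hbd : ∀ m : ℕ, w ^ m / m.factorial * ((1 + w) / (m + 1)) ^ k ≤
      2 ^ k * (w ^ m / m.factorial + k.factorial * (w ^ (m + k) / (m + k).factorial)) := by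
    intro m
    have h1 : (1 + w) ^ k ≤ 2 ^ k * (1 + w ^ k) := by
      rcases le_total w 1 with h | h
      · calc (1 + w) ^ k ≤ 2 ^ k := by gcongr; linarith
          _ ≤ _ := le_mul_of_one_le_right (by positivity) (by linarith [pow_nonneg hw k])
      · calc (1 + w) ^ k ≤ (2 * w) ^ k := by gcongr; linarith
          _ = 2 ^ k * w ^ k := mul_pow _ _ _
          _ ≤ _ := by gcongr; linarith
    have h2 : ((m + k).factorial : ℝ) ≤ m.factorial * k.factorial * ((m : ℝ) + 1) ^ k := by
      exact_mod_cast factorial_add_le m k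
    have h3 : (1 : ℝ) ≤ ((m : ℝ) + 1) ^ k := one_le_pow₀ (by linarith [m.cast_nonneg (α := ℝ)])
    calc w ^ m / m.factorial * ((1 + w) / (m + 1)) ^ k
        ≤ w ^ m / m.factorial * (2 ^ k * (1 + w ^ k) / ((m : ℝ) + 1) ^ k) := by
          rw [div_pow]; gcongr
      _ = 2 ^ k * (w ^ m / m.factorial / ((m : ℝ) + 1) ^ k +
          k.factorial * (w ^ (m + k) / (m.factorial * k.factorial * ((m : ℝ) + 1) ^ k))) := by
          rw [pow_add]; field_simp
      _ ≤ _ := by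
          refine mul_le_mul_of_nonneg_left (add_le_add (div_le_self (by positivity) h3) ?_)
            (by positivity)
          gcongr
  have hsum : Summable fun m : ℕ =>
      2 ^ k * (w ^ m / m.factorial + k.factorial * (w ^ (m + k) / (m + k).factorial)) :=
    (hs.summable.add (hshift.mul_left _)).mul_left _
  have hS := Summable.of_nonneg_of_le (fun m => by positivity) hbd hsum
  refine ⟨hS, (hS.tsum_le_tsum hbd hsum).trans ?_⟩
  rw [tsum_mul_left, hs.summable.tsum_add (hshift.mul_left _), tsum_mul_left, hs.tsum_eq, mul_assoc]
  gcongr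
  rw [add_mul, one_mul]
  gcongr

/-- The mean of `N + 1` for a Poisson variable `N` of parameter `w` is `1 + w`. -/
theorem poisson_mean {w : ℝ} (hw : 0 ≤ w) :
    HasSum (fun m : ℕ => w ^ m / m.factorial * ((1 + w) / (m + 1))⁻¹) (Real.exp w) := by
  have hs := hasSum_exp_series w
  have h1 : HasSum (fun m : ℕ => w ^ m / m.factorial * m) (w * Real.exp w) := by
    rw [← hasSum_nat_add_iff' 1]
    simp only [Finset.range_one, Finset.sum_singleton, Nat.cast_zero, mul_zero, sub_zero]
    convert! hs.mul_left w using 2 with m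
    rw [Nat.factorial_succ]; push_cast; field_simp; ring
  have h2 := (h1.add hs).mul_left (1 + w)⁻¹
  have e : (1 + w)⁻¹ * (w * Real.exp w + Real.exp w) = Real.exp w := by
    field_simp; ring
  rw [e] at h2
  convert! h2 using 2 with m
  field_simp

theorem rpow_le_inv_add_pow {r a : ℝ} {k : ℕ} (hr : 0 < r) (ha : -1 ≤ a) (hk : a ≤ k) :
    r ^ a ≤ r⁻¹ + r ^ k := by
  rcases le_total r 1 with h | h
  · have : r ^ a ≤ r ^ (-1 : ℝ) := Real.rpow_le_rpow_of_exponent_ge hr h ha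
    rw [Real.rpow_neg_one] at this
    linarith [pow_pos hr k]
  · have : r ^ a ≤ r ^ (k : ℝ) := Real.rpow_le_rpow_of_exponent_le h hk
    rw [Real.rpow_natCast] at this
    linarith [inv_pos.2 hr]

/-- Any power of `r` is bounded below where `r` is neither small nor large, and elsewhere `r⁻¹ + r` is
large. This is what turns upper bounds on moments into lower bounds. -/
theorem exists_one_le_mul_rpow_add (a : ℝ) {ε : ℝ} (hε : 0 < ε) :
    ∃ K : ℝ, 0 < K ∧ ∀ r : ℝ, 0 < r → 1 ≤ K * r ^ a + ε * (r⁻¹ + r) := by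
  refine ⟨ε ^ (-a) + ε⁻¹ ^ (-a), by positivity, fun r hr => ?_⟩
  have hra : 0 < r ^ a := by positivity
  have hprod : r ^ (-a) * r ^ a = 1 := by rw [← Real.rpow_add hr]; simp
  by_cases h1 : r < ε
  · have : 1 ≤ ε * r⁻¹ := by rw [← div_eq_mul_inv, one_le_div hr]; exact h1.le
    have h2 : 0 ≤ (ε ^ (-a) + ε⁻¹ ^ (-a)) * r ^ a := by positivity
    nlinarith [mul_pos hε hr]
  by_cases h2 : ε⁻¹ < r
  · have : 1 ≤ ε * r := by
      have := mul_le_mul_of_nonneg_left h2.le hε.le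
      rwa [mul_inv_cancel₀ hε.ne'] at this
    have h3 : 0 ≤ (ε ^ (-a) + ε⁻¹ ^ (-a)) * r ^ a := by positivity
    nlinarith [mul_pos hε (inv_pos.2 hr)]
  · push Not at h1 h2
    have h3 : r ^ (-a) ≤ ε ^ (-a) + ε⁻¹ ^ (-a) := by
      have p1 : 0 < ε ^ (-a) := by positivity
      have p2 : 0 < ε⁻¹ ^ (-a) := by positivity
      rcases le_total 0 (-a) with h | h
      · linarith [Real.rpow_le_rpow hr.le h2 h]
      · linarith [Real.rpow_le_rpow_of_nonpos hε h1 h]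
    have h4 : 1 ≤ (ε ^ (-a) + ε⁻¹ ^ (-a)) * r ^ a := by
      rw [← hprod]; gcongr
    have : 0 ≤ ε * (r⁻¹ + r) := by positivity
    linarith

/-- The even terms of the exponential series, weighted by `(2 n + 1) ^ (-a)`, sum up to a quantity
comparable to `(1 + w) ^ (-a) * exp w`: under the Poisson law of parameter `w` the variable
`N + 1` concentrates around `1 + w`, and its moments of order `-k` and `1` control
the power `-a`. -/
theorem exists_even_exp_series_bounds {a : ℝ} (ha : -1 ≤ a) :
    ∃ c C : ℝ, 0 < c ∧ 0 < C ∧ ∀ w : ℝ, 0 ≤ w →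
      Summable (fun n : ℕ => w ^ (2 * n) / (2 * n).factorial * (((2 * n : ℕ) : ℝ) + 1) ^ (-a)) ∧
      c * (1 + w) ^ (-a) * Real.exp w ≤
        ∑' n : ℕ, w ^ (2 * n) / (2 * n).factorial * (((2 * n : ℕ) : ℝ) + 1) ^ (-a) ∧
      ∑' n : ℕ, w ^ (2 * n) / (2 * n).factorial * (((2 * n : ℕ) : ℝ) + 1) ^ (-a) ≤
        C * (1 + w) ^ (-a) * Real.exp w := by
  obtain ⟨k, hk⟩ := exists_nat_ge a
  set A : ℝ := 2 ^ k * (1 + k.factorial) with hA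
  -- the moments of order `±1` add up to at most `5 * exp w`, and `cosh w ≥ exp w / 2`: with the
  -- weight `1 / 20` the moments take away only half of the lower bound
  obtain ⟨K, hK, hKr⟩ := exists_one_le_mul_rpow_add a (ε := 1 / 20) (by norm_num)
  refine ⟨1 / (4 * K), 1 + A, by positivity, by positivity, fun w hw => ?_⟩
  have hw1 : 0 < 1 + w := by linarith
  have hinj : Function.Injective (fun n : ℕ => 2 * n) := fun a b h => by simpa using h
  set P : ℕ → ℝ := fun m => w ^ m / m.factorial with hP
  set r : ℕ → ℝ := fun m => (1 + w) / ((m : ℝ) + 1) with hr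
  have hP0 : ∀ m, 0 ≤ P m := fun m => by positivity
  have hr0 : ∀ m, 0 < r m := fun m => by positivity
  have hmean := poisson_mean hw
  have hmom := poisson_negative_moment k hw
  have hmom1 := poisson_negative_moment 1 hw
  have hterm : ∀ n : ℕ, w ^ (2 * n) / (2 * n).factorial * (((2 * n : ℕ) : ℝ) + 1) ^ (-a)
      = (1 + w) ^ (-a) * (P (2 * n) * r (2 * n) ^ a) := by
    intro n
    have : r (2 * n) ^ a = (1 + w) ^ a * (((2 * n : ℕ) : ℝ) + 1) ^ (-a) := by
      rw [hr, Real.div_rpow hw1.le (by positivity), Real.rpow_neg (by positivity)]; rfl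
    rw [this]
    have h1 : (1 + w) ^ (-a) * (1 + w) ^ a = 1 := by rw [← Real.rpow_add hw1]; simp
    calc _ = ((1 + w) ^ (-a) * (1 + w) ^ a) * (P (2 * n) * (((2 * n : ℕ) : ℝ) + 1) ^ (-a)) := by
          rw [h1, one_mul]
      _ = _ := by ring
  have hup : ∀ m, P m * r m ^ a ≤ P m * (r m)⁻¹ + P m * r m ^ k := fun m => by
    rw [← mul_add]
    exact mul_le_mul_of_nonneg_left (rpow_le_inv_add_pow (hr0 m) ha hk) (hP0 m)
  have hup_sum : Summable fun m => P m * (r m)⁻¹ + P m * r m ^ k := hmean.summable.add hmom.1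
  have hS : Summable fun m => P m * r m ^ a :=
    Summable.of_nonneg_of_le (fun m => mul_nonneg (hP0 m) (by have := hr0 m; positivity)) hup hup_sum
  have hSe : Summable fun n => P (2 * n) * r (2 * n) ^ a := hS.comp_injective hinj
  simp only [hterm]
  refine ⟨hSe.mul_left _, ?_, ?_⟩
  · rw [tsum_mul_left]
    have hcosh : Real.exp w / 2 ≤ ∑' n, P (2 * n) := by
      have h := (Real.hasSum_cosh w).tsum_eq
      have h' : ∑' n, P (2 * n) = Real.cosh w := h
      rw [h', Real.cosh_eq]
      linarith [Real.exp_pos (-w)]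
    have hlow : ∀ n, P (2 * n) ≤ K * (P (2 * n) * r (2 * n) ^ a) +
        1 / 20 * (P (2 * n) * (r (2 * n))⁻¹ + P (2 * n) * r (2 * n) ^ 1) := fun n => by
      have := mul_le_mul_of_nonneg_left (hKr _ (hr0 (2 * n))) (hP0 (2 * n))
      rw [pow_one]; linarith
    have hA1 : Summable fun m => P m * (r m)⁻¹ + P m * r m ^ 1 := hmean.summable.add hmom1.1
    have hA1le : ∑' n, (P (2 * n) * (r (2 * n))⁻¹ + P (2 * n) * r (2 * n) ^ 1) ≤
        5 * Real.exp w := by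
      calc _ ≤ ∑' m, (P m * (r m)⁻¹ + P m * r m ^ 1) :=
            tsum_comp_le_tsum_of_inj hA1 (fun m => by have := hr0 m; have := hP0 m; positivity) hinj
        _ = _ := hmean.summable.tsum_add hmom1.1
        _ ≤ Real.exp w + 2 ^ 1 * (1 + (1 : ℕ).factorial) * Real.exp w :=
            add_le_add hmean.tsum_eq.le hmom1.2
        _ = _ := by norm_num; ring
    have hPe : Summable fun n => P (2 * n) := (hasSum_exp_series w).summable.comp_injective hinj
    have hA1e : Summable fun n => P (2 * n) * (r (2 * n))⁻¹ + P (2 * n) * r (2 * n) ^ 1 :=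
      hA1.comp_injective hinj
    have h1 := hPe.tsum_le_tsum hlow ((hSe.mul_left K).add (hA1e.mul_left (1 / 20)))
    rw [(hSe.mul_left K).tsum_add (hA1e.mul_left (1 / 20)), tsum_mul_left, tsum_mul_left] at h1
    have h2 : Real.exp w / 4 ≤ K * ∑' n, P (2 * n) * r (2 * n) ^ a := by
      linarith
    calc 1 / (4 * K) * (1 + w) ^ (-a) * Real.exp w
        = (1 + w) ^ (-a) * (Real.exp w / 4 / K) := by field_simp
      _ ≤ _ := by
        gcongr
        rw [div_le_iff₀ hK, mul_comm]; exact h2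
  · rw [tsum_mul_left, mul_comm (1 + A), mul_assoc]
    gcongr
    calc ∑' n, P (2 * n) * r (2 * n) ^ a ≤ ∑' m, P m * r m ^ a :=
          tsum_comp_le_tsum_of_inj hS (fun m => by have := hr0 m; have := hP0 m; positivity) hinj
      _ ≤ ∑' m, (P m * (r m)⁻¹ + P m * r m ^ k) := hS.tsum_le_tsum hup hup_sum
      _ = _ := hmean.summable.tsum_add hmom.1
      _ ≤ Real.exp w + A * Real.exp w := add_le_add hmean.tsum_eq.le hmom.2
      _ = _ := by ring

theorem besselSeries_term_eq (μ w : ℝ) (n : ℕ) :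
    (w / 2) ^ (2 * n) / ((n.factorial : ℝ) * Real.Gamma ((n : ℝ) + μ + 1)) =
      w ^ (2 * n) * (1 / (4 ^ n * ((n.factorial : ℝ) * Real.Gamma ((n : ℝ) + μ + 1)))) := by
  rw [div_pow, pow_mul (2 : ℝ)]
  norm_num
  ring

theorem Gamma_add_add_one_pos {μ : ℝ} (hμ : -1 < μ) (n : ℕ) : 0 < Real.Gamma ((n : ℝ) + μ + 1) :=
  Real.Gamma_pos_of_pos (by linarith [n.cast_nonneg (α := ℝ)])

/-- Two-sided bounds for the modified Bessel function, uniform on the whole half-line. -/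
theorem exists_besselSeries_bounds {μ : ℝ} (hμ : -1 < μ) :
    ∃ c C : ℝ, 0 < c ∧ 0 < C ∧ ∀ w : ℝ, 0 ≤ w →
      Summable (fun n : ℕ =>
        (w / 2) ^ (2 * n) / ((n.factorial : ℝ) * Real.Gamma ((n : ℝ) + μ + 1))) ∧
      c * (1 + w) ^ (-(μ + 1 / 2)) * Real.exp w ≤ besselSeries μ w ∧
      besselSeries μ w ≤ C * (1 + w) ^ (-(μ + 1 / 2)) * Real.exp w := by
  obtain ⟨c, C, hc, hC, h⟩ := exists_besselSeries_coeff_bounds hμ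
  obtain ⟨c', C', hc', hC', h'⟩ := exists_even_exp_series_bounds (a := μ + 1 / 2) (by linarith)
  refine ⟨c * c', C * C', by positivity, by positivity, fun w hw => ?_⟩
  obtain ⟨hS, hlo, hup⟩ := h' w hw
  set E : ℕ → ℝ := fun n =>
    w ^ (2 * n) / (2 * n).factorial * (((2 * n : ℕ) : ℝ) + 1) ^ (-(μ + 1 / 2)) with hE
  set S : ℕ → ℝ := fun n =>
    (w / 2) ^ (2 * n) / ((n.factorial : ℝ) * Real.Gamma ((n : ℝ) + μ + 1)) with hSdef
  have h1 : ∀ n, c * E n ≤ S n := fun n => by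
    simp only [hE, hSdef]
    rw [besselSeries_term_eq]
    calc _ = w ^ (2 * n) *
          (c * (((2 * n : ℕ) : ℝ) + 1) ^ (-(μ + 1 / 2)) / (2 * n).factorial) := by ring
      _ ≤ _ := mul_le_mul_of_nonneg_left (h n).1 (by positivity)
  have h2 : ∀ n, S n ≤ C * E n := fun n => by
    simp only [hE, hSdef]
    rw [besselSeries_term_eq]
    calc _ ≤ w ^ (2 * n) *
          (C * (((2 * n : ℕ) : ℝ) + 1) ^ (-(μ + 1 / 2)) / (2 * n).factorial) :=
          mul_le_mul_of_nonneg_left (h n).2 (by positivity)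
      _ = _ := by ring
  have h0 : ∀ n, 0 ≤ S n := fun n => by
    have := Gamma_add_add_one_pos hμ n
    positivity
  have hSum : Summable S := Summable.of_nonneg_of_le h0 h2 (hS.mul_left C)
  refine ⟨hSum, ?_, ?_⟩
  · calc _ = c * (c' * (1 + w) ^ (-(μ + 1 / 2)) * Real.exp w) := by ring
      _ ≤ c * ∑' n, E n := by gcongr
      _ = ∑' n, c * E n := tsum_mul_left.symm
      _ ≤ _ := (hS.mul_left c).tsum_le_tsum h1 hSum
  · calc _ ≤ ∑' n, C * E n := hSum.tsum_le_tsum h2 (hS.mul_left C)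
      _ = C * ∑' n, E n := tsum_mul_left
      _ ≤ C * (C' * (1 + w) ^ (-(μ + 1 / 2)) * Real.exp w) := by gcongr
      _ = _ := by ring

theorem besselSeries_mono {μ : ℝ} (hμ : -1 < μ) {v w : ℝ} (hv : 0 ≤ v) (hvw : v ≤ w) :
    besselSeries μ v ≤ besselSeries μ w := by
  obtain ⟨c, C, -, -, h⟩ := exists_besselSeries_bounds hμ
  refine (h v hv).1.tsum_le_tsum (fun n => ?_) (h w (hv.trans hvw)).1
  have := Gamma_add_add_one_pos hμ n
  gcongr

theorem besselSeries_pos {μ : ℝ} (hμ : -1 < μ) {w : ℝ} (hw : 0 ≤ w) : 0 < besselSeries μ w := by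
  obtain ⟨c, C, hc, -, h⟩ := exists_besselSeries_bounds hμ
  exact lt_of_lt_of_le (by positivity) (h w hw).2.1

theorem continuous_besselSeries {μ : ℝ} (hμ : -1 < μ) : Continuous (besselSeries μ) := by
  obtain ⟨c, C, -, -, h⟩ := exists_besselSeries_bounds hμ
  rw [continuous_iff_continuousAt]
  intro w₀
  have hR : 0 ≤ |w₀| + 1 := by positivity
  have hc : ContinuousOn (besselSeries μ) (Metric.ball 0 (|w₀| + 1)) := by
    refine continuousOn_tsum (fun n => by fun_prop) (h _ hR).1 fun n x hx => ?_
    have hG := Gamma_add_add_one_pos hμ n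
    rw [Real.norm_eq_abs, abs_div, abs_pow, abs_of_pos (mul_pos (by positivity) hG), abs_div,
      abs_of_pos (two_pos (α := ℝ))]
    rw [mem_ball_zero_iff, Real.norm_eq_abs] at hx
    gcongr
  exact hc.continuousAt (Metric.isOpen_ball.mem_nhds (by simp))

/-! ### The exotic heat kernel with respect to Lebesgue measure -/

/-- The density `y ↦ W̃_t^ν(x, y) y ^ (2ν + 1)` of the exotic semigroup with respect to Lebesgue
measure, written with the entire factor of the Bessel function. -/
noncomputable def heatDensity (ν t x y : ℝ) : ℝ :=
  4 ^ ν / 2 * (x ^ (-2 * ν) * y * t ^ (ν - 1)) * Real.exp (-(x ^ 2 + y ^ 2) / (4 * t)) *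
    besselSeries (-ν) (x * y / (2 * t))

theorem exoticKernel_mul_rpow (ν : ℝ) {t x y : ℝ} (ht : 0 < t) (hx : 0 < x) (hy : 0 < y) :
    y ^ (2 * ν + 1) * exoticKernel ν t x y = heatDensity ν t x y := by
  have hxy : 0 < x * y := mul_pos hx hy
  rw [exoticKernel, classicalKernel, besselI_eq_rpow_mul_besselSeries _ (by positivity), heatDensity,
    neg_neg, show x * y / (2 * t) / 2 = x * y / (4 * t) by ring,
    Real.div_rpow hxy.le (by positivity), Real.mul_rpow (by norm_num) ht.le,
    Real.mul_rpow (z := -2 * ν) hx.le hy.le, Real.rpow_add_one hy.ne', Real.rpow_sub_one ht.ne']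
  have e1 : y ^ (2 * ν) * y ^ (-2 * ν) = 1 := by rw [← Real.rpow_add hy]; ring_nf; simp
  have e2 : (x * y) ^ ν * (x * y) ^ (-ν) = 1 := by rw [← Real.rpow_add hxy]; simp
  have e3 : (4 : ℝ) ^ (-ν) = (4 ^ ν)⁻¹ := Real.rpow_neg (by norm_num) _
  have e4 : t ^ (-ν) = (t ^ ν)⁻¹ := Real.rpow_neg ht.le _
  have h4 : (0 : ℝ) < 4 ^ ν := by positivity
  have h5 : (0 : ℝ) < t ^ ν := by positivity
  rw [e3, e4]
  calc _ = (y ^ (2 * ν) * y ^ (-2 * ν)) * ((x * y) ^ ν * (x * y) ^ (-ν)) *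
        (4 ^ ν / 2 * (x ^ (-2 * ν) * y * (t ^ ν / t)) * Real.exp (-(x ^ 2 + y ^ 2) / (4 * t)) *
    besselSeries (-ν) (x * y / (2 * t))) := by field_simp
    _ = _ := by rw [e1, e2, one_mul, one_mul]

theorem heatDensity_nonneg {ν : ℝ} (hν : ν < 1) {t x y : ℝ} (ht : 0 < t) (hx : 0 < x)
    (hy : 0 < y) : 0 ≤ heatDensity ν t x y := by
  have := besselSeries_pos (μ := -ν) (by linarith) (w := x * y / (2 * t)) (by positivity)
  rw [heatDensity]; positivity

theorem measurable_heatDensity {ν : ℝ} (hν : ν < 1) (t x : ℝ) :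
    Measurable (heatDensity ν t x) := by
  have := (continuous_besselSeries (μ := -ν) (by linarith)).measurable
  unfold heatDensity
  fun_prop

theorem continuousAt_heatDensity {ν : ℝ} (hν : ν < 1) (t y : ℝ) {x : ℝ} (hx : 0 < x) :
    ContinuousAt (fun x => heatDensity ν t x y) x := by
  have := continuous_besselSeries (μ := -ν) (by linarith)
  unfold heatDensity
  have h : ContinuousAt (fun x : ℝ => x ^ (-2 * ν)) x :=
    Real.continuousAt_rpow_const _ _ (Or.inl hx.ne')
  fun_prop

/-- Up to a factor depending on the points, the kernel increases with its first variable. -/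
theorem heatDensity_le_of_le {ν : ℝ} (hν : ν < 1) {t x b y : ℝ} (ht : 0 < t) (hx : 0 < x)
    (hxb : x ≤ b) (hy : 0 < y) :
    heatDensity ν t x y ≤
      (x / b) ^ (-2 * ν) * Real.exp (b ^ 2 / (4 * t)) * heatDensity ν t b y := by
  have hb : 0 < b := hx.trans_le hxb
  have hm := besselSeries_mono (μ := -ν) (by linarith) (v := x * y / (2 * t))
    (w := b * y / (2 * t)) (by positivity) (by gcongr)
  have hp := besselSeries_pos (μ := -ν) (by linarith) (w := x * y / (2 * t)) (by positivity)
  have h1 : (x / b) ^ (-2 * ν) * b ^ (-2 * ν) = x ^ (-2 * ν) := by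
    rw [← Real.mul_rpow (by positivity) hb.le, div_mul_cancel₀ _ hb.ne']
  have h2 : Real.exp (b ^ 2 / (4 * t)) * Real.exp (-(b ^ 2 + y ^ 2) / (4 * t))
      = Real.exp (-y ^ 2 / (4 * t)) := by
    rw [← Real.exp_add]; congr 1; field_simp; ring
  calc heatDensity ν t x y ≤ 4 ^ ν / 2 * (x ^ (-2 * ν) * y * t ^ (ν - 1)) *
        Real.exp (-y ^ 2 / (4 * t)) * besselSeries (-ν) (b * y / (2 * t)) := by
        rw [heatDensity]
        gcongr
        nlinarith [sq_nonneg x]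
    _ = _ := by rw [heatDensity, ← h1, ← h2]; ring

/-- Two-sided Gaussian bounds for the kernel. -/
theorem exists_heatDensity_bounds {ν : ℝ} (hν : ν < 1) :
    ∃ c C : ℝ, 0 < c ∧ 0 < C ∧ ∀ t x y : ℝ, 0 < t → 0 < x → 0 < y →
      c * (x ^ (-2 * ν) * y * t ^ (ν - 1) * (1 + x * y / (2 * t)) ^ (ν - 1 / 2) *
        Real.exp (-(x - y) ^ 2 / (4 * t))) ≤ heatDensity ν t x y ∧
      heatDensity ν t x y ≤
        C * (x ^ (-2 * ν) * y * t ^ (ν - 1) * (1 + x * y / (2 * t)) ^ (ν - 1 / 2) *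
        Real.exp (-(x - y) ^ 2 / (4 * t))) := by
  obtain ⟨c, C, hc, hC, h⟩ := exists_besselSeries_bounds (μ := -ν) (by linarith)
  refine ⟨4 ^ ν / 2 * c, 4 ^ ν / 2 * C, by positivity, by positivity, fun t x y ht hx hy => ?_⟩
  obtain ⟨-, h1, h2⟩ := h (x * y / (2 * t)) (by positivity)
  rw [show -(-ν + 1 / 2) = ν - 1 / 2 by ring] at h1 h2
  have he : Real.exp (-(x - y) ^ 2 / (4 * t)) =
      Real.exp (-(x ^ 2 + y ^ 2) / (4 * t)) * Real.exp (x * y / (2 * t)) := by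
    rw [← Real.exp_add]; congr 1; field_simp; ring
  rw [he, heatDensity]
  set A := 4 ^ ν / 2 * (x ^ (-2 * ν) * y * t ^ (ν - 1)) * Real.exp (-(x ^ 2 + y ^ 2) / (4 * t))
    with hA
  have hA0 : 0 ≤ A := by positivity
  constructor
  · refine le_trans (le_of_eq ?_) (mul_le_mul_of_nonneg_left h1 hA0)
    rw [hA]; ring
  · refine (mul_le_mul_of_nonneg_left h2 hA0).trans (le_of_eq ?_)
    rw [hA]; ring

/-- The lower bound for the kernel that ignores the growth of the Bessel function. -/
theorem exists_heatDensity_lower_bound {ν : ℝ} (hν : ν < 1) :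
    ∃ c : ℝ, 0 < c ∧ ∀ t x y : ℝ, 0 < t → 0 < x → 0 < y →
      c * (x ^ (-2 * ν) * y * t ^ (ν - 1) * Real.exp (-(x ^ 2 + y ^ 2) / (4 * t))) ≤
        heatDensity ν t x y := by
  have h0 := besselSeries_pos (μ := -ν) (by linarith) le_rfl
  refine ⟨4 ^ ν / 2 * besselSeries (-ν) 0, by positivity, fun t x y ht hx hy => ?_⟩
  have hm := besselSeries_mono (μ := -ν) (by linarith) le_rfl
    (show 0 ≤ x * y / (2 * t) by positivity)
  rw [heatDensity]
  set A := 4 ^ ν / 2 * (x ^ (-2 * ν) * y * t ^ (ν - 1)) * Real.exp (-(x ^ 2 + y ^ 2) / (4 * t))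
    with hA
  have hA0 : 0 ≤ A := by positivity
  refine le_trans (le_of_eq ?_) (mul_le_mul_of_nonneg_left hm hA0)
  rw [hA]; ring

/-! ### The semigroup and its maximal operator -/

theorem measurable_ofReal_rpow (δ : ℝ) : Measurable fun x : ℝ => ENNReal.ofReal (x ^ δ) := by
  fun_prop

theorem lintegral_powerMeasure (δ : ℝ) (h : ℝ → ℝ≥0∞) :
    ∫⁻ x, h x ∂(powerMeasure δ) = ∫⁻ x in Ioi 0, ENNReal.ofReal (x ^ δ) * h x := by
  rw [powerMeasure, lintegral_withDensity_eq_lintegral_mul_non_measurable _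
    (measurable_ofReal_rpow δ) (by simp)]
  rfl

theorem powerMeasure_absolutelyContinuous (δ : ℝ) : powerMeasure δ ≪ volume.restrict (Ioi 0) :=
  withDensity_absolutelyContinuous _ _

theorem absolutelyContinuous_powerMeasure (δ : ℝ) : volume.restrict (Ioi 0) ≪ powerMeasure δ := by
  refine withDensity_absolutelyContinuous' (measurable_ofReal_rpow δ).aemeasurable ?_
  filter_upwards [ae_restrict_mem measurableSet_Ioi] with x hx
  have : 0 < x ^ δ := Real.rpow_pos_of_pos hx _
  simpa using this

/-- The exotic semigroup acting on functions with values in `[0, ∞]`. -/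
noncomputable def posSemigroup (ν t : ℝ) (g : ℝ → ℝ≥0∞) (x : ℝ) : ℝ≥0∞ :=
  ∫⁻ y in Ioi 0, ENNReal.ofReal (heatDensity ν t x y) * g y

/-- The maximal operator of the exotic semigroup on functions with values in `[0, ∞]`. -/
noncomputable def posMaximal (ν : ℝ) (g : ℝ → ℝ≥0∞) (x : ℝ) : ℝ≥0∞ :=
  ⨆ (t : ℝ) (_ : 0 < t), posSemigroup ν t g x

section Semigroup

variable {𝕜 : Type*} [RCLike 𝕜]

theorem lintegral_enorm_exoticKernel_smul {ν : ℝ} (hν : ν < 1) {t x : ℝ} (ht : 0 < t) (hx : 0 < x)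
    (f : ℝ → 𝕜) :
    ∫⁻ y, ‖exoticKernel ν t x y • f y‖ₑ ∂(eta ν) = posSemigroup ν t (fun y => ‖f y‖ₑ) x := by
  rw [eta, lintegral_powerMeasure, posSemigroup]
  refine setLIntegral_congr_fun measurableSet_Ioi fun y hy => ?_
  have hy : 0 < y := hy
  have hp : 0 < y ^ (2 * ν + 1) := by positivity
  have h0 := heatDensity_nonneg hν ht hx hy
  rw [← exoticKernel_mul_rpow ν ht hx hy] at h0 ⊢
  have hK := nonneg_of_mul_nonneg_right h0 hp
  rw [enorm_smul, Real.enorm_eq_ofReal hK, ENNReal.ofReal_mul hp.le, mul_assoc]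

theorem exoticSemigroup_eq {ν : ℝ} {t x : ℝ} (ht : 0 < t) (hx : 0 < x)
    (f : ℝ → 𝕜) :
    exoticSemigroup ν t f x = ∫ y in Ioi 0, heatDensity ν t x y • f y := by
  rw [exoticSemigroup, eta, powerMeasure, integral_withDensity_eq_integral_toReal_smul
    (measurable_ofReal_rpow _) (by simp)]
  refine setIntegral_congr_fun measurableSet_Ioi fun y hy => ?_
  have hy : 0 < y := hy
  rw [← exoticKernel_mul_rpow ν ht hx hy, mul_smul, ENNReal.toReal_ofReal (by positivity)]

theorem integrable_exoticKernel_smul_iff {ν : ℝ} {t x : ℝ} (ht : 0 < t)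
    (hx : 0 < x) (f : ℝ → 𝕜) :
    Integrable (fun y => exoticKernel ν t x y • f y) (eta ν) ↔
      IntegrableOn (fun y => heatDensity ν t x y • f y) (Ioi 0) := by
  rw [eta, powerMeasure, integrable_withDensity_iff_integrable_smul' (measurable_ofReal_rpow _)
    (by simp), ← IntegrableOn]
  refine integrableOn_congr_fun (fun y hy => ?_) measurableSet_Ioi
  have hy : 0 < y := hy
  rw [← exoticKernel_mul_rpow ν ht hx hy, mul_smul, ENNReal.toReal_ofReal (by positivity)]

theorem lintegral_enorm_heatDensity_smul {ν : ℝ} (hν : ν < 1) {t x : ℝ} (ht : 0 < t) (hx : 0 < x)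
    (f : ℝ → 𝕜) :
    ∫⁻ y in Ioi 0, ‖heatDensity ν t x y • f y‖ₑ = posSemigroup ν t (fun y => ‖f y‖ₑ) x := by
  rw [posSemigroup]
  refine setLIntegral_congr_fun measurableSet_Ioi fun y hy => ?_
  rw [enorm_smul, Real.enorm_eq_ofReal (heatDensity_nonneg hν ht hx hy)]

theorem mem_exoticDomain {ν : ℝ} (hν : ν < 1) {f : ℝ → 𝕜}
    (hf : AEStronglyMeasurable f (volume.restrict (Ioi 0)))
    (h : ∀ t : ℝ, 0 < t → ∀ x : ℝ, 0 < x → posSemigroup ν t (fun y => ‖f y‖ₑ) x < ∞) :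
    f ∈ exoticDomain 𝕜 ν := by
  intro t ht x hx
  rw [integrable_exoticKernel_smul_iff ht hx]
  refine ⟨(measurable_heatDensity hν t x).aestronglyMeasurable.smul hf, ?_⟩
  rw [hasFiniteIntegral_iff_enorm, lintegral_enorm_heatDensity_smul hν ht hx]
  exact h t ht x hx

theorem exoticMaximal_le_posMaximal {ν : ℝ} (hν : ν < 1) (f : ℝ → 𝕜) {x : ℝ} (hx : 0 < x) :
    exoticMaximal ν f x ≤ posMaximal ν (fun y => ‖f y‖ₑ) x := by
  refine iSup₂_mono fun t ht => ?_
  rw [← lintegral_enorm_exoticKernel_smul hν ht hx, exoticSemigroup]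
  exact enorm_integral_le_lintegral_enorm _

/-- On nonnegative functions of the domain there is no cancellation. -/
theorem posSemigroup_le_exoticMaximal {ν : ℝ} (hν : ν < 1) {f : ℝ → 𝕜} (hf : f ∈ exoticDomain 𝕜 ν)
    (hpos : ∀ y, f y = ((‖f y‖ : ℝ) : 𝕜)) {t x : ℝ} (ht : 0 < t) (hx : 0 < x) :
    posSemigroup ν t (fun y => ‖f y‖ₑ) x ≤ exoticMaximal ν f x := by
  refine le_trans (le_of_eq ?_) (le_iSup₂_of_le t ht le_rfl)
  have hint := (integrable_exoticKernel_smul_iff ht hx f).1 (hf t ht x hx)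
  have h0 : ∀ᵐ y ∂volume.restrict (Ioi 0), 0 ≤ heatDensity ν t x y * ‖f y‖ := by
    filter_upwards [ae_restrict_mem measurableSet_Ioi] with y hy
    exact mul_nonneg (heatDensity_nonneg hν ht hx hy) (norm_nonneg _)
  have hcongr : ∀ᵐ y ∂volume.restrict (Ioi 0), ‖heatDensity ν t x y • f y‖
      = heatDensity ν t x y * ‖f y‖ := by
    filter_upwards [ae_restrict_mem measurableSet_Ioi] with y hy
    rw [norm_smul, Real.norm_of_nonneg (heatDensity_nonneg hν ht hx hy)]
  have hint' : Integrable (fun y => heatDensity ν t x y * ‖f y‖) (volume.restrict (Ioi 0)) :=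
    hint.norm.congr hcongr
  have e1 : exoticSemigroup ν t f x = ((∫ y in Ioi 0, heatDensity ν t x y * ‖f y‖ : ℝ) : 𝕜) := by
    rw [exoticSemigroup_eq ht hx, ← integral_ofReal]
    refine integral_congr_ae (Eventually.of_forall fun y => ?_)
    simp only
    rw [RCLike.ofReal_mul, ← hpos, RCLike.real_smul_eq_coe_mul]
  rw [e1, ← ofReal_norm, RCLike.norm_ofReal, abs_of_nonneg (integral_nonneg_of_ae h0),
    ofReal_integral_eq_lintegral_ofReal hint' h0, ← lintegral_enorm_heatDensity_smul hν ht hx]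
  refine lintegral_congr_ae ?_
  filter_upwards [hcongr] with y hy
  rw [← ofReal_norm, hy]

/-- Finiteness at one point propagates to all points on its left. -/
theorem posSemigroup_lt_top_of_le {ν : ℝ} (hν : ν < 1) {t x b : ℝ} (ht : 0 < t) (hx : 0 < x)
    (hxb : x ≤ b) {g : ℝ → ℝ≥0∞} (hg : posSemigroup ν t g b < ∞) : posSemigroup ν t g x < ∞ := by
  have hb : 0 < b := hx.trans_le hxb
  refine lt_of_le_of_lt ?_ (ENNReal.mul_lt_top (ENNReal.ofReal_lt_top
    (r := (x / b) ^ (-2 * ν) * Real.exp (b ^ 2 / (4 * t)))) hg)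
  rw [posSemigroup, posSemigroup, ← lintegral_const_mul' _ _ ENNReal.ofReal_ne_top]
  refine setLIntegral_mono' measurableSet_Ioi fun y hy => ?_
  rw [← mul_assoc, ← ENNReal.ofReal_mul (by positivity)]
  gcongr
  exact heatDensity_le_of_le hν ht hx hxb hy

theorem continuousOn_exoticSemigroup {ν : ℝ} (hν : ν < 1) {f : ℝ → 𝕜} (hf : f ∈ exoticDomain 𝕜 ν)
    {t : ℝ} (ht : 0 < t) : ContinuousOn (exoticSemigroup ν t f) (Ioi 0) := by
  have hc : ContinuousOn (fun x => ∫ y in Ioi 0, heatDensity ν t x y • f y) (Ioi 0) := by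
    intro x₀ hx₀
    have hx₀ : 0 < x₀ := hx₀
    refine ContinuousAt.continuousWithinAt ?_
    have hint := (integrable_exoticKernel_smul_iff ht (by positivity) f).1
      (hf t ht (2 * x₀) (by positivity))
    have hnhds : Ioo (x₀ / 2) (2 * x₀) ∈ 𝓝 x₀ := Ioo_mem_nhds (by linarith) (by linarith)
    refine continuousAt_of_dominated (bound := fun y =>
      4 ^ |(-2 * ν)| * Real.exp ((2 * x₀) ^ 2 / (4 * t)) * ‖heatDensity ν t (2 * x₀) y • f y‖)
      ?_ ?_ (hint.norm.const_mul _) ?_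
    · filter_upwards [hnhds] with x hx
      exact ((integrable_exoticKernel_smul_iff ht (by linarith [hx.1]) f).1
        (hf t ht x (by linarith [hx.1]))).1
    · filter_upwards [hnhds] with x hx
      have hx0 : 0 < x := by linarith [hx.1]
      filter_upwards [ae_restrict_mem measurableSet_Ioi] with y hy
      rw [norm_smul, norm_smul, ← mul_assoc,
        Real.norm_of_nonneg (heatDensity_nonneg hν ht hx0 hy),
        Real.norm_of_nonneg (heatDensity_nonneg hν ht (by positivity) hy)]
      gcongr
      refine (heatDensity_le_of_le hν ht hx0 hx.2.le hy).trans ?_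
      have := heatDensity_nonneg hν ht (show 0 < 2 * x₀ by positivity) hy
      gcongr
      have h1 : x / (2 * x₀) ≤ 1 := by rw [div_le_one (by positivity)]; exact hx.2.le
      have h2 : 4⁻¹ ≤ x / (2 * x₀) := by
        rw [le_div_iff₀ (by positivity)]; linarith [hx.1]
      rcases le_total 0 (-2 * ν) with h | h
      · rw [abs_of_nonneg h]
        gcongr
        linarith
      · rw [abs_of_nonpos h, Real.rpow_neg (by norm_num), ← Real.inv_rpow (by norm_num)]
        exact Real.rpow_le_rpow_of_nonpos (by norm_num) h2 h
    · exact Eventually.of_forall fun y => (continuousAt_heatDensity hν t y hx₀).smul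
        continuousAt_const
  exact hc.congr fun x hx => exoticSemigroup_eq ht hx f

/-- The maximal function is a supremum of continuous functions on the half-line, hence lower
semicontinuous there, although the supremum is uncountable. -/
theorem aemeasurable_exoticMaximal {ν : ℝ} (hν : ν < 1) {f : ℝ → 𝕜} (hf : f ∈ exoticDomain 𝕜 ν)
    (δ : ℝ) : AEMeasurable (exoticMaximal ν f) (powerMeasure δ) := by
  refine AEMeasurable.mono_ac ?_ (powerMeasure_absolutelyContinuous δ)
  have hlsc : LowerSemicontinuousOn (exoticMaximal ν f) (Ioi 0) :=
    lowerSemicontinuousOn_iSup fun t => lowerSemicontinuousOn_iSup fun ht =>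
      (continuousOn_exoticSemigroup hν hf ht).enorm.lowerSemicontinuousOn
  have hind : LowerSemicontinuous ((Ioi (0 : ℝ)).indicator (exoticMaximal ν f)) := by
    intro x a ha
    by_cases hx : x ∈ Ioi (0 : ℝ)
    · rw [indicator_of_mem hx] at ha
      have := hlsc x hx a ha
      rw [isOpen_Ioi.nhdsWithin_eq hx] at this
      filter_upwards [this, isOpen_Ioi.mem_nhds hx] with z hz hz'
      rwa [indicator_of_mem hz']
    · rw [indicator_of_notMem hx] at ha
      exact absurd ha not_lt_zero
  exact (aemeasurable_indicator_iff measurableSet_Ioi).1 hind.measurable.aemeasurable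

end Semigroup

/-! ### Pointwise domination of the semigroup -/

/-- The Hardy operator `x ^ (-2) ∫_0^x y g(y) dy`. -/
noncomputable def lowerHardy (g : ℝ → ℝ≥0∞) (x : ℝ) : ℝ≥0∞ :=
  ENNReal.ofReal (x ^ (-2 : ℝ)) * ∫⁻ y in Ioo 0 x, ENNReal.ofReal y * g y

/-- A profile vanishing at `0` and at `∞`, which is integrable with respect to `du / u`. -/
noncomputable def bump (ν u : ℝ) : ℝ := min (u ^ (1 - ν)) u⁻¹

/-- The part of the semigroup acting on values to the right of `x`: a dual Hardy operator
`x ^ (-2ν) ∫_x^∞ y ^ (2ν - 1) g(y) dy` localized at `y ≈ √t`. -/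
noncomputable def upperHardyAt (ν t : ℝ) (g : ℝ → ℝ≥0∞) (x : ℝ) : ℝ≥0∞ :=
  ENNReal.ofReal (x ^ (-(2 * ν))) *
    ∫⁻ y in Ioi x, ENNReal.ofReal (y ^ (2 * ν - 1) * bump ν (y ^ 2 / t)) * g y

/-- The centered Hardy–Littlewood maximal function over the intervals of radius at most `x / 10`.
Restricting to rational radii makes it measurable for trivial reasons. -/
noncomputable def localMaximal (g : ℝ → ℝ≥0∞) (x : ℝ) : ℝ≥0∞ :=
  ⨆ (r : ℚ) (_ : 0 < (r : ℝ) ∧ (r : ℝ) ≤ x / 10),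
    ENNReal.ofReal (r : ℝ)⁻¹ * ∫⁻ y in Metric.closedBall x r, g y

theorem exists_rpow_mul_exp_neg_le (N : ℝ) {c : ℝ} (hc : 0 < c) :
    ∃ C : ℝ, 0 < C ∧ ∀ u : ℝ, 0 ≤ u → (1 + u) ^ N * Real.exp (-(c * u)) ≤ C := by
  obtain ⟨k, hk⟩ := exists_nat_ge N
  refine ⟨k.factorial / c ^ k * Real.exp c, by positivity, fun u hu => ?_⟩
  have h1 : (1 + u) ^ N ≤ (1 + u) ^ k := by
    rw [← Real.rpow_natCast]
    exact Real.rpow_le_rpow_of_exponent_le (by linarith) hk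
  have h2 := Real.pow_div_factorial_le_exp (c * (1 + u)) (by positivity) k
  rw [div_le_iff₀ (by positivity), mul_pow] at h2
  calc (1 + u) ^ N * Real.exp (-(c * u)) ≤ (1 + u) ^ k * Real.exp (-(c * u)) := by gcongr
    _ = (c ^ k * (1 + u) ^ k) * Real.exp (-(c * u)) / c ^ k := by field_simp
    _ ≤ (Real.exp (c * (1 + u)) * k.factorial) * Real.exp (-(c * u)) / c ^ k := by gcongr
    _ = k.factorial / c ^ k * (Real.exp (c * (1 + u)) * Real.exp (-(c * u))) := by ring
    _ = _ := by rw [← Real.exp_add]; ring_nf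

/-- The Gaussian majorant of the kernel in `exists_heatDensity_bounds`. -/
noncomputable def gaussMajorant (ν t x y : ℝ) : ℝ :=
  x ^ (-2 * ν) * y * t ^ (ν - 1) * (1 + x * y / (2 * t)) ^ (ν - 1 / 2) *
    Real.exp (-(x - y) ^ 2 / (4 * t))

theorem one_add_rpow_le {v u a : ℝ} (hv : 0 ≤ v) (hvu : v ≤ u) :
    (1 + v) ^ a ≤ (1 + u) ^ |a| := by
  calc (1 + v) ^ a ≤ (1 + v) ^ |a| :=
        Real.rpow_le_rpow_of_exponent_le (by linarith) (le_abs_self a)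
    _ ≤ (1 + u) ^ |a| := by gcongr

theorem sq_div_rpow {x t a : ℝ} (hx : 0 < x) (ht : 0 < t) :
    (x ^ 2 / t) ^ a = x ^ (2 * a) * t ^ (-a) := by
  rw [Real.div_rpow (by positivity) ht.le, Real.rpow_neg ht.le, ← Real.rpow_natCast x 2,
    ← Real.rpow_mul hx.le, div_eq_mul_inv]
  norm_num

theorem gaussMajorant_lower {ν : ℝ} (hν : ν < 1) :
    ∃ C : ℝ, 0 < C ∧ ∀ t x y : ℝ, 0 < t → 0 < x → 0 < y → y ≤ 19 / 20 * x →
      gaussMajorant ν t x y ≤ C * (x ^ (-2 : ℝ) * y) := by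
  obtain ⟨C, hC, h⟩ := exists_rpow_mul_exp_neg_le (1 - ν + |ν - 1 / 2|) (c := 1 / 1600) (by norm_num)
  refine ⟨C, hC, fun t x y ht hx hy hyx => ?_⟩
  set u := x ^ 2 / t with hu
  have hu0 : 0 < u := by positivity
  have e1 : x ^ (-2 * ν) * t ^ (ν - 1) = x ^ (-2 : ℝ) * u ^ (1 - ν) := by
    rw [hu, sq_div_rpow hx ht, ← mul_assoc, ← Real.rpow_add hx]; congr 2 <;> ring
  have e2 : (1 + x * y / (2 * t)) ^ (ν - 1 / 2) ≤ (1 + u) ^ |ν - 1 / 2| := by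
    refine one_add_rpow_le (by positivity) ?_
    rw [hu, div_le_div_iff₀ (by positivity) ht]
    nlinarith [mul_pos hx ht, mul_pos hx hx]
  have e3 : Real.exp (-(x - y) ^ 2 / (4 * t)) ≤ Real.exp (-(1 / 1600 * u)) := by
    gcongr
    rw [hu, div_le_iff₀ (by positivity)]
    have : -(1 / 1600 * (x ^ 2 / t)) * (4 * t) = -(x / 20) ^ 2 := by field_simp; ring
    rw [this, neg_le_neg_iff]
    gcongr
    linarith
  calc gaussMajorant ν t x y = (x ^ (-2 * ν) * t ^ (ν - 1)) * y *
        (1 + x * y / (2 * t)) ^ (ν - 1 / 2) * Real.exp (-(x - y) ^ 2 / (4 * t)) := by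
        rw [gaussMajorant]; ring
    _ ≤ x ^ (-2 : ℝ) * (1 + u) ^ (1 - ν) * y * (1 + u) ^ |ν - 1 / 2| *
        Real.exp (-(1 / 1600 * u)) := by
        rw [e1]; gcongr; linarith
    _ = ((1 + u) ^ (1 - ν + |ν - 1 / 2|) * Real.exp (-(1 / 1600 * u))) * (x ^ (-2 : ℝ) * y) := by
        rw [Real.rpow_add (by linarith)]; ring
    _ ≤ _ := by gcongr; exact h u hu0.le

theorem gaussMajorant_upper {ν : ℝ} (hν : ν < 1) :
    ∃ C : ℝ, 0 < C ∧ ∀ t x y : ℝ, 0 < t → 0 < x → 21 / 20 * x ≤ y →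
      gaussMajorant ν t x y ≤ C * (x ^ (-(2 * ν)) * (y ^ (2 * ν - 1) * bump ν (y ^ 2 / t))) := by
  obtain ⟨C, hC, h⟩ := exists_rpow_mul_exp_neg_le (2 - ν + |ν - 1 / 2|) (c := 1 / 1764) (by norm_num)
  refine ⟨C, hC, fun t x y ht hx hyx => ?_⟩
  have hy : 0 < y := by linarith
  set u := y ^ 2 / t with hu
  have hu0 : 0 < u := by positivity
  have e1 : y * t ^ (ν - 1) = y ^ (2 * ν - 1) * u ^ (1 - ν) := by
    rw [hu, sq_div_rpow hy ht, ← mul_assoc, ← Real.rpow_add hy,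
      show 2 * ν - 1 + 2 * (1 - ν) = 1 by ring, Real.rpow_one]
    congr 2; ring
  have e2 : (1 + x * y / (2 * t)) ^ (ν - 1 / 2) ≤ (1 + u) ^ |ν - 1 / 2| := by
    refine one_add_rpow_le (by positivity) ?_
    rw [hu, div_le_div_iff₀ (by positivity) ht]
    nlinarith [mul_pos hy ht, mul_pos hy hy]
  have e3 : Real.exp (-(x - y) ^ 2 / (4 * t)) ≤ Real.exp (-(1 / 1764 * u)) := by
    gcongr
    rw [hu, div_le_iff₀ (by positivity)]
    have : -(1 / 1764 * (y ^ 2 / t)) * (4 * t) = -(y / 21) ^ 2 := by field_simp; ring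
    rw [this, neg_le_neg_iff, ← neg_sub, neg_sq]
    gcongr
    linarith
  have hu1 : 1 ≤ 1 + u := by linarith
  have key : u ^ (1 - ν) * ((1 + u) ^ |ν - 1 / 2| * Real.exp (-(1 / 1764 * u))) ≤
      C * bump ν u := by
    have hbig : (1 + u) ^ (2 - ν) * ((1 + u) ^ |ν - 1 / 2| * Real.exp (-(1 / 1764 * u))) ≤ C := by
      rw [← mul_assoc, ← Real.rpow_add (by linarith)]; exact h u hu0.le
    have hE : 0 ≤ (1 + u) ^ |ν - 1 / 2| * Real.exp (-(1 / 1764 * u)) := by positivity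
    rw [bump, mul_min_of_nonneg _ _ hC.le]
    refine le_min ?_ ?_
    · rw [mul_comm C]
      gcongr
      refine le_trans ?_ hbig
      exact le_mul_of_one_le_left hE (Real.one_le_rpow hu1 (by linarith))
    · rw [← div_eq_mul_inv, le_div_iff₀ hu0]
      refine le_trans ?_ hbig
      have : u ^ (1 - ν) * u ≤ (1 + u) ^ (2 - ν) := by
        rw [← Real.rpow_add_one hu0.ne', show 1 - ν + 1 = 2 - ν by ring]
        gcongr
        · linarith
        · linarith
      calc _ = (u ^ (1 - ν) * u) * ((1 + u) ^ |ν - 1 / 2| * Real.exp (-(1 / 1764 * u))) := by ring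
        _ ≤ _ := by gcongr
  calc gaussMajorant ν t x y = x ^ (-(2 * ν)) * (y * t ^ (ν - 1)) *
        ((1 + x * y / (2 * t)) ^ (ν - 1 / 2) * Real.exp (-(x - y) ^ 2 / (4 * t))) := by
        rw [gaussMajorant, neg_mul]; ring
    _ ≤ x ^ (-(2 * ν)) * (y ^ (2 * ν - 1) * u ^ (1 - ν)) *
        ((1 + u) ^ |ν - 1 / 2| * Real.exp (-(1 / 1764 * u))) := by
        rw [e1]; gcongr
    _ = x ^ (-(2 * ν)) * (y ^ (2 * ν - 1) *
        (u ^ (1 - ν) * ((1 + u) ^ |ν - 1 / 2| * Real.exp (-(1 / 1764 * u))))) := by ring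
    _ ≤ x ^ (-(2 * ν)) * (y ^ (2 * ν - 1) * (C * bump ν u)) := by gcongr
    _ = _ := by ring

theorem gaussMajorant_local {ν : ℝ} (hν : ν < 1) :
    ∃ C : ℝ, 0 < C ∧ ∀ t x y : ℝ, 0 < t → 0 < x → |x - y| < x / 20 →
      gaussMajorant ν t x y ≤
        C * (x⁻¹ + (√t)⁻¹ * Real.exp (-(x - y) ^ 2 / (4 * t))) := by
  set a := ν - 1 / 2 with ha
  set K : ℝ := 2 ^ |a| with hK
  have hK0 : 0 < K := by positivity
  refine ⟨2 * K * K, by positivity, fun t x y ht hx hxy => ?_⟩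
  rw [abs_lt] at hxy
  have hy : 0 < y := by linarith
  set e := Real.exp (-(x - y) ^ 2 / (4 * t)) with he
  have he1 : e ≤ 1 := by
    rw [he, Real.exp_le_one_iff]
    exact div_nonpos_of_nonpos_of_nonneg (by nlinarith [sq_nonneg (x - y)]) (by positivity)
  have he0 : 0 < e := Real.exp_pos _
  set u := x ^ 2 / t with hu
  have hu0 : 0 < u := by positivity
  have e2 : (1 + x * y / (2 * t)) ^ a ≤ K * (1 + u / 2) ^ a := by
    have h1 : x * y / (2 * t) = (y / x) * (u / 2) := by rw [hu]; field_simp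
    have h2 : y / x ≤ 2 := by rw [div_le_iff₀ hx]; linarith
    have h3 : 1 / 2 ≤ y / x := by rw [le_div_iff₀ hx]; linarith
    refine rpow_le_two_rpow_abs_mul (by positivity) (by positivity) ?_ ?_
    · rw [h1]; nlinarith
    · rw [h1]; nlinarith
  have hst : √t = t ^ (1 / 2 : ℝ) := Real.sqrt_eq_rpow t
  have e1 : x ^ (-2 * ν) * x * t ^ (ν - 1) = (√t)⁻¹ * u ^ (-a) := by
    rw [hu, sq_div_rpow hx ht, hst, ← Real.rpow_neg ht.le, ← Real.rpow_add_one hx.ne', mul_left_comm,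
      ← Real.rpow_add ht, ha]
    congr 2 <;> ring
  have hmain : gaussMajorant ν t x y ≤ 2 * K * ((√t)⁻¹ * u ^ (-a) * (1 + u / 2) ^ a * e) := by
    calc gaussMajorant ν t x y ≤ x ^ (-2 * ν) * (2 * x) * t ^ (ν - 1) *
          (K * (1 + u / 2) ^ a) * e := by
          rw [gaussMajorant]; gcongr; linarith
      _ = 2 * K * ((x ^ (-2 * ν) * x * t ^ (ν - 1)) * (1 + u / 2) ^ a * e) := by ring
      _ = _ := by rw [e1]
  refine hmain.trans ?_
  rw [mul_assoc (2 * K) K]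
  refine mul_le_mul_of_nonneg_left ?_ (by positivity)
  rcases le_total 1 u with h1 | h1
  · have h2 : (1 + u / 2) ^ a ≤ K * u ^ a :=
      rpow_le_two_rpow_abs_mul (by positivity) hu0 (by linarith) (by linarith)
    have h3 : u ^ (-a) * u ^ a = 1 := by rw [← Real.rpow_add hu0]; simp
    calc (√t)⁻¹ * u ^ (-a) * (1 + u / 2) ^ a * e ≤ (√t)⁻¹ * u ^ (-a) * (K * u ^ a) * e := by gcongr
      _ = K * ((u ^ (-a) * u ^ a) * ((√t)⁻¹ * e)) := by ring
      _ = K * ((√t)⁻¹ * e) := by rw [h3, one_mul]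
      _ ≤ _ := by
        gcongr
        exact le_add_of_nonneg_left (by positivity)
  · have h2 : (1 + u / 2) ^ a ≤ K * 1 ^ a :=
      rpow_le_two_rpow_abs_mul (by positivity) one_pos (by linarith) (by linarith)
    rw [Real.one_rpow, mul_one] at h2
    have h3 : (√t)⁻¹ * u ^ (-a) = x⁻¹ * u ^ (1 - ν) := by
      rw [← e1, hu, sq_div_rpow hx ht, ← Real.rpow_neg_one x, ← mul_assoc, ← Real.rpow_add_one hx.ne',
        ← Real.rpow_add hx]
      congr 2 <;> ring
    have h4 : u ^ (1 - ν) ≤ 1 := Real.rpow_le_one hu0.le h1 (by linarith)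
    calc (√t)⁻¹ * u ^ (-a) * (1 + u / 2) ^ a * e ≤ x⁻¹ * 1 * K * 1 := by
          rw [h3]; gcongr
      _ = K * x⁻¹ := by ring
      _ ≤ _ := by
        gcongr
        exact le_add_of_nonneg_right (by positivity)

theorem lintegral_ball_le_localMaximal (g : ℝ → ℝ≥0∞) {x m : ℝ} (hm : 0 < m) (hmx : m ≤ x / 20) :
    ∫⁻ y in Metric.ball x m, g y ≤ ENNReal.ofReal (2 * m) * localMaximal g x := by
  obtain ⟨r, hr1, hr2⟩ := exists_rat_btwn (show m < 2 * m by linarith)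
  have hr : (0 : ℝ) < r := hm.trans hr1
  have h1 : ENNReal.ofReal (r : ℝ)⁻¹ * ∫⁻ y in Metric.closedBall x r, g y ≤ localMaximal g x :=
    le_iSup₂_of_le r ⟨hr, by linarith⟩ le_rfl
  calc ∫⁻ y in Metric.ball x m, g y ≤ ∫⁻ y in Metric.closedBall x r, g y :=
        lintegral_mono_set (Metric.ball_subset_closedBall.trans
          (Metric.closedBall_subset_closedBall hr1.le))
    _ = ENNReal.ofReal r * (ENNReal.ofReal (r : ℝ)⁻¹ * ∫⁻ y in Metric.closedBall x r, g y) := by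
        rw [← mul_assoc, ← ENNReal.ofReal_mul hr.le, mul_inv_cancel₀ hr.ne', ENNReal.ofReal_one,
          one_mul]
    _ ≤ _ := by gcongr

theorem exists_two_pow_exp_bound (v : ℝ) :
    ∃ j : ℕ, v < 2 ^ j ∧ Real.exp (-v ^ 2 / 4) ≤ 16 / 4 ^ j := by
  have hex : ∃ j : ℕ, v < 2 ^ j := pow_unbounded_of_one_lt v one_lt_two
  classical
  refine ⟨Nat.find hex, Nat.find_spec hex, ?_⟩
  rcases hj : Nat.find hex with _ | j
  · have : Real.exp (-v ^ 2 / 4) ≤ 1 := by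
      rw [Real.exp_le_one_iff]; nlinarith [sq_nonneg v]
    norm_num; linarith
  · have h1 : (2 : ℝ) ^ j ≤ v := by
      have := Nat.find_min hex (m := j) (by omega)
      push Not at this; exact this
    have h2 : (4 : ℝ) ^ j ≤ v ^ 2 := by
      calc (4 : ℝ) ^ j = (2 ^ j) ^ 2 := by rw [← pow_mul, mul_comm, pow_mul]; norm_num
        _ ≤ v ^ 2 := by gcongr
    have h3 : (v ^ 2 / 4) ≤ Real.exp (v ^ 2 / 4) := by linarith [Real.add_one_le_exp (v ^ 2 / 4)]
    rw [neg_div, Real.exp_neg, inv_le_comm₀ (Real.exp_pos _) (by positivity), inv_div, pow_succ]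
    linarith [pow_pos (show (0 : ℝ) < 4 by norm_num) j]

/-- Gaussian averages are controlled by the maximal function: cut the Gaussian at the dyadic
multiples of its width. -/
theorem lintegral_gauss_le_localMaximal {g : ℝ → ℝ≥0∞} (hg : Measurable g) {t x : ℝ} (ht : 0 < t)
    (hx : 0 < x) :
    ∫⁻ y in Metric.ball x (x / 20),
      ENNReal.ofReal ((√t)⁻¹ * Real.exp (-(x - y) ^ 2 / (4 * t))) * g y ≤
      64 * localMaximal g x := by
  set s := √t with hs
  have hs0 : 0 < s := Real.sqrt_pos.2 ht
  have hs2 : s ^ 2 = t := Real.sq_sqrt ht.le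
  have hpt : ∀ y, ENNReal.ofReal (s⁻¹ * Real.exp (-(x - y) ^ 2 / (4 * t))) * g y ≤
      ∑' j : ℕ, ENNReal.ofReal (s⁻¹ * (16 / 4 ^ j)) *
        (Metric.ball x (2 ^ j * s)).indicator g y := by
    intro y
    obtain ⟨j, hj1, hj2⟩ := exists_two_pow_exp_bound (|y - x| / s)
    refine le_trans ?_ (ENNReal.le_tsum j)
    have hy : y ∈ Metric.ball x (2 ^ j * s) := by
      rw [Metric.mem_ball, Real.dist_eq]
      rwa [div_lt_iff₀ hs0] at hj1
    rw [indicator_of_mem hy]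
    gcongr
    refine le_trans (le_of_eq ?_) hj2
    rw [div_pow, sq_abs, hs2]
    congr 1; field_simp; ring
  calc _ ≤ ∫⁻ y in Metric.ball x (x / 20), ∑' j : ℕ, ENNReal.ofReal (s⁻¹ * (16 / 4 ^ j)) *
        (Metric.ball x (2 ^ j * s)).indicator g y := lintegral_mono hpt
    _ = ∑' j : ℕ, ENNReal.ofReal (s⁻¹ * (16 / 4 ^ j)) *
        ∫⁻ y in Metric.ball x (min (2 ^ j * s) (x / 20)), g y := by
        rw [lintegral_tsum fun j => ((hg.indicator measurableSet_ball).const_mul _).aemeasurable]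
        refine tsum_congr fun j => ?_
        rw [lintegral_const_mul _ (hg.indicator measurableSet_ball),
          lintegral_indicator measurableSet_ball, Measure.restrict_restrict measurableSet_ball,
          show Metric.ball x (2 ^ j * s) ∩ Metric.ball x (x / 20) =
            Metric.ball x (min (2 ^ j * s) (x / 20)) by ext; simp]
    _ ≤ ∑' j : ℕ, 32 * (2⁻¹) ^ j * localMaximal g x := by
        refine ENNReal.tsum_le_tsum fun j => ?_
        have hm : 0 < min (2 ^ j * s) (x / 20) := lt_min (by positivity) (by positivity)
        calc _ ≤ ENNReal.ofReal (s⁻¹ * (16 / 4 ^ j)) *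
              (ENNReal.ofReal (2 * (2 ^ j * s)) * localMaximal g x) := by
              gcongr
              refine (lintegral_ball_le_localMaximal g hm (min_le_right _ _)).trans ?_
              gcongr
              exact min_le_left _ _
          _ = ENNReal.ofReal (32 * (2⁻¹) ^ j) * localMaximal g x := by
              rw [← mul_assoc, ← ENNReal.ofReal_mul (by positivity)]
              congr 2
              rw [show (4 : ℝ) ^ j = 2 ^ j * 2 ^ j by rw [← mul_pow]; norm_num, inv_pow]
              field_simp; norm_num
          _ = _ := by
              rw [ENNReal.ofReal_mul (by norm_num), ENNReal.ofReal_pow (by norm_num),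
                ENNReal.ofReal_inv_of_pos (by norm_num)]
              norm_num
    _ = 64 * localMaximal g x := by
        rw [ENNReal.tsum_mul_right, ENNReal.tsum_mul_left, ENNReal.tsum_geometric,
          ENNReal.one_sub_inv_two, inv_inv]
        norm_num

/-- The three regions are `y ≤ 19x/20`, `|x - y| < x/20` and `y ≥ 21x/20`. Away from the diagonal
the Gaussian factor absorbs every power of `x²/t` or `y²/t`; near it the kernel is dominated
by the Gauss–Weierstrass kernel and by `x⁻¹`. -/
theorem exists_posSemigroup_le {ν : ℝ} (hν : ν < 1) :
    ∃ C : ℝ≥0, ∀ g : ℝ → ℝ≥0∞, Measurable g → ∀ t x : ℝ, 0 < t → 0 < x →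
      posSemigroup ν t g x ≤ C * (lowerHardy g x + localMaximal g x + upperHardyAt ν t g x) := by
  obtain ⟨_, C, _, hC, h⟩ := exists_heatDensity_bounds hν
  obtain ⟨A, hA, hlow⟩ := gaussMajorant_lower hν
  obtain ⟨L, hL, hloc⟩ := gaussMajorant_local hν
  obtain ⟨B, hB, hupp⟩ := gaussMajorant_upper hν
  refine ⟨(C * (A + 65 * L + B)).toNNReal, fun g hg t x ht hx => ?_⟩
  change _ ≤ ENNReal.ofReal (C * (A + 65 * L + B)) * _
  have hcover : Ioi (0 : ℝ) ⊆ (Ioc 0 (19 / 20 * x) ∪ Metric.ball x (x / 20)) ∪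
      Ici (21 / 20 * x) := by
    intro y hy
    have hy : 0 < y := hy
    by_cases h1 : y ≤ 19 / 20 * x
    · exact Or.inl (Or.inl ⟨hy, h1⟩)
    by_cases h2 : 21 / 20 * x ≤ y
    · exact Or.inr h2
    · refine Or.inl (Or.inr ?_)
      rw [Metric.mem_ball, Real.dist_eq, abs_lt]
      constructor <;> linarith
  have hstep : posSemigroup ν t g x ≤ ENNReal.ofReal C *
      ∫⁻ y in Ioi 0, ENNReal.ofReal (gaussMajorant ν t x y) * g y := by
    rw [posSemigroup, ← lintegral_const_mul' _ _ ENNReal.ofReal_ne_top]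
    refine setLIntegral_mono' measurableSet_Ioi fun y hy => ?_
    rw [← mul_assoc, ← ENNReal.ofReal_mul hC.le]
    gcongr
    exact (h t x y ht hx hy).2
  have h1 : ∫⁻ y in Ioc 0 (19 / 20 * x), ENNReal.ofReal (gaussMajorant ν t x y) * g y ≤
      ENNReal.ofReal A * lowerHardy g x := by
    rw [lowerHardy, ← lintegral_const_mul' _ _ ENNReal.ofReal_ne_top,
      ← lintegral_const_mul' _ _ ENNReal.ofReal_ne_top]
    refine (setLIntegral_mono' measurableSet_Ioc fun y hy => ?_).trans (lintegral_mono_set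
      fun y hy => ⟨hy.1, lt_of_le_of_lt hy.2 (by linarith)⟩)
    rw [← mul_assoc, ← mul_assoc, ← ENNReal.ofReal_mul hA.le, ← ENNReal.ofReal_mul (by positivity),
      mul_assoc A]
    gcongr
    exact hlow t x y ht hx hy.1 hy.2
  have h3 : ∫⁻ y in Ici (21 / 20 * x), ENNReal.ofReal (gaussMajorant ν t x y) * g y ≤
      ENNReal.ofReal B * upperHardyAt ν t g x := by
    rw [upperHardyAt, ← lintegral_const_mul' _ _ ENNReal.ofReal_ne_top,
      ← lintegral_const_mul' _ _ ENNReal.ofReal_ne_top]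
    refine (setLIntegral_mono' measurableSet_Ici fun y hy => ?_).trans (lintegral_mono_set
      fun y hy => lt_of_lt_of_le (show x < 21 / 20 * x by linarith) hy)
    rw [← mul_assoc, ← mul_assoc, ← ENNReal.ofReal_mul hB.le, ← ENNReal.ofReal_mul (by positivity),
      mul_assoc B]
    gcongr
    exact hupp t x y ht hx hy
  have h2 : ∫⁻ y in Metric.ball x (x / 20), ENNReal.ofReal (gaussMajorant ν t x y) * g y ≤
      ENNReal.ofReal (65 * L) * localMaximal g x := by
    calc _ ≤ ∫⁻ y in Metric.ball x (x / 20), ENNReal.ofReal L * (ENNReal.ofReal x⁻¹ * g y +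
          ENNReal.ofReal ((√t)⁻¹ * Real.exp (-(x - y) ^ 2 / (4 * t))) * g y) := by
          refine setLIntegral_mono' measurableSet_ball fun y hy => ?_
          rw [← add_mul, ← mul_assoc, ← ENNReal.ofReal_add (by positivity) (by positivity),
            ← ENNReal.ofReal_mul hL.le]
          gcongr
          refine hloc t x y ht hx ?_
          rw [Metric.mem_ball, Real.dist_eq, abs_sub_comm] at hy
          exact hy
      _ = ENNReal.ofReal L * (ENNReal.ofReal x⁻¹ * (∫⁻ y in Metric.ball x (x / 20), g y) +
          ∫⁻ y in Metric.ball x (x / 20),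
            ENNReal.ofReal ((√t)⁻¹ * Real.exp (-(x - y) ^ 2 / (4 * t))) * g y) := by
          rw [lintegral_const_mul' _ _ ENNReal.ofReal_ne_top, lintegral_add_left (by fun_prop),
            lintegral_const_mul' _ _ ENNReal.ofReal_ne_top]
      _ ≤ ENNReal.ofReal L * (ENNReal.ofReal x⁻¹ * (ENNReal.ofReal (2 * (x / 20)) *
          localMaximal g x) + 64 * localMaximal g x) := by
          gcongr
          · exact lintegral_ball_le_localMaximal g (by positivity) le_rfl
          · exact lintegral_gauss_le_localMaximal hg ht hx
      _ ≤ ENNReal.ofReal L * (1 * localMaximal g x + 64 * localMaximal g x) := by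
          rw [← mul_assoc (ENNReal.ofReal x⁻¹), ← ENNReal.ofReal_mul (by positivity)]
          gcongr
          rw [ENNReal.ofReal_le_one]
          field_simp; norm_num
      _ = _ := by
          rw [← add_mul, ← mul_assoc, mul_comm 65, ENNReal.ofReal_mul hL.le]
          norm_num
  have hAL : (0 : ℝ) ≤ 65 * L := by positivity
  calc posSemigroup ν t g x ≤ ENNReal.ofReal C *
      (ENNReal.ofReal A * lowerHardy g x + ENNReal.ofReal (65 * L) * localMaximal g x +
        ENNReal.ofReal B * upperHardyAt ν t g x) := by
        refine hstep.trans ?_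
        gcongr
        refine (lintegral_mono_set hcover).trans ((lintegral_union_le _ _ _).trans ?_)
        gcongr
        refine (lintegral_union_le _ _ _).trans ?_
        gcongr
    _ ≤ ENNReal.ofReal C * (ENNReal.ofReal (A + 65 * L + B) *
        (lowerHardy g x + localMaximal g x + upperHardyAt ν t g x)) := by
        refine mul_le_mul' le_rfl ?_
        rw [mul_add, mul_add]
        gcongr <;> linarith
    _ = _ := by rw [← mul_assoc, ← ENNReal.ofReal_mul hC.le]

/-! ### Power integrals and power measures -/

theorem lintegral_Ioo_rpow {s R : ℝ} (hs : 0 < s) (hR : 0 < R) :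
    ∫⁻ x in Ioo 0 R, ENNReal.ofReal (x ^ (s - 1)) = ENNReal.ofReal (R ^ s / s) := by
  have hint : IntegrableOn (fun x : ℝ => x ^ (s - 1)) (Ioc 0 R) :=
    (intervalIntegrable_iff_integrableOn_Ioc_of_le hR.le).1
      (intervalIntegral.intervalIntegrable_rpow' (by linarith))
  rw [setLIntegral_congr Ioo_ae_eq_Ioc, ← ofReal_integral_eq_lintegral_ofReal hint]
  · rw [← intervalIntegral.integral_of_le hR.le, integral_rpow (Or.inl (by linarith)),
      sub_add_cancel, Real.zero_rpow hs.ne', sub_zero]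
  · filter_upwards [ae_restrict_mem measurableSet_Ioc] with x hx
    exact Real.rpow_nonneg hx.1.le _

theorem lintegral_Ioi_rpow {s R : ℝ} (hs : s < 0) (hR : 0 < R) :
    ∫⁻ x in Ioi R, ENNReal.ofReal (x ^ (s - 1)) = ENNReal.ofReal (R ^ s / -s) := by
  rw [← ofReal_integral_eq_lintegral_ofReal (integrableOn_Ioi_rpow_of_lt (by linarith) hR)]
  · rw [integral_Ioi_rpow_of_lt (by linarith) hR, sub_add_cancel]
    congr 1; rw [neg_div, div_neg]
  · filter_upwards [ae_restrict_mem measurableSet_Ioi] with x hx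
    exact Real.rpow_nonneg (hR.trans hx).le _

instance instSFinitePowerMeasure (δ : ℝ) : SFinite (powerMeasure δ) := by
  unfold powerMeasure; infer_instance

theorem ae_pos_powerMeasure (δ : ℝ) : ∀ᵐ x ∂(powerMeasure δ), 0 < x :=
  (powerMeasure_absolutelyContinuous δ).ae_le (ae_restrict_mem measurableSet_Ioi)

theorem powerMeasure_eq_lintegral (δ : ℝ) {s : Set ℝ} (hs : MeasurableSet s) (h0 : s ⊆ Ioi 0) :
    powerMeasure δ s = ∫⁻ x in s, ENNReal.ofReal (x ^ δ) := by
  rw [powerMeasure, withDensity_apply _ hs, Measure.restrict_restrict hs, inter_eq_left.2 h0]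

theorem lintegral_powerMeasure_mono {δ : ℝ} {F G : ℝ → ℝ≥0∞} (h : ∀ x, 0 < x → F x ≤ G x) :
    ∫⁻ x, F x ∂(powerMeasure δ) ≤ ∫⁻ x, G x ∂(powerMeasure δ) :=
  lintegral_mono_ae ((ae_pos_powerMeasure δ).mono h)

/-! ### The local maximal function -/

theorem measurable_localMaximal {g : ℝ → ℝ≥0∞} (hg : Measurable g) :
    Measurable (localMaximal g) := by
  refine Measurable.iSup fun r => ?_
  have h1 : Measurable fun x : ℝ => ∫⁻ y in Metric.closedBall x r, g y := by
    have e : ∀ x : ℝ, ∫⁻ y in Metric.closedBall x r, g y =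
        ∫⁻ y, {q : ℝ × ℝ | dist q.2 q.1 ≤ r}.indicator (fun q => g q.2) (x, y) := fun x => by
      rw [← lintegral_indicator measurableSet_closedBall]
      rfl
    simp_rw [e]
    exact Measurable.lintegral_prod_right' (Measurable.indicator (by fun_prop)
      (measurableSet_le (measurable_snd.dist measurable_fst) measurable_const))
  have h2 : (fun x : ℝ => ⨆ (_ : 0 < (r : ℝ) ∧ (r : ℝ) ≤ x / 10),
      ENNReal.ofReal (r : ℝ)⁻¹ * ∫⁻ y in Metric.closedBall x r, g y) =
      {x : ℝ | 0 < (r : ℝ) ∧ (r : ℝ) ≤ x / 10}.indicator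
        (fun x => ENNReal.ofReal (r : ℝ)⁻¹ * ∫⁻ y in Metric.closedBall x r, g y) := by
    ext x
    by_cases hx : 0 < (r : ℝ) ∧ (r : ℝ) ≤ x / 10
    · rw [indicator_of_mem (show x ∈ {x : ℝ | 0 < (r : ℝ) ∧ (r : ℝ) ≤ x / 10} from hx),
        iSup_pos hx]
    · rw [indicator_of_notMem (show x ∉ {x : ℝ | 0 < (r : ℝ) ∧ (r : ℝ) ≤ x / 10} from hx),
        iSup_neg hx]
      rfl
  rw [h2]
  refine (h1.const_mul _).indicator ?_
  exact (MeasurableSet.const _).inter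
    (measurableSet_le measurable_const (measurable_id.div_const 10))

theorem powerMeasure_closedBall_le (δ : ℝ) {x r : ℝ} (hrx : r ≤ x / 2) (hx : 0 < x) :
    powerMeasure δ (Metric.closedBall x r) ≤ ENNReal.ofReal (2 ^ |δ| * x ^ δ * (2 * r)) := by
  rw [powerMeasure, withDensity_apply _ measurableSet_closedBall,
    Measure.restrict_restrict measurableSet_closedBall]
  calc ∫⁻ y in Metric.closedBall x r ∩ Ioi 0, ENNReal.ofReal (y ^ δ)
      ≤ ∫⁻ y in Metric.closedBall x r ∩ Ioi 0, ENNReal.ofReal (2 ^ |δ| * x ^ δ) := by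
        refine setLIntegral_mono' (measurableSet_closedBall.inter measurableSet_Ioi) fun y hy => ?_
        have h1 := hy.1
        have h2 : 0 < y := hy.2
        rw [Metric.mem_closedBall, Real.dist_eq, abs_le] at h1
        exact ENNReal.ofReal_le_ofReal (rpow_le_two_rpow_abs_mul h2 hx (by linarith) (by linarith))
    _ ≤ ∫⁻ y in Metric.closedBall x r, ENNReal.ofReal (2 ^ |δ| * x ^ δ) :=
        lintegral_mono_set inter_subset_left
    _ = _ := by
        rw [setLIntegral_const, Real.volume_closedBall, ← ENNReal.ofReal_mul (by positivity)]

theorem lintegral_closedBall_mul_le (δ : ℝ) (g : ℝ → ℝ≥0∞) {x r : ℝ} (hrx : r ≤ x / 10)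
    (hx : 0 < x) :
    ENNReal.ofReal (x ^ δ) * ∫⁻ y in Metric.closedBall x r, g y ≤
      ENNReal.ofReal (2 ^ |δ|) * ∫⁻ y in Metric.closedBall x r, g y ∂(powerMeasure δ) := by
  have hsub : Metric.closedBall x r ⊆ Ioi 0 := fun y hy => by
    rw [Metric.mem_closedBall, Real.dist_eq, abs_le] at hy
    show 0 < y
    linarith
  rw [powerMeasure, restrict_withDensity measurableSet_closedBall,
    Measure.restrict_restrict measurableSet_closedBall, inter_eq_left.2 hsub,
    lintegral_withDensity_eq_lintegral_mul_non_measurable _ (measurable_ofReal_rpow δ) (by simp),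
    ← lintegral_const_mul' _ _ ENNReal.ofReal_ne_top,
    ← lintegral_const_mul' _ _ ENNReal.ofReal_ne_top]
  refine setLIntegral_mono' measurableSet_closedBall fun y hy => ?_
  rw [Pi.mul_apply, ← mul_assoc, ← ENNReal.ofReal_mul (by positivity)]
  have h2 : 0 < y := hsub hy
  rw [Metric.mem_closedBall, Real.dist_eq, abs_le] at hy
  gcongr
  exact rpow_le_two_rpow_abs_mul hx h2 (by linarith) (by linarith)

/-- The weak type `(1, 1)` inequality for the local maximal function: the intervals
involved stay away from the origin, where `x ^ δ dx` is doubling, so that the Vitali covering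
lemma applies. -/
theorem exists_localMaximal_weak (δ : ℝ) :
    ∃ C : ℝ≥0, ∀ g : ℝ → ℝ≥0∞, ∀ s : ℝ≥0∞,
      s * powerMeasure δ {x | 0 < x ∧ s < localMaximal g x} ≤
        C * ∫⁻ x, g x ∂(powerMeasure δ) := by
  set K : ℝ := 2 ^ |δ| with hK
  have hK0 : 0 < K := by positivity
  refine ⟨(K * 10 * K).toNNReal, fun g s => ?_⟩
  change _ ≤ ENNReal.ofReal (K * 10 * K) * _
  -- truncation makes the radii bounded, as the covering lemma requires
  set S : ℕ → Set ℝ := fun n => {x | (0 < x ∧ s < localMaximal g x) ∧ x ≤ n} with hS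
  have hU : {x | 0 < x ∧ s < localMaximal g x} = ⋃ n, S n := by
    ext x
    simp only [hS, mem_iUnion, mem_ofPred_eq, exists_and_left]
    exact ⟨fun h => ⟨h, exists_nat_ge x⟩, fun h => h.1⟩
  have hmono : Monotone S := fun m n hmn x hx =>
    ⟨hx.1, hx.2.trans (by exact_mod_cast hmn)⟩
  rw [hU, hmono.measure_iUnion, ENNReal.mul_iSup]
  refine iSup_le fun n => ?_
  have hex : ∀ x : ℝ, ∃ r : ℝ, x ∈ S n → 0 < r ∧ r ≤ x / 10 ∧
      s * ENNReal.ofReal r ≤ ∫⁻ y in Metric.closedBall x r, g y := by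
    intro x
    by_cases hx : x ∈ S n
    · have := hx.1.2
      rw [localMaximal, lt_iSup_iff] at this
      obtain ⟨r, hr⟩ := this
      rw [lt_iSup_iff] at hr
      obtain ⟨⟨hr0, hr1⟩, hr2⟩ := hr
      refine ⟨r, fun _ => ⟨hr0, hr1, ?_⟩⟩
      calc s * ENNReal.ofReal r ≤ (ENNReal.ofReal (r : ℝ)⁻¹ *
            ∫⁻ y in Metric.closedBall x r, g y) * ENNReal.ofReal r := by gcongr
        _ = (ENNReal.ofReal (r : ℝ)⁻¹ * ENNReal.ofReal r) *
            ∫⁻ y in Metric.closedBall x r, g y := by ring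
        _ = _ := by
            rw [← ENNReal.ofReal_mul (by positivity), inv_mul_cancel₀ hr0.ne', ENNReal.ofReal_one,
              one_mul]
    · exact ⟨0, fun h => absurd h hx⟩
  choose r hr using hex
  obtain ⟨u, huS, hdisj, hcov⟩ := Vitali.exists_disjoint_subfamily_covering_enlargement_closedBall
    (S n) (fun x => x) r n (fun x hx => by
      obtain ⟨_, h2, _⟩ := hr x hx
      have := hx.2
      have := hx.1.1
      linarith) 5 (by norm_num)
  have hucount : u.Countable := by
    refine hdisj.countable_of_nonempty_interior fun x hx => ?_
    obtain ⟨h1, -, -⟩ := hr x (huS hx)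
    exact ⟨x, Metric.ball_subset_interior_closedBall (Metric.mem_ball_self h1)⟩
  have hsub : S n ⊆ ⋃ b ∈ u, Metric.closedBall b (5 * r b) := by
    intro x hx
    obtain ⟨b, hb, hxb⟩ := hcov x hx
    exact mem_iUnion₂.2 ⟨b, hb, hxb (Metric.mem_closedBall_self (hr x hx).1.le)⟩
  have : Countable u := hucount.to_subtype
  calc s * powerMeasure δ (S n)
      ≤ s * ∑' b : u, powerMeasure δ (Metric.closedBall (b : ℝ) (5 * r b)) := by
        gcongr
        exact (measure_mono hsub).trans (measure_biUnion_le _ hucount _)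
    _ = ∑' b : u, s * powerMeasure δ (Metric.closedBall (b : ℝ) (5 * r b)) :=
        ENNReal.tsum_mul_left.symm
    _ ≤ ∑' b : u, ENNReal.ofReal (K * 10 * K) *
          ∫⁻ y in Metric.closedBall (b : ℝ) (r b), g y ∂(powerMeasure δ) := by
        refine ENNReal.tsum_le_tsum fun b => ?_
        obtain ⟨h1, h2, h3⟩ := hr b (huS b.2)
        have hb0 : 0 < (b : ℝ) := (huS b.2).1.1
        calc s * powerMeasure δ (Metric.closedBall (b : ℝ) (5 * r b))
            ≤ s * ENNReal.ofReal (K * (b : ℝ) ^ δ * (2 * (5 * r b))) := by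
              gcongr
              exact powerMeasure_closedBall_le δ (by linarith) hb0
          _ = ENNReal.ofReal (K * 10) * (ENNReal.ofReal ((b : ℝ) ^ δ) *
              (s * ENNReal.ofReal (r b))) := by
              rw [show K * (b : ℝ) ^ δ * (2 * (5 * r b)) = (K * 10) * ((b : ℝ) ^ δ * r b) by ring,
                ENNReal.ofReal_mul (q := (b : ℝ) ^ δ * r b) (by positivity),
                ENNReal.ofReal_mul (p := (b : ℝ) ^ δ) (by positivity)]
              ring
          _ ≤ ENNReal.ofReal (K * 10) * (ENNReal.ofReal ((b : ℝ) ^ δ) *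
              ∫⁻ y in Metric.closedBall (b : ℝ) (r b), g y) := by gcongr
          _ ≤ ENNReal.ofReal (K * 10) * (ENNReal.ofReal K *
              ∫⁻ y in Metric.closedBall (b : ℝ) (r b), g y ∂(powerMeasure δ)) :=
              mul_le_mul' le_rfl (lintegral_closedBall_mul_le δ g h2 hb0)
          _ = _ := by rw [← mul_assoc, ← ENNReal.ofReal_mul (by positivity)]
    _ = ENNReal.ofReal (K * 10 * K) *
          ∫⁻ y in ⋃ b ∈ u, Metric.closedBall b (r b), g y ∂(powerMeasure δ) := by
        rw [ENNReal.tsum_mul_left,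
          lintegral_biUnion hucount (fun _ _ => measurableSet_closedBall) hdisj]
    _ ≤ _ := by
        gcongr
        exact Measure.restrict_le_self

/-- The layer cake formula for a single value `a`, including `a = ∞`. -/
theorem lintegral_layer (a : ℝ≥0∞) {q : ℝ} (hq : 0 < q) :
    ∫⁻ l in Ioi (0 : ℝ), ENNReal.ofReal (l ^ (q - 1)) *
      {l : ℝ | ENNReal.ofReal l < a}.indicator 1 l = ENNReal.ofReal q⁻¹ * a ^ q := by
  have hfin : ∀ R : ℝ, 0 < R → ∫⁻ l in Ioi (0 : ℝ), ENNReal.ofReal (l ^ (q - 1)) *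
      (Iio R).indicator 1 l = ENNReal.ofReal q⁻¹ * ENNReal.ofReal R ^ q := by
    intro R hR
    have : ∀ l : ℝ, ENNReal.ofReal (l ^ (q - 1)) * (Iio R).indicator 1 l =
        (Iio R).indicator (fun l => ENNReal.ofReal (l ^ (q - 1))) l := fun l => by
      by_cases hl : l ∈ Iio R <;> simp [hl]
    simp_rw [this]
    rw [lintegral_indicator measurableSet_Iio, Measure.restrict_restrict measurableSet_Iio,
      inter_comm, Ioi_inter_Iio, lintegral_Ioo_rpow hq hR, ENNReal.ofReal_rpow_of_pos hR,
      ← ENNReal.ofReal_mul (by positivity)]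
    congr 1; field_simp
  rcases eq_or_ne a ∞ with rfl | ha
  · rw [ENNReal.top_rpow_of_pos hq, ENNReal.mul_top (by simpa using hq)]
    refine ENNReal.eq_top_of_forall_nnreal_le fun r => ?_
    have hR : (0 : ℝ) < (q * (r + 1)) ^ q⁻¹ := by positivity
    calc (r : ℝ≥0∞) ≤ ENNReal.ofReal (r + 1) := by
          rw [ENNReal.ofReal_add (by positivity) (by positivity), ENNReal.ofReal_coe_nnreal]
          exact le_self_add
      _ = ENNReal.ofReal q⁻¹ * ENNReal.ofReal ((q * (r + 1)) ^ q⁻¹) ^ q := by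
          rw [ENNReal.ofReal_rpow_of_pos hR, ← ENNReal.ofReal_mul (by positivity),
            ← Real.rpow_mul (by positivity), inv_mul_cancel₀ hq.ne', Real.rpow_one]
          congr 1; field_simp
      _ ≤ _ := by
          rw [← hfin _ hR]
          gcongr with l
          exact fun l _ => ENNReal.ofReal_lt_top
  · rcases eq_or_ne a 0 with rfl | h0
    · simp [hq]
    · have hR : 0 < a.toReal := ENNReal.toReal_pos h0 ha
      have h1 := hfin _ hR
      rw [ENNReal.ofReal_toReal ha] at h1
      rw [← h1]
      refine setLIntegral_congr_fun measurableSet_Ioi fun l hl => ?_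
      have hiff := ENNReal.ofReal_lt_iff_lt_toReal (le_of_lt hl) ha
      by_cases h : ENNReal.ofReal l < a
      · simp [h, hiff.1 h]
      · have h' : ¬l < a.toReal := fun h' => h (hiff.2 h')
        have h'' : l ∉ Iio a.toReal := h'
        rw [indicator_of_notMem h'', indicator_of_notMem (by simpa using h)]

/-- The local maximal function is bounded on `L^p(x^δ dx)` for `p > 1`, by interpolation between the
weak type `(1, 1)` inequality and the trivial bound on `L^∞`. -/
theorem exists_localMaximal_strong (δ : ℝ) {p : ℝ} (hp : 1 < p) :
    ∃ C : ℝ≥0, ∀ g : ℝ → ℝ≥0∞, Measurable g →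
      ∫⁻ x, localMaximal g x ^ p ∂(powerMeasure δ) ≤ C * ∫⁻ x, g x ^ p ∂(powerMeasure δ) := by
  obtain ⟨C, hC⟩ := exists_localMaximal_weak δ
  refine ⟨3 ^ p * (p.toNNReal * (C * (p - 1)⁻¹.toNNReal)), fun g hg => ?_⟩
  set m := powerMeasure δ with hm
  set F : ℝ → ℝ≥0∞ := fun x => 3⁻¹ * localMaximal g x with hF
  have hFm : Measurable F := (measurable_localMaximal hg).const_mul _
  -- values of `g` below the level `l` contribute at most `2 * l` to the averages, so only the part of
  -- `g` above `l` matters where the maximal function exceeds `3 * l`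
  have hlevel : ∀ l : ℝ, 0 < l → ENNReal.ofReal l * m {x | ENNReal.ofReal l < F x} ≤
      C * ∫⁻ x, {x | ENNReal.ofReal l < g x}.indicator g x ∂m := by
    intro l hl
    set G := {x | ENNReal.ofReal l < g x}.indicator g with hG
    refine le_trans ?_ (hC G (ENNReal.ofReal l))
    gcongr 1
    refine measure_mono_ae ?_
    filter_upwards [ae_pos_powerMeasure δ] with x hx hlx
    refine ⟨hx, ?_⟩
    have hlx : ENNReal.ofReal l < 3⁻¹ * localMaximal g x := hlx
    have hle : localMaximal g x ≤ localMaximal G x + 2 * ENNReal.ofReal l := by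
      refine iSup₂_le fun r hr => ?_
      have h1 : ENNReal.ofReal (r : ℝ)⁻¹ * ∫⁻ y in Metric.closedBall x r, G y ≤
          localMaximal G x := le_iSup₂_of_le r hr le_rfl
      have h2 : ∀ y, g y ≤ G y + ENNReal.ofReal l := fun y => by
        by_cases hy : ENNReal.ofReal l < g y
        · rw [hG, indicator_of_mem (show y ∈ {x | ENNReal.ofReal l < g x} from hy)]
          exact le_self_add
        · exact (not_lt.1 hy).trans le_add_self
      calc _ ≤ ENNReal.ofReal (r : ℝ)⁻¹ *
            ∫⁻ y in Metric.closedBall x r, (G y + ENNReal.ofReal l) := by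
            gcongr with y; exact h2 y
        _ = ENNReal.ofReal (r : ℝ)⁻¹ * (∫⁻ y in Metric.closedBall x r, G y) +
            ENNReal.ofReal (r : ℝ)⁻¹ * (ENNReal.ofReal l * ENNReal.ofReal (2 * r)) := by
            rw [lintegral_add_right _ measurable_const, setLIntegral_const,
              Real.volume_closedBall, mul_add]
        _ ≤ _ := by
            refine add_le_add h1 (le_of_eq ?_)
            have hr0 := hr.1
            rw [← ENNReal.ofReal_mul hl.le, ← ENNReal.ofReal_mul (by positivity),
              show (r : ℝ)⁻¹ * (l * (2 * r)) = 2 * l by field_simp,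
              ENNReal.ofReal_mul (by norm_num)]
            norm_num
    by_contra hcon
    rw [not_lt] at hcon
    have h3 : localMaximal g x ≤ 3 * ENNReal.ofReal l := by
      refine hle.trans ((add_le_add_left hcon _).trans (le_of_eq ?_))
      ring
    have h4 : 3⁻¹ * localMaximal g x ≤ ENNReal.ofReal l := by
      calc 3⁻¹ * localMaximal g x ≤ 3⁻¹ * (3 * ENNReal.ofReal l) := by gcongr
        _ = _ := by
          rw [← mul_assoc, ENNReal.inv_mul_cancel (by norm_num) (by norm_num), one_mul]
    exact absurd hlx (not_lt.2 h4)
  have hmeasF : MeasurableSet {q : ℝ × ℝ | ENNReal.ofReal q.2 < F q.1} :=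
    measurableSet_lt (by fun_prop) (by fun_prop)
  have hmeasg : MeasurableSet {q : ℝ × ℝ | ENNReal.ofReal q.1 < g q.2} :=
    measurableSet_lt (by fun_prop) (by fun_prop)
  have hp1 : 0 < p - 1 := by linarith
  have hmain : ENNReal.ofReal p⁻¹ * ∫⁻ x, F x ^ p ∂m ≤
      C * (ENNReal.ofReal (p - 1)⁻¹ * ∫⁻ x, g x ^ p ∂m) := by
    calc ENNReal.ofReal p⁻¹ * ∫⁻ x, F x ^ p ∂m
        = ∫⁻ x, (∫⁻ l in Ioi (0 : ℝ), ENNReal.ofReal (l ^ (p - 1)) *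
            {l : ℝ | ENNReal.ofReal l < F x}.indicator 1 l) ∂m := by
          rw [← lintegral_const_mul' _ _ ENNReal.ofReal_ne_top]
          refine lintegral_congr fun x => ?_
          rw [lintegral_layer _ (by linarith)]
      _ = ∫⁻ l in Ioi (0 : ℝ), ∫⁻ x, ENNReal.ofReal (l ^ (p - 1)) *
            {l : ℝ | ENNReal.ofReal l < F x}.indicator 1 l ∂m := by
          refine lintegral_lintegral_swap (Measurable.aemeasurable ?_)
          refine Measurable.mul (by fun_prop) ?_
          exact (measurable_one (α := ℝ≥0∞)).indicator hmeasF
      _ = ∫⁻ l in Ioi (0 : ℝ), ENNReal.ofReal (l ^ (p - 1)) * m {x | ENNReal.ofReal l < F x} := by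
          refine lintegral_congr fun l => ?_
          rw [lintegral_const_mul' _ _ ENNReal.ofReal_ne_top, ← lintegral_indicator_one
            (measurableSet_lt measurable_const hFm)]
          rfl
      _ ≤ ∫⁻ l in Ioi (0 : ℝ), C * ∫⁻ x, g x * (ENNReal.ofReal (l ^ (p - 1 - 1)) *
            {l : ℝ | ENNReal.ofReal l < g x}.indicator 1 l) ∂m := by
          refine setLIntegral_mono' measurableSet_Ioi fun l hl => ?_
          have hl : 0 < l := hl
          calc ENNReal.ofReal (l ^ (p - 1)) * m {x | ENNReal.ofReal l < F x}
              = ENNReal.ofReal (l ^ (p - 1 - 1)) *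
                (ENNReal.ofReal l * m {x | ENNReal.ofReal l < F x}) := by
                rw [← mul_assoc, ← ENNReal.ofReal_mul (by positivity),
                  ← Real.rpow_add_one hl.ne', sub_add_cancel]
            _ ≤ ENNReal.ofReal (l ^ (p - 1 - 1)) *
                (C * ∫⁻ x, {x | ENNReal.ofReal l < g x}.indicator g x ∂m) := by
                gcongr 1; exact hlevel l hl
            _ = C * (ENNReal.ofReal (l ^ (p - 1 - 1)) *
                ∫⁻ x, {x | ENNReal.ofReal l < g x}.indicator g x ∂m) := by ring
            _ = _ := by
                rw [← lintegral_const_mul' _ _ ENNReal.ofReal_ne_top]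
                congr 1
                refine lintegral_congr fun x => ?_
                by_cases h : ENNReal.ofReal l < g x
                · simp [h, mul_comm]
                · simp [h]
      _ = C * ∫⁻ l in Ioi (0 : ℝ), ∫⁻ x, g x * (ENNReal.ofReal (l ^ (p - 1 - 1)) *
            {l : ℝ | ENNReal.ofReal l < g x}.indicator 1 l) ∂m :=
          lintegral_const_mul' _ _ ENNReal.coe_ne_top
      _ = C * ∫⁻ x, (∫⁻ l in Ioi (0 : ℝ), g x * (ENNReal.ofReal (l ^ (p - 1 - 1)) *
            {l : ℝ | ENNReal.ofReal l < g x}.indicator 1 l)) ∂m := by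
          congr 1
          refine lintegral_lintegral_swap (Measurable.aemeasurable ?_)
          refine Measurable.mul (by fun_prop) (Measurable.mul (by fun_prop) ?_)
          exact (measurable_one (α := ℝ≥0∞)).indicator hmeasg
      _ = C * ∫⁻ x, ENNReal.ofReal (p - 1)⁻¹ * g x ^ p ∂m := by
          congr 1
          refine lintegral_congr fun x => ?_
          have hmeas : Measurable fun l : ℝ => ENNReal.ofReal (l ^ (p - 1 - 1)) *
              {l : ℝ | ENNReal.ofReal l < g x}.indicator 1 l :=
            Measurable.mul (by fun_prop) ((measurable_one (α := ℝ≥0∞)).indicator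
              (measurableSet_lt (by fun_prop) measurable_const))
          rw [lintegral_const_mul _ hmeas, lintegral_layer _ hp1, mul_left_comm]
          congr 1
          conv_rhs => rw [show p = 1 + (p - 1) by ring, ENNReal.rpow_add_of_nonneg _ _ zero_le_one
            hp1.le, ENNReal.rpow_one]
      _ = _ := by rw [lintegral_const_mul' _ _ ENNReal.ofReal_ne_top]
  have hp0 : 0 < p := by linarith
  calc ∫⁻ x, localMaximal g x ^ p ∂m = 3 ^ p * (ENNReal.ofReal p *
        (ENNReal.ofReal p⁻¹ * ∫⁻ x, F x ^ p ∂m)) := by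
        rw [← mul_assoc (ENNReal.ofReal p), ← ENNReal.ofReal_mul hp0.le, mul_inv_cancel₀ hp0.ne',
          ENNReal.ofReal_one, one_mul, ← lintegral_const_mul' _ _ (by simp)]
        refine lintegral_congr fun x => ?_
        rw [hF, ← ENNReal.mul_rpow_of_nonneg _ _ hp0.le, ← mul_assoc,
          ENNReal.mul_inv_cancel (by norm_num) (by norm_num), one_mul]
    _ ≤ 3 ^ p * (ENNReal.ofReal p * (C * (ENNReal.ofReal (p - 1)⁻¹ * ∫⁻ x, g x ^ p ∂m))) := by
        gcongr
    _ = _ := by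
        push_cast [ENNReal.coe_rpow_of_nonneg _ hp0.le]
        simp only [ENNReal.ofReal]
        ring

/-! ### Hardy operators -/

/-- Jensen's inequality for the power `p`, in the unnormalized form. -/
theorem lintegral_rpow_le_of_one_le {α : Type*} [MeasurableSpace α] {ρ : Measure α} {p : ℝ}
    (hp : 1 ≤ p) {h : α → ℝ≥0∞} (hh : AEMeasurable h ρ) :
    (∫⁻ x, h x ∂ρ) ^ p ≤ ρ univ ^ (p - 1) * ∫⁻ x, h x ^ p ∂ρ := by
  have hp0 : 0 < p := by linarith
  have h1 := eLpNorm'_le_eLpNorm'_mul_rpow_measure_univ (μ := ρ) (f := h) one_pos hp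
    hh.aestronglyMeasurable
  have h2 := ENNReal.rpow_le_rpow h1 hp0.le
  simp only [eLpNorm'_eq_lintegral_enorm, enorm_eq_self, ENNReal.rpow_one, div_one] at h2
  rw [ENNReal.mul_rpow_of_nonneg _ _ hp0.le, ← ENNReal.rpow_mul, ← ENNReal.rpow_mul,
    one_div, inv_mul_cancel₀ hp0.ne', ENNReal.rpow_one] at h2
  rw [mul_comm]
  convert! h2 using 3
  field_simp

/-- The Hardy operator `x ^ (-b) ∫ y ^ (b - 1) g(y) dy`, the integral being over the `y > 0` with
`(x, y) ∈ E`. -/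
noncomputable def hardyOp (E : Set (ℝ × ℝ)) (b : ℝ) (g : ℝ → ℝ≥0∞) (x : ℝ) : ℝ≥0∞ :=
  ENNReal.ofReal (x ^ (-b)) *
    ∫⁻ y in Ioi 0, E.indicator 1 (x, y) * ENNReal.ofReal (y ^ (b - 1)) * g y

theorem measurable_hardyOp {E : Set (ℝ × ℝ)} (hE : MeasurableSet E) (b : ℝ) {g : ℝ → ℝ≥0∞}
    (hg : Measurable g) : Measurable (hardyOp E b g) := by
  refine Measurable.mul (by fun_prop) ?_
  refine Measurable.lintegral_prod_right'
    (f := fun q : ℝ × ℝ => E.indicator 1 q * ENNReal.ofReal (q.2 ^ (b - 1)) * g q.2) ?_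
  exact (((measurable_one (α := ℝ≥0∞)).indicator hE).mul (by fun_prop)).mul (by fun_prop)

/-- Schur's test for Hardy operators with power weights. -/
theorem hardyOp_strong {E : Set (ℝ × ℝ)} (hE : MeasurableSet E) {b p δ σ : ℝ} (hp : 1 ≤ p)
    {C₁ C₂ : ℝ≥0}
    (h1 : ∀ x : ℝ, 0 < x → ∫⁻ y in Ioi 0, E.indicator 1 (x, y) * ENNReal.ofReal (y ^ (σ - 1)) ≤
      C₁ * ENNReal.ofReal (x ^ σ))
    (h2 : ∀ y : ℝ, 0 < y → ∫⁻ x in Ioi 0, E.indicator 1 (x, y) *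
      ENNReal.ofReal (x ^ (δ + 1 - b * p + σ * (p - 1) - 1)) ≤
      C₂ * ENNReal.ofReal (y ^ (δ + 1 - b * p + σ * (p - 1))))
    {g : ℝ → ℝ≥0∞} (hg : Measurable g) :
    ∫⁻ x, hardyOp E b g x ^ p ∂(powerMeasure δ) ≤
      (C₁ ^ (p - 1) * C₂ : ℝ≥0) * ∫⁻ x, g x ^ p ∂(powerMeasure δ) := by
  have hp0 : 0 < p := by linarith
  have hp1 : 0 ≤ p - 1 := by linarith
  set τ := δ + 1 - b * p + σ * (p - 1) with hτ
  rw [lintegral_powerMeasure, lintegral_powerMeasure]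
  have hEm : Measurable fun q : ℝ × ℝ => E.indicator (1 : ℝ × ℝ → ℝ≥0∞) q :=
    (measurable_one (α := ℝ≥0∞)).indicator hE
  have hEx : ∀ x : ℝ, Measurable fun y : ℝ => E.indicator (1 : ℝ × ℝ → ℝ≥0∞) (x, y) :=
    fun x => hEm.comp (by fun_prop)
  have hEy : ∀ y : ℝ, Measurable fun x : ℝ => E.indicator (1 : ℝ × ℝ → ℝ≥0∞) (x, y) :=
    fun y => hEm.comp (by fun_prop)
  have hpt : ∀ x ∈ Ioi (0 : ℝ), ENNReal.ofReal (x ^ δ) * hardyOp E b g x ^ p ≤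
      ∫⁻ y in Ioi 0, (C₁ : ℝ≥0∞) ^ (p - 1) * (ENNReal.ofReal (y ^ (δ - τ)) * g y ^ p *
        (E.indicator 1 (x, y) * ENNReal.ofReal (x ^ (τ - 1)))) := by
    intro x hx
    have hx : 0 < x := hx
    set w : ℝ → ℝ≥0∞ := fun y => E.indicator 1 (x, y) * ENNReal.ofReal (y ^ (σ - 1)) with hw
    have hwm : Measurable w := (hEx x).mul (by fun_prop)
    have hwtop : ∀ y, w y < ∞ := fun y => by
      refine ENNReal.mul_lt_top ?_ ENNReal.ofReal_lt_top
      by_cases hy : (x, y) ∈ E <;> simp [hy]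
    set ρ := (volume.restrict (Ioi (0 : ℝ))).withDensity w with hρ
    have hρu : ρ univ ≤ C₁ * ENNReal.ofReal (x ^ σ) := by
      rw [hρ, withDensity_apply _ MeasurableSet.univ, Measure.restrict_univ]
      exact h1 x hx
    have e1 : ∫⁻ y in Ioi 0, E.indicator 1 (x, y) * ENNReal.ofReal (y ^ (b - 1)) * g y =
        ∫⁻ y, ENNReal.ofReal (y ^ (b - σ)) * g y ∂ρ := by
      rw [hρ, lintegral_withDensity_eq_lintegral_mul_non_measurable _ hwm
        (Eventually.of_forall hwtop)]
      refine setLIntegral_congr_fun measurableSet_Ioi fun y hy => ?_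
      have hy : 0 < y := hy
      simp only [hw, Pi.mul_apply]
      rw [show b - 1 = (σ - 1) + (b - σ) by ring, Real.rpow_add hy,
        ENNReal.ofReal_mul (by positivity)]
      ring
    have e2 : ∫⁻ y, (ENNReal.ofReal (y ^ (b - σ)) * g y) ^ p ∂ρ =
        ∫⁻ y in Ioi 0, E.indicator 1 (x, y) * (ENNReal.ofReal (y ^ (δ - τ)) * g y ^ p) := by
      rw [hρ, lintegral_withDensity_eq_lintegral_mul_non_measurable _ hwm
        (Eventually.of_forall hwtop)]
      refine setLIntegral_congr_fun measurableSet_Ioi fun y hy => ?_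
      have hy : 0 < y := hy
      simp only [hw, Pi.mul_apply]
      rw [ENNReal.mul_rpow_of_nonneg _ _ hp0.le, ENNReal.ofReal_rpow_of_pos (by positivity),
        ← Real.rpow_mul hy.le, show δ - τ = (σ - 1) + (b - σ) * p by rw [hτ]; ring,
        Real.rpow_add hy, ENNReal.ofReal_mul (by positivity)]
      ring
    have e3 : ENNReal.ofReal (x ^ δ) * (ENNReal.ofReal (x ^ (-b)) ^ p *
        ENNReal.ofReal (x ^ σ) ^ (p - 1)) = ENNReal.ofReal (x ^ (τ - 1)) := by
      rw [ENNReal.ofReal_rpow_of_pos (by positivity), ENNReal.ofReal_rpow_of_pos (by positivity),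
        ← ENNReal.ofReal_mul (by positivity), ← ENNReal.ofReal_mul (by positivity),
        ← Real.rpow_mul hx.le, ← Real.rpow_mul hx.le, ← Real.rpow_add hx, ← Real.rpow_add hx]
      congr 2; rw [hτ]; ring
    calc ENNReal.ofReal (x ^ δ) * hardyOp E b g x ^ p
        = ENNReal.ofReal (x ^ δ) * (ENNReal.ofReal (x ^ (-b)) ^ p *
          (∫⁻ y, ENNReal.ofReal (y ^ (b - σ)) * g y ∂ρ) ^ p) := by
          rw [hardyOp, e1, ENNReal.mul_rpow_of_nonneg _ _ hp0.le]
      _ ≤ ENNReal.ofReal (x ^ δ) * (ENNReal.ofReal (x ^ (-b)) ^ p *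
          ((C₁ * ENNReal.ofReal (x ^ σ)) ^ (p - 1) *
            ∫⁻ y, (ENNReal.ofReal (y ^ (b - σ)) * g y) ^ p ∂ρ)) := by
          gcongr
          refine (lintegral_rpow_le_of_one_le hp (by fun_prop)).trans ?_
          gcongr
      _ = ENNReal.ofReal (x ^ (τ - 1)) * ((C₁ : ℝ≥0∞) ^ (p - 1) *
            ∫⁻ y, (ENNReal.ofReal (y ^ (b - σ)) * g y) ^ p ∂ρ) := by
          rw [ENNReal.mul_rpow_of_nonneg _ _ hp1, ← e3]; ring
      _ = _ := by
          rw [e2, ← lintegral_const_mul' _ _ (ENNReal.rpow_ne_top_of_nonneg hp1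
            ENNReal.coe_ne_top), ← lintegral_const_mul' _ _ ENNReal.ofReal_ne_top]
          refine lintegral_congr fun y => ?_
          ring
  calc ∫⁻ x in Ioi 0, ENNReal.ofReal (x ^ δ) * hardyOp E b g x ^ p
      ≤ ∫⁻ x in Ioi 0, ∫⁻ y in Ioi 0, (C₁ : ℝ≥0∞) ^ (p - 1) * (ENNReal.ofReal (y ^ (δ - τ)) *
          g y ^ p * (E.indicator 1 (x, y) * ENNReal.ofReal (x ^ (τ - 1)))) :=
        setLIntegral_mono' measurableSet_Ioi hpt
    _ = ∫⁻ y in Ioi 0, ∫⁻ x in Ioi 0, (C₁ : ℝ≥0∞) ^ (p - 1) * (ENNReal.ofReal (y ^ (δ - τ)) *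
          g y ^ p * (E.indicator 1 (x, y) * ENNReal.ofReal (x ^ (τ - 1)))) := by
        refine lintegral_lintegral_swap (Measurable.aemeasurable ?_)
        refine Measurable.mul (by fun_prop) (Measurable.mul (by fun_prop)
          (Measurable.mul hEm (by fun_prop)))
    _ ≤ ∫⁻ y in Ioi 0, (C₁ ^ (p - 1) * C₂ : ℝ≥0) * (ENNReal.ofReal (y ^ δ) * g y ^ p) := by
        refine setLIntegral_mono' measurableSet_Ioi fun y hy => ?_
        have hy : 0 < y := hy
        have hm1 : Measurable fun x : ℝ => E.indicator (1 : ℝ × ℝ → ℝ≥0∞) (x, y) *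
          ENNReal.ofReal (x ^ (τ - 1)) := (hEy y).mul (by fun_prop)
        rw [lintegral_const_mul _ (hm1.const_mul _), lintegral_const_mul _ hm1]
        calc _ ≤ (C₁ : ℝ≥0∞) ^ (p - 1) * (ENNReal.ofReal (y ^ (δ - τ)) * g y ^ p *
              (C₂ * ENNReal.ofReal (y ^ τ))) := by gcongr; exact h2 y hy
          _ = (C₁ : ℝ≥0∞) ^ (p - 1) * C₂ *
              ((ENNReal.ofReal (y ^ (δ - τ)) * ENNReal.ofReal (y ^ τ)) * g y ^ p) := by ring
          _ = _ := by
            rw [← ENNReal.ofReal_mul (by positivity), ← Real.rpow_add hy, sub_add_cancel,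
              ENNReal.coe_mul, ENNReal.coe_rpow_of_nonneg _ hp1]
    _ = _ := lintegral_const_mul' _ _ ENNReal.coe_ne_top

/-- The region `y < x`. -/
def belowDiag : Set (ℝ × ℝ) := {q | q.2 < q.1}

/-- The region `x < y`. -/
def aboveDiag : Set (ℝ × ℝ) := {q | q.1 < q.2}

theorem measurableSet_belowDiag : MeasurableSet belowDiag :=
  measurableSet_lt measurable_snd measurable_fst

theorem measurableSet_aboveDiag : MeasurableSet aboveDiag :=
  measurableSet_lt measurable_fst measurable_snd

theorem lintegral_Ioi_indicator_lt (a : ℝ) (F : ℝ → ℝ≥0∞) :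
    ∫⁻ z in Ioi 0, (Iio a).indicator 1 z * F z = ∫⁻ z in Ioo 0 a, F z := by
  have : ∀ z : ℝ, (Iio a).indicator 1 z * F z = (Iio a).indicator F z := fun z => by
    by_cases hz : z ∈ Iio a <;> simp [hz]
  simp_rw [this]
  rw [lintegral_indicator measurableSet_Iio, Measure.restrict_restrict measurableSet_Iio,
    inter_comm, Ioi_inter_Iio]

theorem lintegral_Ioi_indicator_gt {a : ℝ} (ha : 0 < a) (F : ℝ → ℝ≥0∞) :
    ∫⁻ z in Ioi 0, (Ioi a).indicator 1 z * F z = ∫⁻ z in Ioi a, F z := by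
  have : ∀ z : ℝ, (Ioi a).indicator 1 z * F z = (Ioi a).indicator F z := fun z => by
    by_cases hz : z ∈ Ioi a <;> simp [hz]
  simp_rw [this]
  rw [lintegral_indicator measurableSet_Ioi, Measure.restrict_restrict measurableSet_Ioi,
    Ioi_inter_Ioi, max_eq_left ha.le]

theorem lowerHardy_eq_hardyOp (g : ℝ → ℝ≥0∞) (x : ℝ) : lowerHardy g x = hardyOp belowDiag 2 g x := by
  rw [lowerHardy, hardyOp, ← lintegral_Ioi_indicator_lt]
  congr 1
  refine setLIntegral_congr_fun measurableSet_Ioi fun y hy => ?_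
  rw [show (2 : ℝ) - 1 = 1 by norm_num, Real.rpow_one, mul_assoc]
  rfl

theorem measurable_bump (ν : ℝ) : Measurable (bump ν) := by
  unfold bump; fun_prop

theorem bump_le_one {ν u : ℝ} (hν : ν < 1) (hu : 0 < u) : bump ν u ≤ 1 := by
  rw [bump]
  rcases le_total u 1 with h | h
  · exact (min_le_left _ _).trans (Real.rpow_le_one hu.le h (by linarith))
  · exact (min_le_right _ _).trans (inv_le_one_of_one_le₀ h)

theorem bump_nonneg {ν u : ℝ} (hu : 0 < u) : 0 ≤ bump ν u :=
  le_min (by positivity) (by positivity)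

theorem upperHardyAt_le_hardyOp {ν t : ℝ} (hν : ν < 1) (ht : 0 < t) (g : ℝ → ℝ≥0∞) {x : ℝ}
    (hx : 0 < x) : upperHardyAt ν t g x ≤ hardyOp aboveDiag (2 * ν) g x := by
  have e : ∫⁻ y in Ioi 0, aboveDiag.indicator 1 (x, y) * ENNReal.ofReal (y ^ (2 * ν - 1)) * g y =
      ∫⁻ y in Ioi x, ENNReal.ofReal (y ^ (2 * ν - 1)) * g y := by
    rw [← lintegral_Ioi_indicator_gt hx]
    refine setLIntegral_congr_fun measurableSet_Ioi fun y hy => ?_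
    rw [mul_assoc]
    rfl
  rw [upperHardyAt, hardyOp, e]
  refine mul_le_mul' le_rfl (setLIntegral_mono' measurableSet_Ioi fun y hy => ?_)
  have hy : 0 < y := hx.trans hy
  gcongr
  exact mul_le_of_le_one_right (by positivity) (bump_le_one hν (by positivity))

theorem lintegral_belowDiag_left (x : ℝ) (F : ℝ → ℝ≥0∞) :
    ∫⁻ y in Ioi 0, belowDiag.indicator 1 (x, y) * F y = ∫⁻ y in Ioo 0 x, F y :=
  lintegral_Ioi_indicator_lt x F

theorem lintegral_belowDiag_right {y : ℝ} (hy : 0 < y) (F : ℝ → ℝ≥0∞) :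
    ∫⁻ x in Ioi 0, belowDiag.indicator 1 (x, y) * F x = ∫⁻ x in Ioi y, F x :=
  lintegral_Ioi_indicator_gt hy F

theorem lintegral_aboveDiag_left {x : ℝ} (hx : 0 < x) (F : ℝ → ℝ≥0∞) :
    ∫⁻ y in Ioi 0, aboveDiag.indicator 1 (x, y) * F y = ∫⁻ y in Ioi x, F y :=
  lintegral_Ioi_indicator_gt hx F

theorem lintegral_aboveDiag_right (y : ℝ) (F : ℝ → ℝ≥0∞) :
    ∫⁻ x in Ioi 0, aboveDiag.indicator 1 (x, y) * F x = ∫⁻ x in Ioo 0 y, F x :=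
  lintegral_Ioi_indicator_lt y F

theorem ofReal_div_eq_inv_toNNReal_mul {a s : ℝ} (ha : 0 ≤ a) :
    ENNReal.ofReal (a / s) = (s⁻¹.toNNReal : ℝ≥0∞) * ENNReal.ofReal a := by
  rw [div_eq_mul_inv, ENNReal.ofReal_mul ha, mul_comm]
  rfl

theorem exists_belowDiag_strong {b p δ : ℝ} (hp : 1 ≤ p) (hδ : δ + 1 < b * p) :
    ∃ C : ℝ≥0, ∀ g : ℝ → ℝ≥0∞, Measurable g →
      ∫⁻ x, hardyOp belowDiag b g x ^ p ∂(powerMeasure δ) ≤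
        C * ∫⁻ x, g x ^ p ∂(powerMeasure δ) := by
  have hp0 : 0 < p := by linarith
  -- any `s > 0` with `s * (p - 1) < b * p - (δ + 1)` would do
  set s := (b * p - (δ + 1)) / p with hs
  have hs0 : 0 < s := by rw [hs]; apply div_pos <;> linarith
  have hsp : s * p = b * p - (δ + 1) := by rw [hs]; field_simp
  have hτ : δ + 1 - b * p + s * (p - 1) < 0 := by nlinarith
  refine ⟨_, fun g hg => hardyOp_strong measurableSet_belowDiag (σ := s) hp
    (C₁ := s⁻¹.toNNReal) (C₂ := (-(δ + 1 - b * p + s * (p - 1)))⁻¹.toNNReal) ?_ ?_ hg⟩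
  · intro x hx
    rw [lintegral_belowDiag_left, lintegral_Ioo_rpow hs0 hx,
      ofReal_div_eq_inv_toNNReal_mul (by positivity)]
  · intro y hy
    rw [lintegral_belowDiag_right hy, lintegral_Ioi_rpow hτ hy,
      ofReal_div_eq_inv_toNNReal_mul (by positivity)]

theorem exists_aboveDiag_strong {b p δ : ℝ} (hp : 1 ≤ p) (hδ : b * p < δ + 1) :
    ∃ C : ℝ≥0, ∀ g : ℝ → ℝ≥0∞, Measurable g →
      ∫⁻ x, hardyOp aboveDiag b g x ^ p ∂(powerMeasure δ) ≤
        C * ∫⁻ x, g x ^ p ∂(powerMeasure δ) := by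
  have hp0 : 0 < p := by linarith
  set s := (b * p - (δ + 1)) / p with hs
  have hs0 : s < 0 := by rw [hs]; apply div_neg_of_neg_of_pos <;> linarith
  have hsp : s * p = b * p - (δ + 1) := by rw [hs]; field_simp
  have hτ : 0 < δ + 1 - b * p + s * (p - 1) := by nlinarith
  refine ⟨_, fun g hg => hardyOp_strong measurableSet_aboveDiag (σ := s) hp
    (C₁ := (-s)⁻¹.toNNReal) (C₂ := (δ + 1 - b * p + s * (p - 1))⁻¹.toNNReal) ?_ ?_ hg⟩
  · intro x hx
    rw [lintegral_aboveDiag_left hx, lintegral_Ioi_rpow hs0 hx,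
      ofReal_div_eq_inv_toNNReal_mul (by positivity)]
  · intro y hy
    rw [lintegral_aboveDiag_right, lintegral_Ioo_rpow hτ hy,
      ofReal_div_eq_inv_toNNReal_mul (by positivity)]

/-! ### Endpoint estimates -/

/-- The function `x ^ (-b)` belongs to the weak space `L^{p,∞}(x^(bp-1) dx)`. -/
theorem exists_rpow_weak {b p : ℝ} (hb : b ≠ 0) (hp : 0 < p) :
    ∃ C : ℝ≥0, C ≠ 0 ∧ ∀ A : ℝ≥0∞, ∀ s : ℝ, 0 < s →
      ENNReal.ofReal (s ^ p) * powerMeasure (b * p - 1)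
        {x | 0 < x ∧ ENNReal.ofReal s < A * ENNReal.ofReal (x ^ (-b))} ≤ C * A ^ p := by
  have hC : 0 < (|b| * p)⁻¹ := by positivity
  refine ⟨(|b| * p)⁻¹.toNNReal, by simpa using hC, fun A s hs => ?_⟩
  change _ ≤ ENNReal.ofReal (|b| * p)⁻¹ * A ^ p
  rcases eq_or_ne A ∞ with rfl | hA
  · rw [ENNReal.top_rpow_of_pos hp, ENNReal.mul_top (by simpa using hC)]
    exact le_top
  rcases eq_or_ne A 0 with rfl | hA0
  · simp
  lift A to ℝ≥0 using hA
  have ha : (0 : ℝ) < A := by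
    have : A ≠ 0 := by simpa using hA0
    exact_mod_cast pos_iff_ne_zero.2 this
  set R : ℝ := ((A : ℝ) / s) ^ b⁻¹ with hR
  have hR0 : 0 < R := by positivity
  have hRb : R ^ b = A / s := by
    rw [hR, ← Real.rpow_mul (by positivity), inv_mul_cancel₀ hb, Real.rpow_one]
  have hRbp : s ^ p * R ^ (b * p) = (A : ℝ) ^ p := by
    rw [Real.rpow_mul hR0.le, hRb, ← Real.mul_rpow hs.le (by positivity), mul_div_cancel₀ _ hs.ne']
  have hmem : ∀ x : ℝ, 0 < x → (ENNReal.ofReal s < A * ENNReal.ofReal (x ^ (-b))) →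
      x ^ b < R ^ b := by
    intro x hx h
    rw [← ENNReal.ofReal_coe_nnreal, ← ENNReal.ofReal_mul ha.le,
      ENNReal.ofReal_lt_ofReal_iff (by positivity), Real.rpow_neg hx.le, ← div_eq_mul_inv,
      lt_div_iff₀ (by positivity)] at h
    rw [hRb, lt_div_iff₀ hs]
    linarith
  have hfinal : ∀ q : ℝ, 0 < q → q = |b| * p →
      ENNReal.ofReal (s ^ p) * ENNReal.ofReal (R ^ (b * p) / q) =
        ENNReal.ofReal (|b| * p)⁻¹ * (A : ℝ≥0∞) ^ p := by
    rintro q hq rfl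
    rw [← ENNReal.ofReal_mul (by positivity), ← ENNReal.ofReal_coe_nnreal,
      ENNReal.ofReal_rpow_of_pos ha, ← ENNReal.ofReal_mul hC.le, ← hRbp]
    congr 1; ring
  rcases lt_or_gt_of_ne hb with hneg | hpos
  · have hsub : {x | 0 < x ∧ ENNReal.ofReal s < A * ENNReal.ofReal (x ^ (-b))} ⊆ Ioi R := by
      rintro x ⟨hx, h⟩
      by_contra hcon
      exact absurd (hmem x hx h)
        (not_lt.2 (Real.rpow_le_rpow_of_nonpos hx (not_lt.1 hcon) hneg.le))
    rw [← hfinal (-(b * p)) (by nlinarith) (by rw [abs_of_neg hneg]; ring)]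
    gcongr
    refine (measure_mono hsub).trans (le_of_eq ?_)
    rw [powerMeasure_eq_lintegral _ measurableSet_Ioi (Ioi_subset_Ioi hR0.le),
      lintegral_Ioi_rpow (by nlinarith) hR0]
  · have hsub : {x | 0 < x ∧ ENNReal.ofReal s < A * ENNReal.ofReal (x ^ (-b))} ⊆ Ioo 0 R := by
      rintro x ⟨hx, h⟩
      exact ⟨hx, (Real.rpow_lt_rpow_iff hx.le hR0.le hpos).1 (hmem x hx h)⟩
    rw [← hfinal (b * p) (by positivity) (by rw [abs_of_pos hpos])]
    gcongr
    refine (measure_mono hsub).trans (le_of_eq ?_)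
    rw [powerMeasure_eq_lintegral _ measurableSet_Ioo Ioo_subset_Ioi_self,
      lintegral_Ioo_rpow (by positivity) hR0]

/-- The mass of the bump at scale `√t` with respect to `dy / y` does not depend on `t`. -/
theorem exists_lintegral_bump_le {ν : ℝ} (hν : ν < 1) :
    ∃ C : ℝ≥0, ∀ t : ℝ, 0 < t →
      ∫⁻ y in Ioi 0, ENNReal.ofReal (y ^ (-1 : ℝ) * bump ν (y ^ 2 / t)) ≤ C := by
  refine ⟨((2 * (1 - ν))⁻¹ + 2⁻¹).toNNReal, fun t ht => ?_⟩
  change _ ≤ ENNReal.ofReal ((2 * (1 - ν))⁻¹ + 2⁻¹)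
  have hν' : 0 < 1 - ν := by linarith
  have hT : 0 < √t := Real.sqrt_pos.2 ht
  have hT2 : √t ^ (2 : ℝ) = t := by rw [Real.rpow_two, Real.sq_sqrt ht.le]
  have hsub : Ioi (0 : ℝ) = Ioc 0 √t ∪ Ioi √t := (Ioc_union_Ioi_eq_Ioi hT.le).symm
  rw [hsub, ENNReal.ofReal_add (by positivity) (by norm_num)]
  refine (lintegral_union_le _ _ _).trans (add_le_add ?_ ?_)
  · rw [setLIntegral_congr Ioo_ae_eq_Ioc.symm]
    calc _ ≤ ∫⁻ y in Ioo 0 √t, ENNReal.ofReal (t ^ (-(1 - ν))) *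
          ENNReal.ofReal (y ^ (2 * (1 - ν) - 1)) := by
          refine setLIntegral_mono' measurableSet_Ioo fun y hy => ?_
          have hy := hy.1
          rw [← ENNReal.ofReal_mul (by positivity)]
          refine ENNReal.ofReal_le_ofReal ?_
          calc y ^ (-1 : ℝ) * bump ν (y ^ 2 / t) ≤ y ^ (-1 : ℝ) * (y ^ 2 / t) ^ (1 - ν) := by
                gcongr; exact min_le_left _ _
            _ = _ := by
                rw [sq_div_rpow hy ht, sub_eq_add_neg (2 * (1 - ν)), Real.rpow_add hy]; ring
      _ = _ := by
          rw [lintegral_const_mul' _ _ ENNReal.ofReal_ne_top,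
            lintegral_Ioo_rpow (by positivity) hT, ← ENNReal.ofReal_mul (by positivity),
            Real.rpow_mul hT.le, hT2, mul_div_assoc', ← Real.rpow_add ht]
          simp
  · calc _ ≤ ∫⁻ y in Ioi √t, ENNReal.ofReal t * ENNReal.ofReal (y ^ ((-2 : ℝ) - 1)) := by
          refine setLIntegral_mono' measurableSet_Ioi fun y hy => ?_
          have hy : 0 < y := hT.trans hy
          rw [← ENNReal.ofReal_mul (by positivity)]
          refine ENNReal.ofReal_le_ofReal ?_
          calc y ^ (-1 : ℝ) * bump ν (y ^ 2 / t) ≤ y ^ (-1 : ℝ) * (y ^ 2 / t)⁻¹ := by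
                gcongr; exact min_le_right _ _
            _ = _ := by
                rw [sub_eq_add_neg, Real.rpow_add hy, Real.rpow_neg_one, Real.rpow_neg hy.le,
                  Real.rpow_two]
                field_simp
      _ = _ := by
          rw [lintegral_const_mul' _ _ ENNReal.ofReal_ne_top,
            lintegral_Ioi_rpow (by norm_num) hT, ← ENNReal.ofReal_mul (by positivity),
            Real.rpow_neg hT.le, hT2]
          congr 1; field_simp

/-- At the critical power `δ = 2νp - 1` the dual Hardy operator itself is unbounded, but the
localization at `y ≈ √t` saves a pointwise bound, by Hölder's inequality. -/
theorem exists_upperHardyAt_endpoint {ν p : ℝ} (hν : ν < 1) (hp : 1 ≤ p) :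
    ∃ C : ℝ≥0, ∀ g : ℝ → ℝ≥0∞, Measurable g → ∀ t x : ℝ, 0 < t → 0 < x →
      upperHardyAt ν t g x ≤
        C * (∫⁻ y, g y ^ p ∂(powerMeasure (2 * ν * p - 1))) ^ p⁻¹ *
          ENNReal.ofReal (x ^ (-(2 * ν))) := by
  obtain ⟨C, hC⟩ := exists_lintegral_bump_le hν
  have hp0 : 0 < p := by linarith
  have hp1 : 0 ≤ p - 1 := by linarith
  refine ⟨(C ^ (p - 1)) ^ p⁻¹, fun g hg t x ht hx => ?_⟩
  rw [upperHardyAt, mul_comm]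
  gcongr
  rw [ENNReal.coe_rpow_of_nonneg _ (by positivity), ENNReal.coe_rpow_of_nonneg _ hp1,
    ← ENNReal.mul_rpow_of_nonneg _ _ (by positivity)]
  refine (ENNReal.le_rpow_inv_iff hp0).2 ?_
  -- Jensen's inequality for the measure of bounded mass concentrated at `y ≈ √t`
  set w : ℝ → ℝ≥0∞ := fun y => ENNReal.ofReal (y ^ (-1 : ℝ) * bump ν (y ^ 2 / t)) with hw
  have hwm : Measurable w := by
    have := measurable_bump ν
    fun_prop
  set ρ := (volume.restrict (Ioi (0 : ℝ))).withDensity w with hρ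
  have e1 : ∫⁻ y in Ioi x, ENNReal.ofReal (y ^ (2 * ν - 1) * bump ν (y ^ 2 / t)) * g y ≤
      ∫⁻ y, ENNReal.ofReal (y ^ (2 * ν)) * g y ∂ρ := by
    rw [hρ, lintegral_withDensity_eq_lintegral_mul_non_measurable _ hwm (by simp [hw])]
    refine (lintegral_mono_set (Ioi_subset_Ioi hx.le)).trans (le_of_eq ?_)
    refine setLIntegral_congr_fun measurableSet_Ioi fun y hy => ?_
    have hy : 0 < y := hy
    have := bump_nonneg (ν := ν) (show 0 < y ^ 2 / t by positivity)
    simp only [hw, Pi.mul_apply]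
    rw [← mul_assoc, ← ENNReal.ofReal_mul (by positivity), sub_eq_add_neg, Real.rpow_add hy]
    congr 2; ring
  have e2 : ∫⁻ y, (ENNReal.ofReal (y ^ (2 * ν)) * g y) ^ p ∂ρ ≤
      ∫⁻ y, g y ^ p ∂(powerMeasure (2 * ν * p - 1)) := by
    rw [hρ, lintegral_withDensity_eq_lintegral_mul_non_measurable _ hwm (by simp [hw]),
      lintegral_powerMeasure]
    refine setLIntegral_mono' measurableSet_Ioi fun y hy => ?_
    have hy : 0 < y := hy
    have h1 := bump_le_one hν (show 0 < y ^ 2 / t by positivity)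
    have h0 := bump_nonneg (ν := ν) (show 0 < y ^ 2 / t by positivity)
    simp only [hw, Pi.mul_apply]
    rw [ENNReal.mul_rpow_of_nonneg _ _ hp0.le, ENNReal.ofReal_rpow_of_pos (by positivity),
      ← mul_assoc, ← ENNReal.ofReal_mul (by positivity), ← Real.rpow_mul hy.le]
    gcongr
    calc y ^ (-1 : ℝ) * bump ν (y ^ 2 / t) * y ^ (2 * ν * p) ≤
        y ^ (-1 : ℝ) * 1 * y ^ (2 * ν * p) := by gcongr
      _ = _ := by rw [mul_one, ← Real.rpow_add hy]; congr 1; ring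
  calc _ ≤ (∫⁻ y, ENNReal.ofReal (y ^ (2 * ν)) * g y ∂ρ) ^ p := by gcongr
    _ ≤ _ := lintegral_rpow_le_of_one_le hp (by fun_prop)
    _ ≤ _ := by
        gcongr
        rw [hρ, withDensity_apply _ MeasurableSet.univ, Measure.restrict_univ]
        exact hC t ht

/-- At the critical power `δ = 2p - 1` the Hardy operator obeys a pointwise bound on characteristic
functions; for `p = 1` it holds for all functions. -/
theorem lowerHardy_indicator_endpoint {p : ℝ} (hp : 1 ≤ p) {E : Set ℝ} (hE : MeasurableSet E)
    (h0 : E ⊆ Ioi 0) (x : ℝ) :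
    lowerHardy (E.indicator 1) x ≤
      2 * powerMeasure (2 * p - 1) E ^ p⁻¹ * ENNReal.ofReal (x ^ (-(2 : ℝ))) := by
  have hp0 : 0 < p := by linarith
  rw [lowerHardy, mul_comm]
  gcongr
  set A := powerMeasure (2 * p - 1) E with hA
  have hAe : A = ∫⁻ y in E, ENNReal.ofReal (y ^ (2 * p - 1)) := powerMeasure_eq_lintegral _ hE h0
  have e0 : ∫⁻ y in Ioo 0 x, ENNReal.ofReal y * E.indicator 1 y ≤
      ∫⁻ y in E, ENNReal.ofReal y := by
    rw [← lintegral_indicator hE]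
    refine (setLIntegral_le_lintegral _ _).trans (lintegral_mono fun y => ?_)
    by_cases hy : y ∈ E <;> simp [hy]
  refine e0.trans ?_
  rcases eq_or_ne A ∞ with h | hfin
  · rw [h, ENNReal.top_rpow_of_pos (by positivity)]; simp
  rcases eq_or_ne A 0 with h | hne
  · have : ∫⁻ y in E, ENNReal.ofReal y = 0 := by
      rw [hAe, lintegral_eq_zero_iff (by fun_prop)] at h
      rw [lintegral_eq_zero_iff (by fun_prop)]
      filter_upwards [h, ae_restrict_mem hE] with y hy hyE
      have : 0 < y := h0 hyE
      have h3 : 0 < y ^ (2 * p - 1) := by positivity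
      simp only [Pi.zero_apply, ENNReal.ofReal_eq_zero] at hy
      linarith
    rw [this]; exact zero_le
  have ha : 0 < A.toReal := ENNReal.toReal_pos hne hfin
  -- below the height `R` the weight `y` is integrated over everything, above it is compared with
  -- `y ^ (2p - 1)`; this `R` balances the two contributions
  set R := A.toReal ^ (2 * p)⁻¹ with hR
  have hR0 : 0 < R := by positivity
  have hR2 : R ^ (2 : ℝ) = A.toReal ^ p⁻¹ := by
    rw [hR, ← Real.rpow_mul ha.le]; congr 1; field_simp
  have hAp : A ^ p⁻¹ = ENNReal.ofReal (A.toReal ^ p⁻¹) := by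
    rw [← ENNReal.ofReal_rpow_of_pos ha, ENNReal.ofReal_toReal hfin]
  have hpt : ∀ y ∈ E, ENNReal.ofReal y ≤
      (Iio R).indicator (fun y => ENNReal.ofReal (y ^ ((2 : ℝ) - 1))) y +
        ENNReal.ofReal (R ^ (2 - 2 * p)) * ENNReal.ofReal (y ^ (2 * p - 1)) := by
    intro y hy
    have hy0 : 0 < y := h0 hy
    by_cases h : y < R
    · rw [indicator_of_mem (show y ∈ Iio R from h)]
      norm_num
    · refine le_trans ?_ le_add_self
      rw [← ENNReal.ofReal_mul (by positivity)]
      refine ENNReal.ofReal_le_ofReal ?_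
      calc y = y ^ (2 - 2 * p) * y ^ (2 * p - 1) := by
            rw [← Real.rpow_add hy0]; ring_nf; simp
        _ ≤ R ^ (2 - 2 * p) * y ^ (2 * p - 1) := by
            gcongr 1
            exact Real.rpow_le_rpow_of_nonpos hR0 (not_lt.1 h) (by linarith)
  calc ∫⁻ y in E, ENNReal.ofReal y
      ≤ ∫⁻ y in E, ((Iio R).indicator (fun y => ENNReal.ofReal (y ^ ((2 : ℝ) - 1))) y +
        ENNReal.ofReal (R ^ (2 - 2 * p)) * ENNReal.ofReal (y ^ (2 * p - 1))) :=
        setLIntegral_mono' hE hpt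
    _ = (∫⁻ y in E, (Iio R).indicator (fun y => ENNReal.ofReal (y ^ ((2 : ℝ) - 1))) y) +
        ENNReal.ofReal (R ^ (2 - 2 * p)) * A := by
        rw [lintegral_add_right _ (by fun_prop), lintegral_const_mul' _ _ ENNReal.ofReal_ne_top,
          hAe]
    _ ≤ ENNReal.ofReal (R ^ (2 : ℝ) / 2) + ENNReal.ofReal (R ^ (2 - 2 * p)) * A := by
        gcongr
        rw [← lintegral_Ioo_rpow two_pos hR0, lintegral_indicator measurableSet_Iio,
          Measure.restrict_restrict measurableSet_Iio]
        exact lintegral_mono_set fun y hy => ⟨h0 hy.2, hy.1⟩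
    _ ≤ _ := by
        have e3 : R ^ (2 - 2 * p) * A.toReal = A.toReal ^ p⁻¹ := by
          rw [hR, ← Real.rpow_mul ha.le, ← Real.rpow_add_one ha.ne']
          congr 1; field_simp; ring
        have e4 : ENNReal.ofReal (R ^ (2 - 2 * p)) * A = ENNReal.ofReal (A.toReal ^ p⁻¹) := by
          rw [← e3, ENNReal.ofReal_mul (by positivity), ENNReal.ofReal_toReal hfin]
        rw [e4, hR2, hAp, two_mul]
        gcongr
        linarith [show 0 < A.toReal ^ p⁻¹ by positivity]

theorem lowerHardy_one_endpoint (g : ℝ → ℝ≥0∞) (x : ℝ) :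
    lowerHardy g x ≤ (∫⁻ y, g y ∂(powerMeasure 1)) * ENNReal.ofReal (x ^ (-(2 : ℝ))) := by
  rw [lowerHardy, mul_comm, lintegral_powerMeasure]
  refine mul_le_mul' ?_ le_rfl
  simp_rw [Real.rpow_one]
  exact lintegral_mono_set Ioo_subset_Ioi_self

/-! ### Boundedness of the maximal operator on nonnegative functions -/

/-- The weak type `(p, p)` inequality with respect to `x ^ δ dx`, for an operator on functions with
values in `[0, ∞]` and tested on the measurable functions of a class `𝒢`. -/
def WeakBoundOn (𝒢 : Set (ℝ → ℝ≥0∞)) (T : (ℝ → ℝ≥0∞) → ℝ → ℝ≥0∞) (δ p : ℝ) : Prop :=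
  ∃ C : ℝ≥0, ∀ g ∈ 𝒢, Measurable g → ∀ s : ℝ, 0 < s →
    ENNReal.ofReal (s ^ p) * powerMeasure δ {x | 0 < x ∧ ENNReal.ofReal s < T g x} ≤
      C * ∫⁻ x, g x ^ p ∂(powerMeasure δ)

theorem WeakBoundOn.of_strong {𝒢 : Set (ℝ → ℝ≥0∞)} {T : (ℝ → ℝ≥0∞) → ℝ → ℝ≥0∞} {δ p : ℝ}
    (hp : 0 < p) (hT : ∀ g, Measurable g → Measurable (T g))
    (h : ∃ C : ℝ≥0, ∀ g : ℝ → ℝ≥0∞, Measurable g →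
      ∫⁻ x, T g x ^ p ∂(powerMeasure δ) ≤ C * ∫⁻ x, g x ^ p ∂(powerMeasure δ)) :
    WeakBoundOn 𝒢 T δ p := by
  obtain ⟨C, hC⟩ := h
  refine ⟨C, fun g _ hg s hs => le_trans ?_ (hC g hg)⟩
  refine le_trans ?_ (mul_meas_ge_le_lintegral ((hT g hg).pow_const p) (ENNReal.ofReal (s ^ p)))
  refine mul_le_mul' le_rfl (measure_mono ?_)
  rintro x ⟨-, hx⟩
  change ENNReal.ofReal (s ^ p) ≤ T g x ^ p
  rw [← ENNReal.ofReal_rpow_of_pos hs]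
  exact ENNReal.rpow_le_rpow hx.le hp.le

theorem WeakBoundOn.of_le_rpow {𝒢 : Set (ℝ → ℝ≥0∞)} {T : (ℝ → ℝ≥0∞) → ℝ → ℝ≥0∞} {b p : ℝ}
    (hb : b ≠ 0) (hp : 0 < p)
    (h : ∃ C : ℝ≥0, ∀ g ∈ 𝒢, Measurable g → ∀ x, 0 < x → T g x ≤
      C * (∫⁻ y, g y ^ p ∂(powerMeasure (b * p - 1))) ^ p⁻¹ * ENNReal.ofReal (x ^ (-b))) :
    WeakBoundOn 𝒢 T (b * p - 1) p := by
  obtain ⟨C, hC⟩ := h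
  obtain ⟨D, -, hD⟩ := exists_rpow_weak hb hp
  refine ⟨D * C ^ p, fun g hgG hg s hs => ?_⟩
  refine le_trans ?_ ((hD (C * (∫⁻ y, g y ^ p ∂(powerMeasure (b * p - 1))) ^ p⁻¹) s hs).trans
    (le_of_eq ?_))
  · gcongr with x hx
    exact hC g hgG hg x hx
  · rw [ENNReal.mul_rpow_of_nonneg _ _ hp.le, ← ENNReal.rpow_mul, inv_mul_cancel₀ hp.ne',
      ENNReal.rpow_one, ENNReal.coe_mul, ENNReal.coe_rpow_of_nonneg _ hp.le, mul_assoc]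

theorem WeakBoundOn.of_le_add {𝒢 : Set (ℝ → ℝ≥0∞)} {T T₁ T₂ T₃ : (ℝ → ℝ≥0∞) → ℝ → ℝ≥0∞} {δ p : ℝ}
    (h₁ : WeakBoundOn 𝒢 T₁ δ p) (h₂ : WeakBoundOn 𝒢 T₂ δ p)
    (h₃ : WeakBoundOn 𝒢 T₃ δ p) (C : ℝ≥0)
    (h : ∀ g, Measurable g → ∀ x, 0 < x → T g x ≤ C * (T₁ g x + T₂ g x + T₃ g x)) :
    WeakBoundOn 𝒢 T δ p := by
  obtain ⟨C₁, h₁⟩ := h₁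
  obtain ⟨C₂, h₂⟩ := h₂
  obtain ⟨C₃, h₃⟩ := h₃
  -- enlarging the constant makes it invertible
  set K : ℝ := 3 * (C + 1) with hK
  have hK0 : 0 < K := by positivity
  refine ⟨(K ^ p).toNNReal * (C₁ + C₂ + C₃), fun g hgG hg s hs => ?_⟩
  have hsK : 0 < s / K := by positivity
  have hsub : {x | 0 < x ∧ ENNReal.ofReal s < T g x} ⊆
      ({x | 0 < x ∧ ENNReal.ofReal (s / K) < T₁ g x} ∪
        {x | 0 < x ∧ ENNReal.ofReal (s / K) < T₂ g x}) ∪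
        {x | 0 < x ∧ ENNReal.ofReal (s / K) < T₃ g x} := by
    rintro x ⟨hx, hlt⟩
    by_contra hcon
    simp only [mem_union, mem_ofPred_eq, not_or, not_and, not_lt] at hcon
    obtain ⟨⟨a1, a2⟩, a3⟩ := hcon
    have hle : T g x ≤ ENNReal.ofReal s := by
      calc T g x ≤ C * (T₁ g x + T₂ g x + T₃ g x) := h g hg x hx
        _ ≤ ENNReal.ofReal (C + 1) * (ENNReal.ofReal (s / K) + ENNReal.ofReal (s / K) +
            ENNReal.ofReal (s / K)) := by
            gcongr
            · rw [ENNReal.ofReal_add (by positivity) (by positivity), ENNReal.ofReal_coe_nnreal]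
              exact le_self_add
            · exact a1 hx
            · exact a2 hx
            · exact a3 hx
        _ = ENNReal.ofReal s := by
            rw [← ENNReal.ofReal_add hsK.le hsK.le, ← ENNReal.ofReal_add (by positivity) hsK.le,
              ← ENNReal.ofReal_mul (by positivity)]
            congr 1
            rw [hK]; field_simp; norm_num
    exact absurd hlt (not_lt.2 hle)
  have hsp : ENNReal.ofReal (s ^ p) = ENNReal.ofReal (K ^ p) * ENNReal.ofReal ((s / K) ^ p) := by
    rw [← ENNReal.ofReal_mul (by positivity), ← Real.mul_rpow hK0.le hsK.le,
      mul_div_cancel₀ _ hK0.ne']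
  calc _ ≤ ENNReal.ofReal (s ^ p) *
        (powerMeasure δ {x | 0 < x ∧ ENNReal.ofReal (s / K) < T₁ g x} +
        powerMeasure δ {x | 0 < x ∧ ENNReal.ofReal (s / K) < T₂ g x} +
        powerMeasure δ {x | 0 < x ∧ ENNReal.ofReal (s / K) < T₃ g x}) := by
        gcongr
        refine (measure_mono hsub).trans ((measure_union_le _ _).trans ?_)
        gcongr
        exact measure_union_le _ _
    _ = ENNReal.ofReal (K ^ p) *
        (ENNReal.ofReal ((s / K) ^ p) *
          powerMeasure δ {x | 0 < x ∧ ENNReal.ofReal (s / K) < T₁ g x} +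
        ENNReal.ofReal ((s / K) ^ p) *
          powerMeasure δ {x | 0 < x ∧ ENNReal.ofReal (s / K) < T₂ g x} +
        ENNReal.ofReal ((s / K) ^ p) *
          powerMeasure δ {x | 0 < x ∧ ENNReal.ofReal (s / K) < T₃ g x}) := by
        rw [hsp]; ring
    _ ≤ ENNReal.ofReal (K ^ p) * (C₁ * (∫⁻ x, g x ^ p ∂(powerMeasure δ)) +
        C₂ * (∫⁻ x, g x ^ p ∂(powerMeasure δ)) + C₃ * (∫⁻ x, g x ^ p ∂(powerMeasure δ))) := by
        exact mul_le_mul' le_rfl (add_le_add (add_le_add (h₁ g hgG hg _ hsK) (h₂ g hgG hg _ hsK))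
          (h₃ g hgG hg _ hsK))
    _ = _ := by
        push_cast
        simp only [ENNReal.ofReal]
        ring

/-- The supremum over the time of `upperHardyAt`. -/
noncomputable def upperMaximal (ν : ℝ) (g : ℝ → ℝ≥0∞) (x : ℝ) : ℝ≥0∞ :=
  ⨆ (t : ℝ) (_ : 0 < t), upperHardyAt ν t g x

theorem upperMaximal_le_hardyOp {ν : ℝ} (hν : ν < 1) (g : ℝ → ℝ≥0∞) {x : ℝ} (hx : 0 < x) :
    upperMaximal ν g x ≤ hardyOp aboveDiag (2 * ν) g x :=
  iSup₂_le fun _ ht => upperHardyAt_le_hardyOp hν ht g hx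

theorem exists_posMaximal_le {ν : ℝ} (hν : ν < 1) :
    ∃ C : ℝ≥0, ∀ g : ℝ → ℝ≥0∞, Measurable g → ∀ x : ℝ, 0 < x →
      posMaximal ν g x ≤ C * (lowerHardy g x + localMaximal g x + upperMaximal ν g x) := by
  obtain ⟨C, hC⟩ := exists_posSemigroup_le hν
  refine ⟨C, fun g hg x hx => iSup₂_le fun t ht => (hC g hg t x ht hx).trans ?_⟩
  gcongr
  exact le_iSup₂_of_le t ht le_rfl

theorem measurable_lowerHardy {g : ℝ → ℝ≥0∞} (hg : Measurable g) : Measurable (lowerHardy g) := by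
  have : lowerHardy g = hardyOp belowDiag 2 g := funext fun x => lowerHardy_eq_hardyOp g x
  rw [this]
  exact measurable_hardyOp measurableSet_belowDiag _ hg

theorem exists_lowerHardy_strong {p δ : ℝ} (hp : 1 ≤ p) (hδ : δ < 2 * p - 1) :
    ∃ C : ℝ≥0, ∀ g : ℝ → ℝ≥0∞, Measurable g →
      ∫⁻ x, lowerHardy g x ^ p ∂(powerMeasure δ) ≤ C * ∫⁻ x, g x ^ p ∂(powerMeasure δ) := by
  simp_rw [lowerHardy_eq_hardyOp]
  exact exists_belowDiag_strong hp (by linarith)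

theorem exists_upperMaximal_strong {ν p δ : ℝ} (hν : ν < 1) (hp : 1 ≤ p) (hδ : 2 * ν * p - 1 < δ) :
    ∃ C : ℝ≥0, ∀ g : ℝ → ℝ≥0∞, Measurable g →
      ∫⁻ x, upperMaximal ν g x ^ p ∂(powerMeasure δ) ≤ C * ∫⁻ x, g x ^ p ∂(powerMeasure δ) := by
  obtain ⟨C, hC⟩ := exists_aboveDiag_strong (b := 2 * ν) hp (show 2 * ν * p < δ + 1 by linarith)
  refine ⟨C, fun g hg => le_trans (lintegral_powerMeasure_mono fun x hx => ?_) (hC g hg)⟩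
  have := upperMaximal_le_hardyOp hν g hx
  gcongr

theorem localMaximal_weakBoundOn (𝒢 : Set (ℝ → ℝ≥0∞)) (δ : ℝ) {p : ℝ} (hp : 1 ≤ p) :
    WeakBoundOn 𝒢 localMaximal δ p := by
  rcases hp.eq_or_lt with rfl | hp
  · obtain ⟨C, hC⟩ := exists_localMaximal_weak δ
    refine ⟨C, fun g _ _ s _ => ?_⟩
    simpa using hC g (ENNReal.ofReal s)
  · exact .of_strong (by linarith) (fun g hg => measurable_localMaximal hg)
      (exists_localMaximal_strong δ hp)

theorem upperMaximal_weakBoundOn (𝒢 : Set (ℝ → ℝ≥0∞)) {ν δ p : ℝ} (hν : ν < 1) (hν0 : ν ≠ 0)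
    (hp : 1 ≤ p) (hδ : 2 * ν * p - 1 ≤ δ) : WeakBoundOn 𝒢 (upperMaximal ν) δ p := by
  rcases hδ.eq_or_lt with rfl | hδ
  · refine .of_le_rpow (b := 2 * ν) (by simpa using hν0) (by linarith) ?_
    obtain ⟨C, hC⟩ := exists_upperHardyAt_endpoint hν hp
    exact ⟨C, fun g _ hg x hx => iSup₂_le fun t ht => hC g hg t x ht hx⟩
  · obtain ⟨C, hC⟩ := WeakBoundOn.of_strong (𝒢 := 𝒢) (T := hardyOp aboveDiag (2 * ν)) (by linarith)
      (fun g hg => measurable_hardyOp measurableSet_aboveDiag _ hg)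
      (exists_aboveDiag_strong hp (show 2 * ν * p < δ + 1 by linarith))
    refine ⟨C, fun g hgG hg s hs => le_trans ?_ (hC g hgG hg s hs)⟩
    gcongr with x hx
    exact upperMaximal_le_hardyOp hν g hx

theorem posMaximal_weakBoundOn {𝒢 : Set (ℝ → ℝ≥0∞)} {ν δ p : ℝ} (hν : ν < 1) (hν0 : ν ≠ 0)
    (hp : 1 ≤ p) (hδ : 2 * ν * p - 1 ≤ δ) (hlow : WeakBoundOn 𝒢 lowerHardy δ p) :
    WeakBoundOn 𝒢 (posMaximal ν) δ p := by
  obtain ⟨C, hC⟩ := exists_posMaximal_le hν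
  exact .of_le_add hlow (localMaximal_weakBoundOn 𝒢 δ hp)
    (upperMaximal_weakBoundOn 𝒢 hν hν0 hp hδ) C hC

theorem lowerHardy_weakBoundOn (𝒢 : Set (ℝ → ℝ≥0∞)) {δ p : ℝ} (hp : 1 ≤ p)
    (hδ : δ < 2 * p - 1 ∨ (p = 1 ∧ δ ≤ 2 * p - 1)) : WeakBoundOn 𝒢 lowerHardy δ p := by
  by_cases h : δ < 2 * p - 1
  · exact .of_strong (by linarith) (fun g hg => measurable_lowerHardy hg)
      (exists_lowerHardy_strong hp h)
  · obtain ⟨rfl, h2⟩ := hδ.resolve_left h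
    obtain rfl : δ = 2 * 1 - 1 := by linarith
    refine .of_le_rpow two_ne_zero one_pos ⟨1, fun g _ hg x hx => ?_⟩
    have := lowerHardy_one_endpoint g x
    norm_num at this ⊢
    exact this

/-- The characteristic functions of measurable subsets of the half-line. -/
def indicatorClass : Set (ℝ → ℝ≥0∞) :=
  {g | ∃ E : Set ℝ, E ⊆ Ioi 0 ∧ MeasurableSet E ∧ g = E.indicator 1}

theorem lintegral_indicator_one_rpow (δ : ℝ) {p : ℝ} (hp : 0 < p) {E : Set ℝ}
    (hE : MeasurableSet E) :
    ∫⁻ x, E.indicator (1 : ℝ → ℝ≥0∞) x ^ p ∂(powerMeasure δ) = powerMeasure δ E := by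
  rw [← lintegral_indicator_one hE]
  refine lintegral_congr fun x => ?_
  by_cases hx : x ∈ E <;> simp [hx, hp]

theorem lowerHardy_weakBoundOn_indicatorClass {δ p : ℝ} (hp : 1 ≤ p) (hδ : δ ≤ 2 * p - 1) :
    WeakBoundOn indicatorClass lowerHardy δ p := by
  have hp0 : 0 < p := by linarith
  rcases hδ.lt_or_eq with h | rfl
  · exact lowerHardy_weakBoundOn _ hp (Or.inl h)
  · refine .of_le_rpow two_ne_zero hp0 ⟨2, ?_⟩
    rintro g ⟨E, h0, hE, rfl⟩ - x hx
    rw [lintegral_indicator_one_rpow _ hp0 hE]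
    exact lowerHardy_indicator_endpoint hp hE h0 x

theorem exists_posMaximal_strong {ν δ p : ℝ} (hν : ν < 1) (hp : 1 < p) (h1 : 2 * ν * p - 1 < δ)
    (h2 : δ < 2 * p - 1) :
    ∃ C : ℝ≥0, ∀ g : ℝ → ℝ≥0∞, Measurable g →
      ∫⁻ x, posMaximal ν g x ^ p ∂(powerMeasure δ) ≤ C * ∫⁻ x, g x ^ p ∂(powerMeasure δ) := by
  obtain ⟨C, hC⟩ := exists_posMaximal_le hν
  obtain ⟨C₁, h₁⟩ := exists_lowerHardy_strong hp.le h2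
  obtain ⟨C₂, h₂⟩ := exists_localMaximal_strong δ hp
  obtain ⟨C₃, h₃⟩ := exists_upperMaximal_strong hν hp.le h1
  have hp0 : 0 < p := by linarith
  refine ⟨(C * 3) ^ p * (C₁ + C₂ + C₃), fun g hg => ?_⟩
  have hpt : ∀ a b c : ℝ≥0∞, (C * (a + b + c)) ^ p ≤
      ((C * 3 : ℝ≥0) : ℝ≥0∞) ^ p * (a ^ p + b ^ p + c ^ p) := by
    intro a b c
    obtain ⟨d, hd, ha, hb, hc⟩ : ∃ d : ℝ≥0∞, d ^ p ≤ a ^ p + b ^ p + c ^ p ∧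
        a ≤ d ∧ b ≤ d ∧ c ≤ d := by
      refine ⟨max (max a b) c, ?_, by simp, by simp, by simp⟩
      rcases max_choice (max a b) c with h | h <;> rw [h]
      · rcases max_choice a b with h | h <;> rw [h]
        · exact le_self_add.trans le_self_add
        · exact le_add_self.trans le_self_add
      · exact le_add_self
    calc (C * (a + b + c)) ^ p ≤ (C * (d + d + d)) ^ p := by gcongr
      _ = (((C * 3 : ℝ≥0) : ℝ≥0∞) * d) ^ p := by congr 1; push_cast; ring
      _ = ((C * 3 : ℝ≥0) : ℝ≥0∞) ^ p * d ^ p := ENNReal.mul_rpow_of_nonneg _ _ hp0.le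
      _ ≤ _ := by gcongr
  have hsum : Measurable fun x => lowerHardy g x ^ p + localMaximal g x ^ p :=
    ((measurable_lowerHardy hg).pow_const p).add ((measurable_localMaximal hg).pow_const p)
  calc ∫⁻ x, posMaximal ν g x ^ p ∂(powerMeasure δ)
      ≤ ∫⁻ x, ((C * 3 : ℝ≥0) : ℝ≥0∞) ^ p * (lowerHardy g x ^ p + localMaximal g x ^ p +
        upperMaximal ν g x ^ p) ∂(powerMeasure δ) :=
        lintegral_powerMeasure_mono fun x hx =>
          (ENNReal.rpow_le_rpow (hC g hg x hx) hp0.le).trans (hpt _ _ _)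
    _ = ((C * 3 : ℝ≥0) : ℝ≥0∞) ^ p * (∫⁻ x, lowerHardy g x ^ p ∂(powerMeasure δ) +
        ∫⁻ x, localMaximal g x ^ p ∂(powerMeasure δ) +
        ∫⁻ x, upperMaximal ν g x ^ p ∂(powerMeasure δ)) := by
        rw [lintegral_const_mul' _ _ (ENNReal.rpow_ne_top_of_nonneg hp0.le ENNReal.coe_ne_top),
          lintegral_add_left hsum,
          lintegral_add_left ((measurable_lowerHardy hg).pow_const p)]
    _ ≤ ((C * 3 : ℝ≥0) : ℝ≥0∞) ^ p * (C₁ * (∫⁻ x, g x ^ p ∂(powerMeasure δ)) +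
        C₂ * (∫⁻ x, g x ^ p ∂(powerMeasure δ)) + C₃ * (∫⁻ x, g x ^ p ∂(powerMeasure δ))) := by
        gcongr
        · exact h₁ g hg
        · exact h₂ g hg
        · exact h₃ g hg
    _ = _ := by
        rw [← ENNReal.coe_rpow_of_nonneg _ hp0.le]
        push_cast
        ring

/-- For `ν < 0` all three dominating operators are bounded on constant functions. -/
theorem exists_posMaximal_le_bound {ν : ℝ} (hν : ν < 0) :
    ∃ C : ℝ≥0, ∀ A : ℝ≥0∞, ∀ x : ℝ, 0 < x → posMaximal ν (fun _ => A) x ≤ C * A := by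
  obtain ⟨C, hC⟩ := exists_posMaximal_le (show ν < 1 by linarith)
  have hν' : 0 < -(2 * ν) := by linarith
  refine ⟨C * (1 + 2 + (-(2 * ν))⁻¹.toNNReal), fun A x hx => ?_⟩
  refine (hC _ measurable_const x hx).trans ?_
  rw [ENNReal.coe_mul, mul_assoc]
  refine mul_le_mul' le_rfl ?_
  push_cast
  rw [add_mul, add_mul]
  refine add_le_add (add_le_add ?_ ?_) ?_
  · rw [lowerHardy]
    calc _ ≤ ENNReal.ofReal (x ^ (-2 : ℝ)) * ((∫⁻ y in Ioo 0 x,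
          ENNReal.ofReal (y ^ ((2 : ℝ) - 1))) * A) := by
          rw [← lintegral_mul_const _ (by fun_prop)]
          norm_num
      _ = ENNReal.ofReal (1 / 2) * A := by
          rw [lintegral_Ioo_rpow two_pos hx, ← mul_assoc, ← ENNReal.ofReal_mul (by positivity),
            Real.rpow_neg hx.le]
          congr 2
          have : x ^ (2 : ℝ) ≠ 0 := by positivity
          field_simp
      _ ≤ 1 * A := by
          gcongr
          rw [ENNReal.ofReal_le_one]; norm_num
  · refine iSup₂_le fun r hr => ?_
    have hr0 := hr.1
    rw [setLIntegral_const, Real.volume_closedBall, mul_left_comm,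
      ← ENNReal.ofReal_mul (by positivity), show (r : ℝ)⁻¹ * (2 * r) = 2 by field_simp, mul_comm]
    norm_num
  · refine (upperMaximal_le_hardyOp (by linarith) _ hx).trans ?_
    rw [hardyOp]
    simp_rw [mul_assoc]
    rw [lintegral_aboveDiag_left hx fun y => ENNReal.ofReal (y ^ (2 * ν - 1)) * A,
      lintegral_mul_const _ (by fun_prop), lintegral_Ioi_rpow (by linarith) hx, ← mul_assoc,
      ← ENNReal.ofReal_mul (by positivity)]
    gcongr
    change _ ≤ ENNReal.ofReal (-(2 * ν))⁻¹
    refine ENNReal.ofReal_le_ofReal (le_of_eq ?_)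
    rw [mul_div_assoc', ← Real.rpow_add hx]
    simp

/-! ### Sufficiency -/

section Sufficiency

variable {𝕜 : Type*} [RCLike 𝕜]

theorem posMaximal_congr {ν : ℝ} {g h : ℝ → ℝ≥0∞} (hgh : g =ᵐ[volume.restrict (Ioi 0)] h) :
    posMaximal ν g = posMaximal ν h := by
  have : ∀ t x, posSemigroup ν t g x = posSemigroup ν t h x := fun t x =>
    lintegral_congr_ae (hgh.mono fun y hy => by simp only [hy])
  funext x
  simp only [posMaximal, this]

/-- As finiteness propagates to the left, almost everywhere finiteness of the maximal function gives
absolute convergence at every point. -/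
theorem mem_exoticDomain_of_ae_lt_top {ν δ : ℝ} (hν : ν < 1) {f : ℝ → 𝕜}
    (hf : AEStronglyMeasurable f (powerMeasure δ))
    (h : ∀ᵐ x ∂(powerMeasure δ), posMaximal ν (fun y => ‖f y‖ₑ) x < ∞) :
    f ∈ exoticDomain 𝕜 ν := by
  refine mem_exoticDomain hν (hf.mono_ac (absolutelyContinuous_powerMeasure δ)) fun t ht x hx => ?_
  have h1 : ∀ᵐ b ∂(volume.restrict (Ioi x)), posMaximal ν (fun y => ‖f y‖ₑ) b < ∞ :=
    ae_restrict_of_ae_restrict_of_subset (Ioi_subset_Ioi hx.le)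
      ((absolutelyContinuous_powerMeasure δ).ae_le h)
  have : (ae (volume.restrict (Ioi x))).NeBot := by
    rw [ae_neBot, Ne, Measure.restrict_eq_zero, Real.volume_Ioi]; simp
  obtain ⟨b, hb, hxb⟩ := (h1.and (ae_restrict_mem measurableSet_Ioi)).exists
  refine posSemigroup_lt_top_of_le hν ht hx (le_of_lt hxb) (lt_of_le_of_lt ?_ hb)
  exact le_iSup₂_of_le t ht le_rfl

theorem eq_zero_of_forall_rpow_mul_le {p : ℝ} (hp : 0 < p) {a M : ℝ≥0∞} (hM : M ≠ ∞)
    (h : ∀ s : ℝ, 0 < s → ENNReal.ofReal (s ^ p) * a ≤ M) : a = 0 := by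
  by_contra ha
  obtain ⟨n, hn⟩ := ENNReal.exists_nat_mul_gt ha hM
  have h1 := h (((n : ℝ) + 1) ^ p⁻¹) (by positivity)
  rw [← Real.rpow_mul (by positivity), inv_mul_cancel₀ hp.ne', Real.rpow_one] at h1
  refine absurd (hn.trans_le (le_trans ?_ h1)) (lt_irrefl _)
  gcongr
  rw [← ENNReal.ofReal_natCast]
  exact ENNReal.ofReal_le_ofReal (by linarith)

/-- A weak type bound on nonnegative functions passes to all functions, and it entails that the
semigroup is defined by absolutely convergent integrals. -/
theorem weak_bound_transfer {ν δ p : ℝ} (hν : ν < 1) (hp : 0 < p) {C : ℝ≥0} {f : ℝ → 𝕜}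
    (hf : AEStronglyMeasurable f (powerMeasure δ)) {g : ℝ → ℝ≥0∞}
    (hfg : g =ᵐ[powerMeasure δ] fun y => ‖f y‖ₑ)
    (hfin : ∫⁻ x, ‖f x‖ₑ ^ p ∂(powerMeasure δ) ≠ ∞)
    (hC : ∀ s : ℝ, 0 < s →
      ENNReal.ofReal (s ^ p) * powerMeasure δ {x | 0 < x ∧ ENNReal.ofReal s < posMaximal ν g x} ≤
        C * ∫⁻ x, g x ^ p ∂(powerMeasure δ)) :
    f ∈ exoticDomain 𝕜 ν ∧ AEMeasurable (exoticMaximal ν f) (powerMeasure δ) ∧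
      ∀ s : ℝ, 0 < s →
        ENNReal.ofReal (s ^ p) *
          powerMeasure δ {x | 0 < x ∧ ENNReal.ofReal s < exoticMaximal ν f x} ≤
          C * ∫⁻ x, ‖f x‖ₑ ^ p ∂(powerMeasure δ) := by
  rw [posMaximal_congr ((absolutelyContinuous_powerMeasure δ).ae_le hfg),
    lintegral_congr_ae (hfg.mono fun x hx => by simp only [hx] :
      (fun x => g x ^ p) =ᵐ[powerMeasure δ] fun x => ‖f x‖ₑ ^ p)] at hC
  have hD : f ∈ exoticDomain 𝕜 ν := by
    refine mem_exoticDomain_of_ae_lt_top hν hf ?_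
    have h0 : powerMeasure δ {x | 0 < x ∧ posMaximal ν (fun y => ‖f y‖ₑ) x = ∞} = 0 := by
      refine eq_zero_of_forall_rpow_mul_le hp (ENNReal.mul_ne_top ENNReal.coe_ne_top hfin)
        fun s hs => le_trans ?_ (hC s hs)
      gcongr with x hx
      intro hx'
      rw [hx']
      exact ENNReal.ofReal_lt_top
    have h1 : ∀ᵐ x ∂(powerMeasure δ), ¬(0 < x ∧ posMaximal ν (fun y => ‖f y‖ₑ) x = ∞) :=
      measure_eq_zero_iff_ae_notMem.1 h0
    filter_upwards [h1, ae_pos_powerMeasure δ] with x hx hx0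
    exact lt_top_iff_ne_top.2 fun h => hx ⟨hx0, h⟩
  refine ⟨hD, aemeasurable_exoticMaximal hν hD δ, fun s hs => le_trans ?_ (hC s hs)⟩
  gcongr with x hx
  exact exoticMaximal_le_posMaximal hν f hx

theorem lintegral_enorm_rpow_ne_top {δ p : ℝ} (hp : 0 < p) {f : ℝ → 𝕜}
    (hf : MemLp f (ENNReal.ofReal p) (powerMeasure δ)) :
    ∫⁻ x, ‖f x‖ₑ ^ p ∂(powerMeasure δ) ≠ ∞ := by
  have h := lintegral_rpow_enorm_lt_top_of_eLpNorm_lt_top (by simpa using hp)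
    ENNReal.ofReal_ne_top hf.2
  rw [ENNReal.toReal_ofReal hp.le] at h
  exact h.ne

theorem isWeakType_of_weakBoundOn {ν δ p : ℝ} (hν : ν < 1) (hp : 0 < p)
    (h : WeakBoundOn univ (posMaximal ν) δ p) :
    IsWeakType (exoticDomain 𝕜 ν) (exoticMaximal ν) δ p := by
  obtain ⟨C, hC⟩ := h
  refine ⟨C, fun f hf => ?_⟩
  have hm : AEMeasurable (fun y => ‖f y‖ₑ) (powerMeasure δ) := hf.1.enorm
  exact weak_bound_transfer hν hp hf.1 hm.ae_eq_mk.symm (lintegral_enorm_rpow_ne_top hp hf)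
    (hC _ trivial hm.measurable_mk)

theorem enorm_indicator_one (E : Set ℝ) :
    (fun y => ‖E.indicator (fun _ => (1 : 𝕜)) y‖ₑ) = E.indicator 1 := by
  ext y
  by_cases hy : y ∈ E <;> simp [hy]

theorem lintegral_enorm_indicator_one_rpow (δ : ℝ) {p : ℝ} (hp : 0 < p) {E : Set ℝ}
    (hE : MeasurableSet E) :
    ∫⁻ x, ‖E.indicator (fun _ => (1 : 𝕜)) x‖ₑ ^ p ∂(powerMeasure δ) = powerMeasure δ E := by
  rw [← lintegral_indicator_one_rpow δ hp hE, ← enorm_indicator_one (𝕜 := 𝕜)]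

theorem isRestrictedWeakType_of_weakBoundOn {ν δ p : ℝ} (hν : ν < 1) (hp : 0 < p)
    (h : WeakBoundOn indicatorClass (posMaximal ν) δ p) :
    IsRestrictedWeakType (𝕜 := 𝕜) (exoticDomain 𝕜 ν) (exoticMaximal ν) δ p := by
  obtain ⟨C, hC⟩ := h
  refine ⟨C, fun E h0 hE hfin => ?_⟩
  have hI := lintegral_enorm_indicator_one_rpow (𝕜 := 𝕜) δ hp hE
  rw [← hI]
  refine weak_bound_transfer hν hp (stronglyMeasurable_const.indicator hE).aestronglyMeasurable
    (g := E.indicator 1) (by rw [enorm_indicator_one]) (by rw [hI]; exact hfin.ne)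
    (hC _ ⟨E, h0, hE, rfl⟩ (measurable_one.indicator hE))

theorem IsWeakType.isRestrictedWeakType {D : Set (ℝ → 𝕜)} {T : (ℝ → 𝕜) → ℝ → ℝ≥0∞} {δ p : ℝ}
    (hp : 0 < p) (h : IsWeakType D T δ p) : IsRestrictedWeakType D T δ p := by
  obtain ⟨C, hC⟩ := h
  refine ⟨C, fun E h0 hE hfin => ?_⟩
  rw [← lintegral_enorm_indicator_one_rpow (𝕜 := 𝕜) δ hp hE]
  exact hC _ (memLp_indicator_const _ hE _ (Or.inr hfin.ne))

theorem IsStrongType.isWeakType {D : Set (ℝ → 𝕜)} {T : (ℝ → 𝕜) → ℝ → ℝ≥0∞} {δ p : ℝ}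
    (hp : 0 < p) (h : IsStrongType D T δ (ENNReal.ofReal p)) : IsWeakType D T δ p := by
  obtain ⟨C, hC⟩ := h
  refine ⟨C ^ p, fun f hf => ?_⟩
  obtain ⟨h1, h2, h3⟩ := hC f hf
  refine ⟨h1, h2, fun s hs => ?_⟩
  have hp' : ENNReal.ofReal p ≠ 0 := by simpa using hp
  rw [eLpNorm_eq_lintegral_rpow_enorm_toReal hp' ENNReal.ofReal_ne_top,
    eLpNorm_eq_lintegral_rpow_enorm_toReal hp' ENNReal.ofReal_ne_top,
    ENNReal.toReal_ofReal hp.le] at h3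
  have h4 := ENNReal.rpow_le_rpow h3 hp.le
  rw [ENNReal.mul_rpow_of_nonneg _ _ hp.le, ← ENNReal.rpow_mul, ← ENNReal.rpow_mul,
    one_div, inv_mul_cancel₀ hp.ne', ENNReal.rpow_one, ENNReal.rpow_one] at h4
  rw [ENNReal.coe_rpow_of_nonneg _ hp.le]
  refine le_trans ?_ h4
  simp only [enorm_eq_self]
  refine le_trans ?_ (mul_meas_ge_le_lintegral₀ (h2.pow_const p) (ENNReal.ofReal (s ^ p)))
  refine mul_le_mul' le_rfl (measure_mono ?_)
  rintro x ⟨-, hx⟩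
  change ENNReal.ofReal (s ^ p) ≤ T f x ^ p
  rw [← ENNReal.ofReal_rpow_of_pos hs]
  exact ENNReal.rpow_le_rpow hx.le hp.le

theorem isWeakType_of_le {ν δ p : ℝ} (hν : ν < 1) (hν0 : ν ≠ 0) (hp : 1 ≤ p)
    (h1 : 2 * ν * p - 1 ≤ δ) (h2 : δ < 2 * p - 1 ∨ (p = 1 ∧ δ ≤ 2 * p - 1)) :
    IsWeakType (exoticDomain 𝕜 ν) (exoticMaximal ν) δ p :=
  isWeakType_of_weakBoundOn hν (by linarith)
    (posMaximal_weakBoundOn hν hν0 hp h1 (lowerHardy_weakBoundOn _ hp h2))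

theorem isRestrictedWeakType_of_le {ν δ p : ℝ} (hν : ν < 1) (hν0 : ν ≠ 0) (hp : 1 ≤ p)
    (h1 : 2 * ν * p - 1 ≤ δ) (h2 : δ ≤ 2 * p - 1) :
    IsRestrictedWeakType (𝕜 := 𝕜) (exoticDomain 𝕜 ν) (exoticMaximal ν) δ p :=
  isRestrictedWeakType_of_weakBoundOn hν (by linarith)
    (posMaximal_weakBoundOn hν hν0 hp h1 (lowerHardy_weakBoundOn_indicatorClass hp h2))

theorem isStrongType_of_lt {ν δ p : ℝ} (hν : ν < 1) (hν0 : ν ≠ 0) (hp : 1 < p)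
    (h1 : 2 * ν * p - 1 < δ) (h2 : δ < 2 * p - 1) :
    IsStrongType (exoticDomain 𝕜 ν) (exoticMaximal ν) δ (ENNReal.ofReal p) := by
  have hp0 : 0 < p := by linarith
  obtain ⟨_, hW⟩ := isWeakType_of_le (𝕜 := 𝕜) hν hν0 hp.le h1.le (Or.inl h2)
  obtain ⟨C, hC⟩ := exists_posMaximal_strong hν hp h1 h2
  refine ⟨C ^ p⁻¹, fun f hf => ?_⟩
  obtain ⟨hD, hM, -⟩ := hW f hf
  refine ⟨hD, hM, ?_⟩
  have hp' : ENNReal.ofReal p ≠ 0 := by simpa using hp0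
  rw [eLpNorm_eq_lintegral_rpow_enorm_toReal hp' ENNReal.ofReal_ne_top,
    eLpNorm_eq_lintegral_rpow_enorm_toReal hp' ENNReal.ofReal_ne_top,
    ENNReal.toReal_ofReal hp0.le, ENNReal.coe_rpow_of_nonneg _ (by positivity), one_div,
    ← ENNReal.mul_rpow_of_nonneg _ _ (by positivity)]
  refine ENNReal.rpow_le_rpow ?_ (by positivity)
  have hm : AEMeasurable (fun y => ‖f y‖ₑ) (powerMeasure δ) := hf.1.enorm
  have hfg := hm.ae_eq_mk
  rw [lintegral_congr_ae (hfg.mono fun x hx => by simp only [hx] :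
      (fun x => ‖f x‖ₑ ^ p) =ᵐ[powerMeasure δ] fun x => hm.mk _ x ^ p)]
  refine le_trans (lintegral_powerMeasure_mono fun x hx => ?_) (hC _ hm.measurable_mk)
  rw [← posMaximal_congr ((absolutelyContinuous_powerMeasure δ).ae_le hfg), enorm_eq_self]
  exact ENNReal.rpow_le_rpow (exoticMaximal_le_posMaximal hν f hx) hp0.le

theorem isStrongType_top_of_neg {ν : ℝ} (hν : ν < 0) (δ : ℝ) :
    IsStrongType (exoticDomain 𝕜 ν) (exoticMaximal ν) δ ∞ := by
  have hν1 : ν < 1 := by linarith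
  obtain ⟨C, hC⟩ := exists_posMaximal_le_bound hν
  refine ⟨C, fun f hf => ?_⟩
  set A := eLpNorm f ∞ (powerMeasure δ) with hA
  have hbd : ∀ᵐ y ∂(powerMeasure δ), ‖f y‖ₑ ≤ A := by
    rw [hA, eLpNorm_exponent_top]; exact enorm_ae_le_eLpNormEssSup f _
  have hpos : ∀ x, 0 < x → posMaximal ν (fun y => ‖f y‖ₑ) x ≤ C * A := by
    intro x hx
    refine le_trans (iSup₂_mono fun t ht => ?_) (hC A x hx)
    refine lintegral_mono_ae ?_
    filter_upwards [(absolutelyContinuous_powerMeasure δ).ae_le hbd] with y hy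
    gcongr
  have hD : f ∈ exoticDomain 𝕜 ν := mem_exoticDomain_of_ae_lt_top hν1 hf.1
    ((ae_pos_powerMeasure δ).mono fun x hx =>
      (hpos x hx).trans_lt (ENNReal.mul_lt_top ENNReal.coe_lt_top hf.2))
  refine ⟨hD, aemeasurable_exoticMaximal hν1 hD δ, ?_⟩
  rw [eLpNorm_exponent_top]
  refine eLpNormEssSup_le_of_ae_enorm_bound ?_
  filter_upwards [ae_pos_powerMeasure δ] with x hx
  rw [enorm_eq_self]
  exact (exoticMaximal_le_posMaximal hν1 f hx).trans (hpos x hx)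

end Sufficiency

/-! ### Necessity -/

theorem lintegral_Ioo_inv_sub (d : ℝ) {a b : ℝ} (ha : 0 < a) (hab : a ≤ b) :
    ∫⁻ x in Ioo (a + d) (b + d), ENNReal.ofReal (x - d)⁻¹ = ENNReal.ofReal (Real.log (b / a)) := by
  have hle : a + d ≤ b + d := by linarith
  have hcont : ContinuousOn (fun x : ℝ => (x - d)⁻¹) (Icc (a + d) (b + d)) := by
    refine ContinuousOn.inv₀ (by fun_prop) fun x hx => ?_
    have := hx.1
    exact (by linarith : 0 < x - d).ne'
  rw [setLIntegral_congr Ioo_ae_eq_Ioc, ← ofReal_integral_eq_lintegral_ofReal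
    ((hcont.integrableOn_Icc).mono_set Ioc_subset_Icc_self)]
  · rw [← intervalIntegral.integral_of_le hle,
      intervalIntegral.integral_comp_sub_right (fun x => x⁻¹) d, add_sub_cancel_right,
      add_sub_cancel_right, integral_inv_of_pos ha (by linarith)]
  · filter_upwards [ae_restrict_mem measurableSet_Ioc] with x hx
    have := hx.1
    exact inv_nonneg.2 (by linarith)

theorem lintegral_Ioo_inv {a b : ℝ} (ha : 0 < a) (hab : a ≤ b) :
    ∫⁻ x in Ioo a b, ENNReal.ofReal x⁻¹ = ENNReal.ofReal (Real.log (b / a)) := by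
  simpa using lintegral_Ioo_inv_sub 0 ha hab

/-- A function of size `x ^ (-a)` on the annulus `(ρ, 2ρ)` satisfies a weak type bound only if
`ρ ^ (δ + 1 - a p)` is bounded. -/
theorem exists_annulus_bound {T : ℝ → ℝ≥0∞} {δ p a c : ℝ} (hc : 0 < c) {M : ℝ≥0∞}
    (hM : M ≠ ∞)
    (hT : ∀ s : ℝ, 0 < s →
      ENNReal.ofReal (s ^ p) * powerMeasure δ {x | 0 < x ∧ ENNReal.ofReal s < T x} ≤ M) :
    ∃ M' : ℝ, ∀ ρ : ℝ, 0 < ρ →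
      (∀ x ∈ Ioo ρ (2 * ρ), ENNReal.ofReal (c * x ^ (-a)) ≤ T x) → ρ ^ (δ + 1 - a * p) ≤ M' := by
  set k : ℝ := c / 2 ^ |-a| / 2 with hk
  have hk0 : 0 < k := by positivity
  set D : ℝ := k ^ p * (2 ^ |δ|)⁻¹ with hD
  have hD0 : 0 < D := by positivity
  refine ⟨M.toReal / D, fun ρ hρ h => ?_⟩
  have hs : 0 < k * ρ ^ (-a) := by positivity
  have h1 := hT _ hs
  have hsub : Ioo ρ (2 * ρ) ⊆ {x | 0 < x ∧ ENNReal.ofReal (k * ρ ^ (-a)) < T x} := by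
    intro x hx
    have hx0 : 0 < x := hρ.trans hx.1
    refine ⟨hx0, lt_of_lt_of_le ?_ (h x hx)⟩
    rw [ENNReal.ofReal_lt_ofReal_iff (by positivity)]
    have h2 : ρ ^ (-a) ≤ 2 ^ |-a| * x ^ (-a) :=
      rpow_le_two_rpow_abs_mul hρ hx0 (by linarith [hx.1]) hx.2.le
    calc k * ρ ^ (-a) ≤ k * (2 ^ |-a| * x ^ (-a)) := by gcongr
      _ = c * x ^ (-a) / 2 := by rw [hk]; field_simp
      _ < _ := half_lt_self (by positivity)
  have h3 : ENNReal.ofReal ((2 ^ |δ|)⁻¹ * ρ ^ δ * ρ) ≤ powerMeasure δ (Ioo ρ (2 * ρ)) := by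
    rw [powerMeasure_eq_lintegral δ measurableSet_Ioo (fun x hx => hρ.trans hx.1)]
    calc _ = ∫⁻ x in Ioo ρ (2 * ρ), ENNReal.ofReal ((2 ^ |δ|)⁻¹ * ρ ^ δ) := by
          rw [setLIntegral_const, Real.volume_Ioo, ← ENNReal.ofReal_mul (by positivity)]
          congr 1; ring
      _ ≤ _ := by
          refine setLIntegral_mono' measurableSet_Ioo fun x hx => ENNReal.ofReal_le_ofReal ?_
          rw [inv_mul_le_iff₀ (by positivity)]
          exact rpow_le_two_rpow_abs_mul hρ (hρ.trans hx.1) (by linarith [hx.1]) hx.2.le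
  have h4 : ENNReal.ofReal (D * ρ ^ (δ + 1 - a * p)) ≤ M := by
    refine le_trans (le_of_eq ?_) ((mul_le_mul' le_rfl (h3.trans (measure_mono hsub))).trans h1)
    rw [← ENNReal.ofReal_mul (by positivity), Real.mul_rpow hk0.le (by positivity),
      ← Real.rpow_mul hρ.le, show δ + 1 - a * p = -a * p + δ + 1 by ring, Real.rpow_add_one hρ.ne',
      Real.rpow_add hρ, hD]
    congr 1; ring
  rw [le_div_iff₀ hD0, mul_comm]
  exact (ENNReal.ofReal_le_iff_le_toReal hM).1 h4

section Necessity

variable {𝕜 : Type*} [RCLike 𝕜]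

theorem posSemigroup_indicator_one (ν t x : ℝ) {E : Set ℝ} (hE : MeasurableSet E)
    (h0 : E ⊆ Ioi 0) :
    posSemigroup ν t (fun y => ‖E.indicator (fun _ => (1 : 𝕜)) y‖ₑ) x =
      ∫⁻ y in E, ENNReal.ofReal (heatDensity ν t x y) := by
  have e : ∀ y, ENNReal.ofReal (heatDensity ν t x y) * ‖E.indicator (fun _ => (1 : 𝕜)) y‖ₑ =
      E.indicator (fun y => ENNReal.ofReal (heatDensity ν t x y)) y := fun y => by
    by_cases hy : y ∈ E <;> simp [hy]
  rw [posSemigroup]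
  simp_rw [e]
  rw [lintegral_indicator hE, Measure.restrict_restrict hE, inter_eq_left.2 h0]

theorem indicator_one_eq_norm (E : Set ℝ) (y : ℝ) :
    E.indicator (fun _ => (1 : 𝕜)) y = ((‖E.indicator (fun _ => (1 : 𝕜)) y‖ : ℝ) : 𝕜) := by
  by_cases hy : y ∈ E <;> simp [hy]

/-- If the density of the kernel is at least `m` on `E`, the maximal function of the
characteristic function of `E` is at least `m |E|`. -/
theorem le_exoticMaximal_indicator {ν : ℝ} (hν : ν < 1) {E : Set ℝ} (hE : MeasurableSet E)
    (h0 : E ⊆ Ioi 0) (hD : E.indicator (fun _ => (1 : 𝕜)) ∈ exoticDomain 𝕜 ν) {t x m : ℝ}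
    (ht : 0 < t) (hx : 0 < x) (hm : ∀ y ∈ E, m ≤ heatDensity ν t x y) :
    ENNReal.ofReal m * volume E ≤ exoticMaximal ν (E.indicator fun _ => (1 : 𝕜)) x := by
  refine le_trans ?_ (posSemigroup_le_exoticMaximal hν hD (indicator_one_eq_norm E) ht hx)
  rw [posSemigroup_indicator_one ν t x hE h0, ← setLIntegral_const]
  exact setLIntegral_mono' hE fun y hy => ENNReal.ofReal_le_ofReal (hm y hy)

theorem powerMeasure_Ioo_lt_top (δ : ℝ) {a b : ℝ} (ha : 0 < a) : powerMeasure δ (Ioo a b) < ∞ := by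
  rw [powerMeasure_eq_lintegral δ measurableSet_Ioo (fun x hx => ha.trans hx.1)]
  have hc : ContinuousOn (fun x : ℝ => x ^ δ) (Icc a b) := fun x hx =>
    (Real.continuousAt_rpow_const _ _ (Or.inl (ha.trans_le hx.1).ne')).continuousWithinAt
  have := ((hc.integrableOn_Icc (μ := volume)).mono_set Ioo_subset_Icc_self).2
  rw [hasFiniteIntegral_iff_enorm] at this
  refine lt_of_le_of_lt (lintegral_mono fun x => ?_) this
  exact Real.ofReal_le_enorm _

/-- The maximal function of the characteristic function of `(1, 2)` decays no faster than
`x ^ (-2ν)` at the origin (time `1`) and `x ^ (-2)` at infinity (time `x ^ 2`). -/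
theorem exists_exoticMaximal_indicator_lower {ν : ℝ} (hν : ν < 1)
    (hD : (Ioo (1 : ℝ) 2).indicator (fun _ => (1 : 𝕜)) ∈ exoticDomain 𝕜 ν) :
    ∃ c : ℝ, 0 < c ∧
      (∀ x : ℝ, 0 < x → x ≤ 1 → ENNReal.ofReal (c * x ^ (-(2 * ν))) ≤
        exoticMaximal ν ((Ioo (1 : ℝ) 2).indicator fun _ => (1 : 𝕜)) x) ∧
      (∀ x : ℝ, 2 ≤ x → ENNReal.ofReal (c * x ^ (-(2 : ℝ))) ≤
        exoticMaximal ν ((Ioo (1 : ℝ) 2).indicator fun _ => (1 : 𝕜)) x) := by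
  obtain ⟨c, hc, h⟩ := exists_heatDensity_lower_bound hν
  have hvol : volume (Ioo (1 : ℝ) 2) = 1 := by rw [Real.volume_Ioo]; norm_num
  have h0 : Ioo (1 : ℝ) 2 ⊆ Ioi 0 := fun x hx => lt_trans one_pos hx.1
  refine ⟨c * Real.exp (-(5 / 4)), by positivity, fun x hx hx1 => ?_, fun x hx => ?_⟩
  · have := le_exoticMaximal_indicator (𝕜 := 𝕜) hν measurableSet_Ioo h0 hD (t := 1) one_pos hx
      (m := c * Real.exp (-(5 / 4)) * x ^ (-(2 * ν))) fun y hy => ?_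
    · rwa [hvol, mul_one] at this
    · have hy0 : 0 < y := h0 hy
      refine le_trans ?_ (h 1 x y one_pos hx hy0)
      rw [Real.one_rpow, mul_one, neg_mul]
      calc c * Real.exp (-(5 / 4)) * x ^ (-(2 * ν)) =
          c * (x ^ (-(2 * ν)) * 1 * Real.exp (-(5 / 4))) := by ring
        _ ≤ _ := by
          gcongr
          · exact hy.1.le
          · have := hy.1
            have := hy.2
            nlinarith
  · have hx0 : 0 < x := by linarith
    have := le_exoticMaximal_indicator (𝕜 := 𝕜) hν measurableSet_Ioo h0 hD (t := x ^ 2)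
      (by positivity) hx0 (m := c * Real.exp (-(5 / 4)) * x ^ (-(2 : ℝ))) fun y hy => ?_
    · rwa [hvol, mul_one] at this
    · have hy0 : 0 < y := h0 hy
      refine le_trans ?_ (h (x ^ 2) x y (by positivity) hx0 hy0)
      have e : x ^ (-2 * ν) * (x ^ 2) ^ (ν - 1) = x ^ (-(2 : ℝ)) := by
        rw [← Real.rpow_natCast x 2, ← Real.rpow_mul hx0.le, ← Real.rpow_add hx0]
        congr 1; push_cast; ring
      calc c * Real.exp (-(5 / 4)) * x ^ (-(2 : ℝ)) =
          c * (x ^ (-2 * ν) * 1 * (x ^ 2) ^ (ν - 1) * Real.exp (-(5 / 4))) := by rw [← e]; ring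
        _ ≤ _ := by
          gcongr
          · exact hy.1.le
          · have := hy.1
            have := hy.2
            rw [le_div_iff₀ (by positivity)]
            nlinarith

theorem le_of_isRestrictedWeakType {ν δ p : ℝ} (hν : ν < 1)
    (h : IsRestrictedWeakType (𝕜 := 𝕜) (exoticDomain 𝕜 ν) (exoticMaximal ν) δ p) :
    2 * ν * p - 1 ≤ δ ∧ δ ≤ 2 * p - 1 := by
  obtain ⟨C, hC⟩ := h
  have hfin := powerMeasure_Ioo_lt_top δ (a := 1) (b := 2) one_pos
  obtain ⟨hD, -, hw⟩ := hC (Ioo 1 2) (fun x hx => lt_trans one_pos hx.1) measurableSet_Ioo hfin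
  obtain ⟨c, hc, hnear, hfar⟩ := exists_exoticMaximal_indicator_lower hν hD
  have hM : (C : ℝ≥0∞) * powerMeasure δ (Ioo 1 2) ≠ ∞ :=
    ENNReal.mul_ne_top ENNReal.coe_ne_top hfin.ne
  constructor
  · obtain ⟨M, hM'⟩ := exists_annulus_bound (a := 2 * ν) hc hM hw
    by_contra hcon
    have ht := tendsto_rpow_atTop (show 0 < -(δ + 1 - 2 * ν * p) by linarith)
    obtain ⟨R, hR2, hR⟩ := ((eventually_ge_atTop 2).and (ht.eventually_gt_atTop M)).exists
    have hR0 : 0 < R := by linarith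
    have := hM' R⁻¹ (by positivity) fun x hx => hnear x ((inv_pos.2 hR0).trans hx.1) (by
      refine hx.2.le.trans ?_
      rw [← div_eq_mul_inv, div_le_one hR0]
      exact hR2)
    rw [Real.inv_rpow hR0.le, ← Real.rpow_neg hR0.le] at this
    linarith
  · obtain ⟨M, hM'⟩ := exists_annulus_bound (a := 2) hc hM hw
    by_contra hcon
    have ht := tendsto_rpow_atTop (show 0 < δ + 1 - 2 * p by linarith)
    obtain ⟨R, hR2, hR⟩ := ((eventually_ge_atTop 2).and (ht.eventually_gt_atTop M)).exists
    have hR0 : 0 < R := by linarith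
    have := hM' R hR0 fun x hx => hfar x (hR2.trans hx.1.le)
    linarith

theorem IsStrongType.exists_lintegral_indicator_le {D : Set (ℝ → 𝕜)}
    {T : (ℝ → 𝕜) → ℝ → ℝ≥0∞} {δ p : ℝ} (hp : 0 < p) (h : IsStrongType D T δ (ENNReal.ofReal p)) :
    ∃ C : ℝ≥0, ∀ E : Set ℝ, MeasurableSet E → powerMeasure δ E < ∞ →
      E.indicator (fun _ => (1 : 𝕜)) ∈ D ∧
      ∫⁻ x, T (E.indicator fun _ => (1 : 𝕜)) x ^ p ∂(powerMeasure δ) ≤ C * powerMeasure δ E := by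
  obtain ⟨C, hC⟩ := h
  refine ⟨C ^ p, fun E hE hfin => ?_⟩
  obtain ⟨h1, -, h3⟩ := hC _ (memLp_indicator_const (ENNReal.ofReal p) hE (1 : 𝕜) (Or.inr hfin.ne))
  refine ⟨h1, ?_⟩
  have hp' : ENNReal.ofReal p ≠ 0 := by simpa using hp
  rw [eLpNorm_eq_lintegral_rpow_enorm_toReal hp' ENNReal.ofReal_ne_top,
    eLpNorm_eq_lintegral_rpow_enorm_toReal hp' ENNReal.ofReal_ne_top,
    ENNReal.toReal_ofReal hp.le, lintegral_enorm_indicator_one_rpow δ hp hE] at h3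
  have h4 := ENNReal.rpow_le_rpow h3 hp.le
  rw [ENNReal.mul_rpow_of_nonneg _ _ hp.le, ← ENNReal.rpow_mul, ← ENNReal.rpow_mul,
    one_div, inv_mul_cancel₀ hp.ne', ENNReal.rpow_one, ENNReal.rpow_one] at h4
  rw [ENNReal.coe_rpow_of_nonneg _ hp.le]
  simpa only [enorm_eq_self] using h4

theorem ofReal_log_le_lintegral_rpow {T : ℝ → ℝ≥0∞} {δ p a c u v : ℝ} (hp : 0 < p) (hc : 0 < c)
    (hδ : δ + 1 = a * p) (hu : 0 < u) (huv : u ≤ v)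
    (hT : ∀ x ∈ Ioo u v, ENNReal.ofReal (c * x ^ (-a)) ≤ T x) :
    ENNReal.ofReal (c ^ p * Real.log (v / u)) ≤ ∫⁻ x, T x ^ p ∂(powerMeasure δ) := by
  rw [ENNReal.ofReal_mul (by positivity), ← lintegral_Ioo_inv hu huv,
    ← lintegral_const_mul' _ _ ENNReal.ofReal_ne_top, lintegral_powerMeasure]
  refine (setLIntegral_mono' measurableSet_Ioo fun x hx => ?_).trans
    (lintegral_mono_set fun x hx => hu.trans hx.1)
  have hx0 : 0 < x := hu.trans hx.1
  calc ENNReal.ofReal (c ^ p) * ENNReal.ofReal x⁻¹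
      = ENNReal.ofReal (x ^ δ) * ENNReal.ofReal (c * x ^ (-a)) ^ p := by
        rw [ENNReal.ofReal_rpow_of_pos (by positivity), ← ENNReal.ofReal_mul (by positivity),
          ← ENNReal.ofReal_mul (by positivity), Real.mul_rpow hc.le (by positivity),
          ← Real.rpow_mul hx0.le, ← Real.rpow_neg_one, mul_left_comm, ← Real.rpow_add hx0]
        congr 3; linarith
    _ ≤ _ := by gcongr; exact hT x hx

theorem lt_of_isStrongType {ν δ p : ℝ} (hν : ν < 1) (hp : 1 ≤ p)
    (h : IsStrongType (exoticDomain 𝕜 ν) (exoticMaximal ν) δ (ENNReal.ofReal p)) :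
    2 * ν * p - 1 < δ ∧ δ < 2 * p - 1 := by
  have hp0 : 0 < p := by linarith
  obtain ⟨h1, h2⟩ := le_of_isRestrictedWeakType hν
    ((h.isWeakType hp0).isRestrictedWeakType hp0)
  obtain ⟨C, hC⟩ := h.exists_lintegral_indicator_le hp0
  have hfin := powerMeasure_Ioo_lt_top δ (a := 1) (b := 2) one_pos
  obtain ⟨hD, hI⟩ := hC (Ioo 1 2) measurableSet_Ioo hfin
  obtain ⟨c, hc, hnear, hfar⟩ := exists_exoticMaximal_indicator_lower hν hD
  set M : ℝ≥0∞ := C * powerMeasure δ (Ioo 1 2) with hMdef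
  have hM : M ≠ ∞ := ENNReal.mul_ne_top ENNReal.coe_ne_top hfin.ne
  have hcp : 0 < c ^ p := by positivity
  set L : ℝ := (M.toReal + 1) / c ^ p with hL
  have hL0 : 0 < L := by positivity
  have hLbig : ¬ENNReal.ofReal (c ^ p * L) ≤ M := by
    rw [ENNReal.ofReal_le_iff_le_toReal hM, hL, mul_div_cancel₀ _ hcp.ne']
    linarith
  refine ⟨lt_of_le_of_ne h1 fun he => hLbig ?_, lt_of_le_of_ne h2 fun he => hLbig ?_⟩
  · have := ofReal_log_le_lintegral_rpow (T := exoticMaximal ν ((Ioo (1 : ℝ) 2).indicator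
      fun _ => (1 : 𝕜))) (a := 2 * ν) (δ := δ) (u := Real.exp (-L)) (v := 1) hp0 hc (by linarith)
      (Real.exp_pos _) (Real.exp_le_one_iff.2 (by linarith))
      fun x hx => hnear x ((Real.exp_pos _).trans hx.1) hx.2.le
    rw [one_div, ← Real.exp_neg, neg_neg, Real.log_exp] at this
    exact this.trans hI
  · have := ofReal_log_le_lintegral_rpow (T := exoticMaximal ν ((Ioo (1 : ℝ) 2).indicator
      fun _ => (1 : 𝕜))) (a := 2) (δ := δ) (u := 2) (v := 2 * Real.exp L) hp0 hc (by linarith)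
      two_pos (by linarith [Real.add_one_le_exp L])
      fun x hx => hfar x hx.1.le
    rw [mul_div_cancel_left₀ _ two_ne_zero, Real.log_exp] at this
    exact this.trans hI

/-- For `p > 1` and `δ = 2p - 1`, the functions `y ^ (-2)` cut off near the origin have norms growing like
`L ^ (1 / p)`, while the semigroup at time `1` grows like `L`. -/
theorem lt_of_isWeakType {ν δ p : ℝ} (hν : ν < 1) (hp : 1 < p)
    (h : IsWeakType (exoticDomain 𝕜 ν) (exoticMaximal ν) δ p) : δ < 2 * p - 1 := by
  have hp0 : 0 < p := by linarith
  refine lt_of_le_of_ne (le_of_isRestrictedWeakType hν (h.isRestrictedWeakType hp0)).2 fun hδ => ?_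
  obtain ⟨C, hC⟩ := h
  obtain ⟨c, hc, hlow⟩ := exists_heatDensity_lower_bound hν
  set k : ℝ := c * (2 ^ |-2 * ν|)⁻¹ * Real.exp (-(5 / 4)) with hk
  have hk0 : 0 < k := by positivity
  have hμ : ENNReal.ofReal (2 ^ |δ|)⁻¹ ≤ powerMeasure δ (Ioo 1 2) := by
    rw [powerMeasure_eq_lintegral δ measurableSet_Ioo (fun x hx => lt_trans one_pos hx.1)]
    calc _ = ∫⁻ x in Ioo (1 : ℝ) 2, ENNReal.ofReal (2 ^ |δ|)⁻¹ := by
          rw [setLIntegral_const, Real.volume_Ioo]; norm_num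
      _ ≤ _ := by
          refine setLIntegral_mono' measurableSet_Ioo fun x hx => ENNReal.ofReal_le_ofReal ?_
          rw [inv_le_iff_one_le_mul₀' (by positivity)]
          have := rpow_le_two_rpow_abs_mul (a := δ) one_pos (show 0 < x by linarith [hx.1])
            (by linarith [hx.1]) (by linarith [hx.2])
          rwa [Real.one_rpow] at this
  -- the test functions are `y ^ (-2)` on `(exp (-L), 1)`
  have key : ∀ L : ℝ, 0 < L → (k / 2) ^ p * (2 ^ |δ|)⁻¹ * L ^ (p - 1) ≤ C := by
    intro L hL
    set ε := Real.exp (-L) with hε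
    have hε0 : 0 < ε := Real.exp_pos _
    have hε1 : ε ≤ 1 := Real.exp_le_one_iff.2 (by linarith)
    have hlog : ∫⁻ x in Ioo ε 1, ENNReal.ofReal x⁻¹ = ENNReal.ofReal L := by
      rw [lintegral_Ioo_inv hε0 hε1, hε, one_div, ← Real.exp_neg, neg_neg, Real.log_exp]
    set f : ℝ → 𝕜 := (Ioo ε 1).indicator fun y => ((y ^ (-(2 : ℝ)) : ℝ) : 𝕜) with hf
    have hfm : Measurable f := Measurable.indicator (by fun_prop) measurableSet_Ioo
    have hfe : ∀ y, ‖f y‖ₑ = (Ioo ε 1).indicator (fun y => ENNReal.ofReal (y ^ (-(2 : ℝ)))) y := by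
      intro y
      by_cases hy : y ∈ Ioo ε 1
      · have hy0 : 0 < y := hε0.trans hy.1
        rw [hf, indicator_of_mem hy, indicator_of_mem hy, ← ofReal_norm, RCLike.norm_ofReal,
          abs_of_nonneg (by positivity)]
      · rw [hf, indicator_of_notMem hy, indicator_of_notMem hy, enorm_zero]
    have hnorm : ∫⁻ x, ‖f x‖ₑ ^ p ∂(powerMeasure δ) = ENNReal.ofReal L := by
      rw [← hlog, lintegral_powerMeasure]
      have e : ∀ x ∈ Ioi (0 : ℝ), ENNReal.ofReal (x ^ δ) * ‖f x‖ₑ ^ p =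
          (Ioo ε 1).indicator (fun x => ENNReal.ofReal x⁻¹) x := by
        intro x hx
        have hx : 0 < x := hx
        rw [hfe]
        by_cases hy : x ∈ Ioo ε 1
        · rw [indicator_of_mem hy, indicator_of_mem hy, ENNReal.ofReal_rpow_of_pos (by positivity),
            ← ENNReal.ofReal_mul (by positivity), ← Real.rpow_mul hx.le, ← Real.rpow_add hx,
            ← Real.rpow_neg_one]
          congr 2; rw [hδ]; ring
        · rw [indicator_of_notMem hy, indicator_of_notMem hy, ENNReal.zero_rpow_of_pos hp0, mul_zero]
      rw [setLIntegral_congr_fun measurableSet_Ioi e, lintegral_indicator measurableSet_Ioo,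
        Measure.restrict_restrict measurableSet_Ioo,
        inter_eq_left.2 (show Ioo ε 1 ⊆ Ioi 0 from fun x hx => hε0.trans hx.1)]
    have hmem : MemLp f (ENNReal.ofReal p) (powerMeasure δ) := by
      refine ⟨hfm.aestronglyMeasurable, ?_⟩
      rw [eLpNorm_eq_lintegral_rpow_enorm_toReal (by simpa using hp0) ENNReal.ofReal_ne_top,
        ENNReal.toReal_ofReal hp0.le, hnorm]
      exact ENNReal.rpow_lt_top_of_nonneg (by positivity) ENNReal.ofReal_ne_top
    obtain ⟨hD, -, hw⟩ := hC f hmem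
    have hpos : ∀ y, f y = ((‖f y‖ : ℝ) : 𝕜) := by
      intro y
      by_cases hy : y ∈ Ioo ε 1
      · have hy0 : 0 < y := hε0.trans hy.1
        rw [hf, indicator_of_mem hy, RCLike.norm_ofReal, abs_of_nonneg (by positivity)]
      · rw [hf, indicator_of_notMem hy]; simp
    have hTf : ∀ x ∈ Ioo (1 : ℝ) 2, ENNReal.ofReal (k * L) ≤ exoticMaximal ν f x := by
      intro x hx
      have hx0 : 0 < x := by linarith [hx.1]
      refine le_trans ?_ (posSemigroup_le_exoticMaximal hν hD hpos one_pos hx0)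
      rw [ENNReal.ofReal_mul hk0.le, ← hlog, ← lintegral_const_mul' _ _ ENNReal.ofReal_ne_top,
        posSemigroup]
      refine (setLIntegral_mono' measurableSet_Ioo fun y hy => ?_).trans
        (lintegral_mono_set fun y hy => hε0.trans hy.1)
      have hy0 : 0 < y := hε0.trans hy.1
      rw [hfe, indicator_of_mem hy, ← ENNReal.ofReal_mul hk0.le,
        ← ENNReal.ofReal_mul (heatDensity_nonneg hν one_pos hx0 hy0)]
      refine ENNReal.ofReal_le_ofReal ?_
      have h1 : (2 ^ |-2 * ν|)⁻¹ ≤ x ^ (-2 * ν) := by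
        rw [inv_le_iff_one_le_mul₀' (by positivity)]
        have := rpow_le_two_rpow_abs_mul (a := -2 * ν) one_pos hx0 (by linarith [hx.1]) (by linarith [hx.2])
        rwa [Real.one_rpow] at this
      have h2 : y * y ^ (-(2 : ℝ)) = y⁻¹ := by
        rw [Real.rpow_neg hy0.le, Real.rpow_two]; field_simp
      calc k * y⁻¹ = c * ((2 ^ |-2 * ν|)⁻¹ * y * 1 * Real.exp (-(5 / 4))) * y ^ (-(2 : ℝ)) := by
            rw [← h2, hk]; ring
        _ ≤ c * (x ^ (-2 * ν) * y * (1 : ℝ) ^ (ν - 1) * Real.exp (-(x ^ 2 + y ^ 2) / (4 * 1))) *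
            y ^ (-(2 : ℝ)) := by
            rw [Real.one_rpow]
            gcongr
            have := hx.1
            have := hx.2
            have := hy.2
            nlinarith
        _ ≤ _ := by gcongr; exact hlow 1 x y one_pos hx0 hy0
    have hs : 0 < k / 2 * L := by positivity
    have h1 := hw _ hs
    rw [hnorm] at h1
    have h2 : ENNReal.ofReal ((k / 2 * L) ^ p) * ENNReal.ofReal (2 ^ |δ|)⁻¹ ≤
        C * ENNReal.ofReal L := by
      refine le_trans (mul_le_mul' le_rfl (hμ.trans (measure_mono fun x hx => ?_))) h1
      refine ⟨lt_trans one_pos hx.1, lt_of_lt_of_le ?_ (hTf x hx)⟩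
      rw [ENNReal.ofReal_lt_ofReal_iff (by positivity)]
      nlinarith [mul_pos hk0 hL]
    rw [← ENNReal.ofReal_mul (by positivity), ← ENNReal.ofReal_coe_nnreal,
      ← ENNReal.ofReal_mul C.coe_nonneg, ENNReal.ofReal_le_ofReal_iff (by positivity),
      Real.mul_rpow (by positivity) hL.le] at h2
    refine le_of_mul_le_mul_right (le_trans (le_of_eq ?_) h2) hL
    rw [mul_assoc, mul_assoc, ← Real.rpow_add_one hL.ne', sub_add_cancel]
    ring
  have ht := (tendsto_rpow_atTop (show 0 < p - 1 by linarith)).const_mul_atTop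
    (show 0 < (k / 2) ^ p * (2 ^ |δ|)⁻¹ by positivity)
  obtain ⟨L, hL0, hL⟩ := ((eventually_gt_atTop 0).and (ht.eventually_gt_atTop (C : ℝ))).exists
  exact absurd (key L hL0) (not_le.2 hL)

/-- At unit distance from the origin the kernel is bounded below by a multiple of `|x - y|⁻¹` for a
suitable time, as for the Gauss–Weierstrass kernel. -/
theorem exists_heatDensity_near_diagonal {ν : ℝ} (hν : ν < 1) :
    ∃ k : ℝ, 0 < k ∧ ∀ x y : ℝ, 1 < y → y < x → x < 3 / 2 →
      ∀ z : ℝ, x - y ≤ z → z ≤ 1 / 2 → k * z⁻¹ ≤ heatDensity ν (z ^ 2) x y := by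
  obtain ⟨c, _, hc, _, h⟩ := exists_heatDensity_bounds hν
  refine ⟨c * (2 ^ |-2 * ν|)⁻¹ * (2 ^ |-(ν - 1 / 2)|)⁻¹ * Real.exp (-(1 / 4)), by positivity,
    fun x y hy hxy hx z hz hz2 => ?_⟩
  have hx0 : 0 < x := by linarith
  have hy0 : 0 < y := by linarith
  have hz0 : 0 < z := by linarith
  set t := z ^ 2 with ht
  have ht0 : 0 < t := by positivity
  have ht1 : t ≤ 1 / 4 := by rw [ht]; nlinarith
  refine le_trans ?_ (h t x y ht0 hx0 hy0).1
  have h1 : (2 ^ |-2 * ν|)⁻¹ ≤ x ^ (-2 * ν) := by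
    rw [inv_le_iff_one_le_mul₀' (by positivity)]
    have := rpow_le_two_rpow_abs_mul (a := -2 * ν) one_pos hx0 (by linarith) (by linarith)
    rwa [Real.one_rpow] at this
  set a := ν - 1 / 2 with ha
  have hw : 0 < 1 + x * y / (2 * t) := by positivity
  have h2 : (2 ^ |-a|)⁻¹ * t ^ (-a) ≤ (1 + x * y / (2 * t)) ^ a := by
    have hxy9 : x * y ≤ 9 / 4 := by nlinarith
    have hxy1 : 1 ≤ x * y := by nlinarith
    have hcomp : t ^ (-a) ≤ 2 ^ |-a| * ((1 + x * y / (2 * t))⁻¹) ^ (-a) := by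
      have e : (1 + x * y / (2 * t))⁻¹ = 2 * t / (2 * t + x * y) := by field_simp
      refine rpow_le_two_rpow_abs_mul ht0 (by positivity) ?_ ?_ <;> rw [e]
      · rw [← mul_div_assoc, le_div_iff₀ (by positivity)]; nlinarith
      · rw [div_le_iff₀ (by positivity)]; nlinarith
    rw [inv_mul_le_iff₀ (by positivity)]
    rwa [Real.inv_rpow hw.le, Real.rpow_neg hw.le, inv_inv] at hcomp
  have h3 : Real.exp (-(1 / 4)) ≤ Real.exp (-(x - y) ^ 2 / (4 * t)) := by
    gcongr
    rw [le_div_iff₀ (by positivity), ht]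
    have : (x - y) ^ 2 ≤ z ^ 2 := pow_le_pow_left₀ (by linarith) hz 2
    linarith
  have h4 : t ^ (ν - 1) * t ^ (-a) = z⁻¹ := by
    rw [← Real.rpow_add ht0, ht, ← Real.rpow_natCast z 2, ← Real.rpow_mul hz0.le,
      ← Real.rpow_neg_one, ha]
    congr 1; push_cast; ring
  calc _ = c * ((2 ^ |-2 * ν|)⁻¹ * 1 * t ^ (ν - 1) * ((2 ^ |-a|)⁻¹ * t ^ (-a)) *
        Real.exp (-(1 / 4))) := by rw [← h4]; ring
    _ ≤ _ := by gcongr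

/-- On characteristic functions of intervals `(1, 1 + ε)` the maximal function is at least a multiple
of `ε / (x - 1)`, whose integral exceeds the norm by a factor `log (1 / ε)`. -/
theorem not_isStrongType_one {ν δ : ℝ} (hν : ν < 1) :
    ¬IsStrongType (exoticDomain 𝕜 ν) (exoticMaximal (𝕜 := 𝕜) ν) δ (ENNReal.ofReal 1) := by
  intro h
  obtain ⟨C, hC⟩ := h.exists_lintegral_indicator_le one_pos
  obtain ⟨k, hk, hker⟩ := exists_heatDensity_near_diagonal hν
  set K : ℝ := 2 ^ |δ| with hK
  have hK0 : 0 < K := by positivity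
  -- the test functions are the characteristic functions of `(1, 1 + ε)` with `ε = exp (-L) / 2`
  have key : ∀ L : ℝ, 0 < L → K⁻¹ * k * L ≤ C * K := by
    intro L hL
    set ε := Real.exp (-L) / 2 with hε
    have hε0 : 0 < ε := by positivity
    have hε1 : ε < 1 / 2 := by
      rw [hε]; linarith [Real.exp_lt_one_iff.2 (show -L < 0 by linarith)]
    set E := Ioo 1 (1 + ε) with hE
    have hE0 : E ⊆ Ioi 0 := fun x hx => lt_trans one_pos hx.1
    obtain ⟨hD, hI⟩ := hC E measurableSet_Ioo (powerMeasure_Ioo_lt_top δ one_pos)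
    simp only [ENNReal.rpow_one] at hI
    have hvol : volume E = ENNReal.ofReal ε := by rw [hE, Real.volume_Ioo, add_sub_cancel_left]
    have hup : powerMeasure δ E ≤ ENNReal.ofReal (K * ε) := by
      rw [powerMeasure_eq_lintegral δ measurableSet_Ioo hE0, ENNReal.ofReal_mul hK0.le, ← hvol,
        ← setLIntegral_const]
      refine setLIntegral_mono' measurableSet_Ioo fun x hx => ENNReal.ofReal_le_ofReal ?_
      have := rpow_le_two_rpow_abs_mul (a := δ) (hE0 hx) one_pos (by linarith [hx.2]) (by linarith [hx.1])
      rwa [Real.one_rpow, mul_one] at this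
    have hlow : ENNReal.ofReal (K⁻¹ * (k * ε) * L) ≤
        ∫⁻ x, exoticMaximal ν (E.indicator fun _ => (1 : 𝕜)) x ∂(powerMeasure δ) := by
      have hlog : ∫⁻ x in Ioo (ε + 1) (1 / 2 + 1), ENNReal.ofReal (x - 1)⁻¹ =
          ENNReal.ofReal L := by
        rw [lintegral_Ioo_inv_sub 1 hε0 hε1.le, hε, div_div_div_cancel_right₀ two_ne_zero, one_div,
          ← Real.exp_neg, neg_neg, Real.log_exp]
      rw [ENNReal.ofReal_mul (by positivity), ← hlog,
        ← lintegral_const_mul' _ _ ENNReal.ofReal_ne_top, lintegral_powerMeasure]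
      refine (setLIntegral_mono' measurableSet_Ioo fun x hx => ?_).trans
        (lintegral_mono_set fun x hx => lt_trans (by linarith) hx.1)
      have hx1 : 1 + ε < x := by linarith [hx.1]
      have hx2 : x < 3 / 2 := by linarith [hx.2]
      have hx0 : 0 < x := by linarith
      have hz : 0 < x - 1 := by linarith
      have h1 := le_exoticMaximal_indicator (𝕜 := 𝕜) hν measurableSet_Ioo hE0 hD
        (t := (x - 1) ^ 2) (by positivity) hx0 (m := k * (x - 1)⁻¹) fun y hy =>
          hker x y hy.1 (hy.2.trans hx1) hx2 (x - 1) (by linarith [hy.1]) (by linarith)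
      rw [hvol, ← ENNReal.ofReal_mul (by positivity)] at h1
      have h2 : K⁻¹ ≤ x ^ δ := by
        rw [inv_le_iff_one_le_mul₀' (by positivity)]
        have := rpow_le_two_rpow_abs_mul (a := δ) one_pos hx0 (by linarith) (by linarith)
        rwa [Real.one_rpow] at this
      calc ENNReal.ofReal (K⁻¹ * (k * ε)) * ENNReal.ofReal (x - 1)⁻¹
          = ENNReal.ofReal K⁻¹ * ENNReal.ofReal (k * (x - 1)⁻¹ * ε) := by
            rw [← ENNReal.ofReal_mul (by positivity), ← ENNReal.ofReal_mul (by positivity)]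
            congr 1; ring
        _ ≤ _ := by gcongr
    have h3 := (hlow.trans hI).trans (mul_le_mul' le_rfl hup)
    rw [← ENNReal.ofReal_coe_nnreal, ← ENNReal.ofReal_mul C.coe_nonneg,
      ENNReal.ofReal_le_ofReal_iff (by positivity)] at h3
    refine le_of_mul_le_mul_right (le_trans (le_of_eq ?_) (h3.trans (le_of_eq ?_))) hε0 <;> ring
  have h1 := key (C * K * K * k⁻¹ + 1) (by positivity)
  have h2 : K⁻¹ * k * (C * K * K * k⁻¹ + 1) = C * K + K⁻¹ * k := by field_simp
  rw [h2] at h1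
  linarith [show 0 < K⁻¹ * k by positivity]

/-- For `ν > 0` the semigroup maps the constant `1` to functions growing like `t ^ ν` near the origin. -/
theorem neg_of_isStrongType_top {ν δ : ℝ} (hν0 : ν ≠ 0) (hν : ν < 1)
    (h : IsStrongType (exoticDomain 𝕜 ν) (exoticMaximal (𝕜 := 𝕜) ν) δ ∞) : ν < 0 := by
  by_contra hneg
  have hν' : 0 < ν := lt_of_le_of_ne (not_lt.1 hneg) hν0.symm
  obtain ⟨C, hC⟩ := h
  obtain ⟨hD, -, hb⟩ := hC (fun _ => 1) (memLp_top_const 1)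
  obtain ⟨c, hc, hlow⟩ := exists_heatDensity_lower_bound hν
  set k := c * Real.exp (-(5 / 4)) with hk
  have hk0 : 0 < k := by positivity
  have hT : ∀ x : ℝ, 0 < x → x < 1 → exoticMaximal ν (fun _ => (1 : 𝕜)) x = ∞ := by
    intro x hx0 hx1
    have hbd : ∀ t : ℝ, 1 ≤ t →
        ENNReal.ofReal (k * t ^ ν) ≤ exoticMaximal ν (fun _ => (1 : 𝕜)) x := by
      intro t ht
      have ht0 : 0 < t := by linarith
      have hs0 : 0 < √t := Real.sqrt_pos.2 ht0
      have hs2 : √t ^ 2 = t := Real.sq_sqrt ht0.le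
      refine le_trans ?_ (posSemigroup_le_exoticMaximal hν hD (by simp) ht0 hx0)
      rw [posSemigroup]
      have e : k * t ^ ν = k * (√t * t ^ (ν - 1)) * √t := by
        rw [show k * (√t * t ^ (ν - 1)) * √t = k * (t ^ (ν - 1) * √t ^ 2) by ring, hs2,
          ← Real.rpow_add_one ht0.ne', sub_add_cancel]
      have hvol : volume (Ioo √t (2 * √t)) = ENNReal.ofReal √t := by
        rw [Real.volume_Ioo]; congr 1; ring
      rw [e, ENNReal.ofReal_mul (by positivity), ← hvol, ← setLIntegral_const]
      refine (setLIntegral_mono' measurableSet_Ioo fun y hy => ?_).trans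
        (lintegral_mono_set fun y hy => hs0.trans hy.1)
      have hy0 : 0 < y := hs0.trans hy.1
      rw [enorm_one, mul_one]
      refine ENNReal.ofReal_le_ofReal (le_trans ?_ (hlow t x y ht0 hx0 hy0))
      have h1 : 1 ≤ x ^ (-2 * ν) :=
        Real.one_le_rpow_of_pos_of_le_one_of_nonpos hx0 hx1.le (by linarith)
      calc k * (√t * t ^ (ν - 1)) = c * (1 * √t * t ^ (ν - 1) * Real.exp (-(5 / 4))) := by
            rw [hk]; ring
        _ ≤ _ := by
            gcongr
            · exact hy.1.le
            · rw [le_div_iff₀ (by positivity)]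
              have h2 : y ^ 2 ≤ 4 * t := by
                calc y ^ 2 ≤ (2 * √t) ^ 2 := by gcongr; exact hy.2.le
                  _ = 4 * t := by rw [mul_pow, hs2]; norm_num
              nlinarith
    refine ENNReal.eq_top_of_forall_nnreal_le fun r => ?_
    obtain ⟨t, ht1, ht⟩ := ((eventually_ge_atTop 1).and
      (((tendsto_rpow_atTop hν').const_mul_atTop hk0).eventually_ge_atTop (r : ℝ))).exists
    refine le_trans ?_ (hbd t ht1)
    rw [← ENNReal.ofReal_coe_nnreal]
    exact ENNReal.ofReal_le_ofReal ht
  have hfin : eLpNorm (exoticMaximal ν fun _ => (1 : 𝕜)) ∞ (powerMeasure δ) < ∞ :=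
    hb.trans_lt (ENNReal.mul_lt_top ENNReal.coe_lt_top (memLp_top_const 1).2)
  rw [eLpNorm_exponent_top] at hfin
  have hae : ∀ᵐ x ∂(powerMeasure δ), exoticMaximal ν (fun _ => (1 : 𝕜)) x < ∞ := by
    filter_upwards [enorm_ae_le_eLpNormEssSup (exoticMaximal ν fun _ => (1 : 𝕜))
      (powerMeasure δ)] with x hx
    exact hx.trans_lt hfin
  have hae' : ∀ᵐ x ∂(volume.restrict (Ioo (0 : ℝ) 1)),
      exoticMaximal ν (fun _ => (1 : 𝕜)) x < ∞ :=
    ae_restrict_of_ae_restrict_of_subset Ioo_subset_Ioi_self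
      ((absolutelyContinuous_powerMeasure δ).ae_le hae)
  have : (ae (volume.restrict (Ioo (0 : ℝ) 1))).NeBot := by
    rw [ae_neBot, Ne, Measure.restrict_eq_zero, Real.volume_Ioo]; simp
  obtain ⟨x, hx, hx01⟩ := (hae'.and (ae_restrict_mem measurableSet_Ioo)).exists
  exact hx.ne (hT x hx01.1 hx01.2)

end Necessity

theorem theorem3p2 {𝕜 : Type*} [RCLike 𝕜] (ν : ℝ) (hν0 : ν ≠ 0) (hν1 : ν < 1) (δ : ℝ) :
    (∀ p : ℝ, 1 ≤ p →
      (IsStrongType (exoticDomain 𝕜 ν) (exoticMaximal ν) δ (ENNReal.ofReal p) ↔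
        1 < p ∧ 2 * ν * p - 1 < δ ∧ δ < 2 * p - 1) ∧
      (IsWeakType (exoticDomain 𝕜 ν) (exoticMaximal ν) δ p ↔
        2 * ν * p - 1 ≤ δ ∧ (δ < 2 * p - 1 ∨ (p = 1 ∧ δ ≤ 2 * p - 1))) ∧
      (IsRestrictedWeakType (exoticDomain 𝕜 ν) (exoticMaximal ν) δ p ↔
        2 * ν * p - 1 ≤ δ ∧ δ ≤ 2 * p - 1)) ∧
    (IsStrongType (exoticDomain 𝕜 ν) (exoticMaximal ν) δ ∞ ↔ ν < 0) := by
  refine ⟨fun p hp => ⟨⟨fun h => ⟨?_, lt_of_isStrongType hν1 hp h⟩, fun h =>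
    isStrongType_of_lt hν1 hν0 h.1 h.2.1 h.2.2⟩, ⟨fun h => ?_, fun h =>
    isWeakType_of_le hν1 hν0 hp h.1 h.2⟩, ⟨fun h => le_of_isRestrictedWeakType hν1 h, fun h =>
    isRestrictedWeakType_of_le hν1 hν0 hp h.1 h.2⟩⟩, ⟨fun h => neg_of_isStrongType_top hν0 hν1 h,
    fun h => isStrongType_top_of_neg h δ⟩⟩
  · refine lt_of_le_of_ne hp ?_
    rintro rfl
    exact not_isStrongType_one hν1 h
  · obtain ⟨h1, h2⟩ := le_of_isRestrictedWeakType hν1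
      (h.isRestrictedWeakType (by linarith))
    rcases hp.eq_or_lt with rfl | hp
    · exact ⟨h1, Or.inr ⟨rfl, h2⟩⟩
    · exact ⟨h1, Or.inl (lt_of_isWeakType hν1 hp h)⟩
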